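/- **Theorem (CKY structures).** Let $(V_4,g)$ be an oriented smooth four-dimensional spacetime of signature $(-+++)$, with Levi-Civita connection $\nabla$, volume element $\eta$, Hodge dual $*$ (so $(*A)_{\alpha\beta}=\tfrac12\eta_{\alpha\beta\mu\nu}A^{\mu\nu}$ on 2-forms) and codifferential $\delta=*d*$, where for 3-forms $(*B)_\lambda=\tfrac1{3!}B^{\alpha\beta\gamma}\eta_{\alpha\beta\gamma\lambda}$ (thus $(\delta A)_\mu=-\nabla^\alpha A_{\alpha\mu}$). For a 1-form $w$ and a covariant tensor $T$, $i(w)T$ is the contraction of $w$ with the first index of $T$. Let $U$ be a smooth unitary 2-form, i.e. at each point the volume element of a time-like plane $V$; the planes $V$ and $H=V^\perp$ form a 2+2 structure with projectors $v=U^2$ and $h=g-v$. Put $\mathcal U=\frac1{\sqrt2}(U-\mathrm i *U)$, $\mathcal G=\frac12(G-\mathrm i\,\eta)$ with $G_{\alpha\beta\mu\nu}=g_{\alpha\mu}g_{\beta\nu}-g_{\alpha\nu}g_{\beta\mu}$, and $$\Sigma[U]=\nabla\mathcal U-i(\delta\mathcal U)\,\mathcal U\otimes\mathcal U-i(\delta\mathcal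 U)\,\mathcal G,$$ $$\Phi[U]=i(\delta U)U-i(\delta *U)*U,\qquad \Psi[U]=-i(\delta U)*U-i(\delta *U)U .$$ A 2-form $A$ is a *conformal Killing-Yano (CKY) tensor* if $$\nabla_{(\alpha}A_{\beta)\mu}=g_{\alpha\beta}a_\mu-a_{(\alpha}g_{\beta)\mu},\qquad 3a=-\delta A,$$ and a *Maxwell field* if $\delta A=0$ and $\delta *A=0$. It is *regular* if $A^{\alpha\beta}A_{\alpha\beta}$ and $A^{\alpha\beta}(*A)_{\alpha\beta}$ do not vanish simultaneously; $U$ is a *canonical 2-form* of $A$ if at each point $A=e^{\phi}[\cos\psi\,U+\sin\psi *U]$ for some real $\phi,\psi$. We say that $U$ *defines a CKY structure* (respectively *a maxwellian structure*) if every point has an open neighbourhood with a smooth regular CKY tensor (respectively Maxwell field) on it of which $U$ is a canonical 2-form. The structure is *umbilical* if, for each of the two plane fields $V$ and $H$, the symmetric part of the second fundamental form (for $V$: $(x,y)\mapsto h(\nabla_{x}y)$ with $x,y$ tangent to $V$) is proportional to the induced metric, i.e. equal to the induced metric times a normal vector. Then: 1. $U$ defines a CKY structure if, and only if, its 2+2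 structure is umbilical and maxwellian. 2. $U$ defines a CKY structure if, and only if, $$\Sigma[U]=0,\qquad d\Phi[U]=0,\qquad d\Psi[U]=0 .$$ 3. Suppose that $U$ satisfies these three equations. Then every point has an open neighbourhood on which there are smooth functions $\phi,\psi$ with $-2\,d\phi=\Phi[U]$ and $-2\,d\psi=\Psi[U]$. Moreover, for any smooth functions $\phi,\psi$ with these two properties on an open set $W$, the 2-form $A=e^{\phi}[\cos\psi\,U+\sin\psi *U]$ is a regular CKY tensor on $W$. -/

import Mathlib

open scoped Manifold ContDiff

namespace CKY

/-- The model space of a four-dimensional manifold. -/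
abbrev R4 := EuclideanSpace ℝ (Fin 4)

noncomputable section

/-! ### Tensor calculus in a coordinate domain of `ℝ⁴`

Tensors are given by their covariant components with respect to the coordinate frame. `G` is the
matrix `g_{ij}` of a metric at a point, `V i j k l` are the components `η_{ijkl}` of its volume
element at that point, `g` is the field of matrices `g_{ij}`. -/

/-- The partial derivative `∂_i f` at `x`. -/
def pd (i : Fin 4) (f : R4 → ℝ) (x : R4) : ℝ :=
  fderiv ℝ f x (EuclideanSpace.single i 1)

/-- The Christoffel symbol `Γ^k_{ij}` of the Levi-Civita connection of `g`. -/
def christoffel (g : R4 → Matrix (Fin 4) (Fin 4) ℝ) (x : R4) (k i j : Fin 4) : ℝ :=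
  (1 / 2) * ∑ l, (g x)⁻¹ k l *
    (pd i (fun y => g y j l) x + pd j (fun y => g y i l) x - pd l (fun y => g y i j) x)

/-- The covariant derivative `∇_k A_{ij}` of a covariant 2-tensor. -/
def nabla (g : R4 → Matrix (Fin 4) (Fin 4) ℝ) (A : R4 → Fin 4 → Fin 4 → ℝ) (x : R4)
    (k i j : Fin 4) : ℝ :=
  pd k (fun y => A y i j) x - ∑ l, christoffel g x l k i * A x l j
    - ∑ l, christoffel g x l k j * A x i l

/-- The exterior derivative of a 1-form, `∂_i w_j - ∂_j w_i`. -/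
def dOne (w : R4 → Fin 4 → ℝ) (x : R4) (i j : Fin 4) : ℝ :=
  pd i (fun y => w y j) x - pd j (fun y => w y i) x

/-- The exterior derivative of a 2-form, `∂_i A_{jk} + ∂_j A_{ki} + ∂_k A_{ij}`. -/
def dTwo (A : R4 → Fin 4 → Fin 4 → ℝ) (x : R4) (i j k : Fin 4) : ℝ :=
  pd i (fun y => A y j k) x + pd j (fun y => A y k i) x + pd k (fun y => A y i j) x

/-- The Hodge dual of a 3-form, `(*B)_l = (1/3!) B^{ijk} η_{ijkl}`. -/
def starThree (G : Matrix (Fin 4) (Fin 4) ℝ) (V : Fin 4 → Fin 4 → Fin 4 → Fin 4 → ℝ)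
    (B : Fin 4 → Fin 4 → Fin 4 → ℝ) (l : Fin 4) : ℝ :=
  (1 / 6) * ∑ i, ∑ j, ∑ k, ∑ a, ∑ b, ∑ c,
    G⁻¹ i a * G⁻¹ j b * G⁻¹ k c * B a b c * V i j k l

/-- The interior product `(i(w)A)_j = w^i A_{ij}`, for real or complex components. -/
def interior {R : Type*} [CommRing R] [Algebra ℝ R] (G : Matrix (Fin 4) (Fin 4) ℝ)
    (w : Fin 4 → R) (A : Fin 4 → Fin 4 → R) (j : Fin 4) : R :=
  ∑ i, ∑ a, G⁻¹ i a • (w a * A i j)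

/-- The self-dual metric `𝒢 = ½ (G - i η)` on 2-forms,
where `G_{abmn} = g_{am} g_{bn} - g_{an} g_{bm}`. -/
def selfDualMetric (G : Matrix (Fin 4) (Fin 4) ℝ) (V : Fin 4 → Fin 4 → Fin 4 → Fin 4 → ℝ)
    (a b m n : Fin 4) : ℂ :=
  (1 / 2) * (((G a m * G b n - G a n * G b m : ℝ) : ℂ) - Complex.I * ((V a b m n : ℝ) : ℂ))

/-- The complex combination `(1/√2) (s - i t)`. -/
def selfDual (s t : ℝ) : ℂ :=
  ((1 / √2 : ℝ) : ℂ) * ((s : ℂ) - Complex.I * (t : ℂ))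

/-- For a plane field with covariant projector `P` whose orthogonal complement has covariant
projector `Q`, the tensor `(x, y, z) ↦ g(∇_{Px} (Py), Qz) = (∇_{Px} P)(Py, Qz)`. -/
def secondFF (g : R4 → Matrix (Fin 4) (Fin 4) ℝ) (P Q : R4 → Fin 4 → Fin 4 → ℝ) (x : R4)
    (i j k : Fin 4) : ℝ :=
  ∑ a, ∑ b, ∑ c, ((g x)⁻¹ * Matrix.of (P x)) a i * ((g x)⁻¹ * Matrix.of (P x)) b j *
    ((g x)⁻¹ * Matrix.of (Q x)) c k * nabla g P x a b c

/-- The plane field with projector `P` (and complementary projector `Q`) is umbilical at `x`: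
the symmetric part of its second fundamental form is proportional to its induced metric. -/
def UmbilicalPlaneAt (g : R4 → Matrix (Fin 4) (Fin 4) ℝ) (P Q : R4 → Fin 4 → Fin 4 → ℝ)
    (x : R4) : Prop :=
  ∃ c : Fin 4 → ℝ, ∀ i j k,
    (1 / 2) * (secondFF g P Q x i j k + secondFF g P Q x j i k) = P x i j * c k

end

/-! ### Tensor fields on a four-dimensional manifold -/

/-- The matrix `diag(-1, 1, 1, 1)`. -/
def minkowski : Matrix (Fin 4) (Fin 4) ℝ := Matrix.diagonal ![-1, 1, 1, 1]

noncomputable section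

/-- The coordinate vector `∂_i` of the chart `e`, at the point with coordinates `x`. -/
def coordVec {M : Type*} [TopologicalSpace M] [ChartedSpace R4 M]
    (e : OpenPartialHomeomorph M R4) (x : R4) (i : Fin 4) :
    TangentSpace (𝓡 4) (e.symm x) :=
  mfderiv (𝓡 4) (𝓡 4) e.symm x (EuclideanSpace.single i (1 : ℝ) : R4)

/-- A basis of the tangent space at `p` (the coordinate basis of the preferred chart at `p`). It
only serves to write contractions; these do not depend on it. -/
def stdBasis {M : Type*} [TopologicalSpace M] [ChartedSpace R4 M] (p : M) :
    Module.Basis (Fin 4) ℝ (TangentSpace (𝓡 4) p) :=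
  (EuclideanSpace.basisFun (Fin 4) ℝ).toBasis

/-- The charts of the manifold: all the elements of its maximal smooth atlas. -/
def charts (M : Type*) [TopologicalSpace M] [ChartedSpace R4 M] :
    Set (OpenPartialHomeomorph M R4) :=
  IsManifold.maximalAtlas (𝓡 4) ∞ M

/-- A field of bilinear forms on the tangent spaces. -/
abbrev BilinField (M : Type*) [TopologicalSpace M] [ChartedSpace R4 M] :=
  ∀ p : M, LinearMap.BilinForm ℝ (TangentSpace (𝓡 4) p)

/-- A field of alternating 2-forms. -/
abbrev TwoForm (M : Type*) [TopologicalSpace M] [ChartedSpace R4 M] :=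
  ∀ p : M, TangentSpace (𝓡 4) p [⋀^Fin 2]→ₗ[ℝ] ℝ

/-- A field of alternating 4-forms. -/
abbrev FourForm (M : Type*) [TopologicalSpace M] [ChartedSpace R4 M] :=
  ∀ p : M, TangentSpace (𝓡 4) p [⋀^Fin 4]→ₗ[ℝ] ℝ

/-- The components in the chart `e` of a field of bilinear forms. -/
def bilinComp {M : Type*} [TopologicalSpace M] [ChartedSpace R4 M]
    (e : OpenPartialHomeomorph M R4) (B : BilinField M) (x : R4) : Matrix (Fin 4) (Fin 4) ℝ :=
  Matrix.of fun i j => B (e.symm x) (coordVec e x i) (coordVec e x j)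

/-- The components in the chart `e` of a 2-form. -/
def twoComp {M : Type*} [TopologicalSpace M] [ChartedSpace R4 M]
    (e : OpenPartialHomeomorph M R4) (A : TwoForm M) (x : R4) (i j : Fin 4) : ℝ :=
  A (e.symm x) ![coordVec e x i, coordVec e x j]

/-- The components in the chart `e` of a 4-form. -/
def fourComp {M : Type*} [TopologicalSpace M] [ChartedSpace R4 M]
    (e : OpenPartialHomeomorph M R4) (V : FourForm M) (x : R4) (i j k l : Fin 4) : ℝ :=
  V (e.symm x) ![coordVec e x i, coordVec e x j, coordVec e x k, coordVec e x l]

/-- A 2-form is smooth on `W` when its components in every chart are. -/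
def SmoothOn {M : Type*} [TopologicalSpace M] [ChartedSpace R4 M]
    (A : TwoForm M) (W : Set M) : Prop :=
  ∀ e ∈ charts M, ∀ i j,
    ContDiffOn ℝ ∞ (fun x => twoComp e A x i j) (e.target ∩ e.symm ⁻¹' W)

/-- An oriented spacetime structure on a 4-manifold: a smooth metric of signature `(-+++)` and its
volume element for one of the orientations, i.e. a smooth 4-form with value `1` or `-1` on every
orthonormal frame. -/
structure OrientedSpacetime (M : Type*) [TopologicalSpace M] [ChartedSpace R4 M] where
  metric : BilinField M
  metric_symm : ∀ p x y, metric p x y = metric p y x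
  metric_lorentzian : ∀ p, ∃ b : Module.Basis (Fin 4) ℝ (TangentSpace (𝓡 4) p),
    ∀ i j, metric p (b i) (b j) = minkowski i j
  metric_smooth : ∀ e ∈ charts M, ∀ i j,
    ContDiffOn ℝ ∞ (fun x => bilinComp e metric x i j) e.target
  vol : FourForm M
  vol_orthonormal : ∀ p (b : Fin 4 → TangentSpace (𝓡 4) p),
    (∀ i j, metric p (b i) (b j) = minkowski i j) → vol p b = 1 ∨ vol p b = -1
  vol_smooth : ∀ e ∈ charts M, ∀ i j k l,
    ContDiffOn ℝ ∞ (fun x => fourComp e vol x i j k l) e.target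

namespace OrientedSpacetime

variable {M : Type*} [TopologicalSpace M] [ChartedSpace R4 M]

/-! #### Algebra of 2-forms -/

/-- The contravariant components `A^{kl}` of a 2-form at `p`, in the basis `stdBasis p`. -/
def raise (S : OrientedSpacetime M) (A : TwoForm M) (p : M) (k l : Fin 4) : ℝ :=
  let Ginv := (Matrix.of fun i j => S.metric p (stdBasis p i) (stdBasis p j))⁻¹
  ∑ a, ∑ b, Ginv k a * Ginv l b * A p ![stdBasis p a, stdBasis p b]

/-- The Hodge dual of a 2-form, `*A = ½ A^{kl} η(∂_k, ∂_l, ·, ·)`. -/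
def star (S : OrientedSpacetime M) (A : TwoForm M) : TwoForm M := fun p =>
  (1 / 2 : ℝ) • ∑ k, ∑ l, S.raise A p k l •
    ((S.vol p).curryLeft (stdBasis p k)).curryLeft (stdBasis p l)

/-- The scalar `A^{kl} B_{kl}`. -/
def contract (S : OrientedSpacetime M) (A B : TwoForm M) (p : M) : ℝ :=
  ∑ k, ∑ l, S.raise A p k l * B p ![stdBasis p k, stdBasis p l]

/-- A 2-form is regular (non-null) at `p` when its two scalar invariants `A^{kl} A_{kl}` and
`A^{kl} (*A)_{kl}` do not both vanish. -/
def RegularAt (S : OrientedSpacetime M) (A : TwoForm M) (p : M) : Prop :=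
  S.contract A A p ≠ 0 ∨ S.contract A (S.star A) p ≠ 0

/-- `U` is a smooth unitary 2-form: at every point it is the volume element (for one of the two
orientations) of a time-like plane, spanned by orthonormal vectors `u` (time-like) and `w`. -/
def IsUnitary (S : OrientedSpacetime M) (U : TwoForm M) : Prop :=
  SmoothOn U Set.univ ∧ ∀ p, ∃ u w : TangentSpace (𝓡 4) p,
    S.metric p u u = -1 ∧ S.metric p w w = 1 ∧ S.metric p u w = 0 ∧
    ∀ x y, U p ![x, y] =
      S.metric p u x * S.metric p w y - S.metric p u y * S.metric p w x

/-- The 2-form `e^φ (cos ψ U + sin ψ *U)`. -/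
def canonical (S : OrientedSpacetime M) (U : TwoForm M) (φ ψ : M → ℝ) : TwoForm M := fun p =>
  Real.exp (φ p) • (Real.cos (ψ p) • U p + Real.sin (ψ p) • S.star U p)

/-- `U` is a canonical unitary 2-form of `A` on `W`, i.e. the principal planes of `A` are the planes
of the 2+2 structure of `U`: at each point of `W`, `A` is `e^φ (cos ψ U + sin ψ *U)` for some real
numbers `φ, ψ`. -/
def HasCanonicalForm (S : OrientedSpacetime M) (U A : TwoForm M) (W : Set M) : Prop :=
  ∀ p ∈ W, ∃ φ ψ : ℝ, A p = Real.exp φ • (Real.cos ψ • U p + Real.sin ψ • S.star U p)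

/-! #### Differential concomitants, in the chart `e` -/

/-- The components `g_{ij}` of the metric in the chart `e`. -/
def g (S : OrientedSpacetime M) (e : OpenPartialHomeomorph M R4) (x : R4) :
    Matrix (Fin 4) (Fin 4) ℝ :=
  bilinComp e S.metric x

/-- The components `η_{ijkl}` of the volume element in the chart `e`. -/
def eta (S : OrientedSpacetime M) (e : OpenPartialHomeomorph M R4) (x : R4) :
    Fin 4 → Fin 4 → Fin 4 → Fin 4 → ℝ :=
  fourComp e S.vol x

/-- The covariant derivative `∇_k A_{ij}` of a 2-form, in the chart `e`. -/
def nablaTwo (S : OrientedSpacetime M) (e : OpenPartialHomeomorph M R4) (A : TwoForm M) (x : R4)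
    (k i j : Fin 4) : ℝ :=
  nabla (S.g e) (twoComp e A) x k i j

/-- The exterior codifferential `δA = *d*A` of a 2-form, in the chart `e`. -/
def codiff (S : OrientedSpacetime M) (e : OpenPartialHomeomorph M R4) (A : TwoForm M) (x : R4) :
    Fin 4 → ℝ :=
  starThree (S.g e x) (S.eta e x) (dTwo (twoComp e (S.star A)) x)

/-- The 1-form `Φ[U] = i(δU)U - i(δ*U)*U`, in the chart `e`. -/
def Phi (S : OrientedSpacetime M) (e : OpenPartialHomeomorph M R4) (U : TwoForm M) (x : R4)
    (j : Fin 4) : ℝ :=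
  interior (S.g e x) (S.codiff e U x) (twoComp e U x) j
    - interior (S.g e x) (S.codiff e (S.star U) x) (twoComp e (S.star U) x) j

/-- The 1-form `Ψ[U] = - i(δU)*U - i(δ*U)U`, in the chart `e`. -/
def Psi (S : OrientedSpacetime M) (e : OpenPartialHomeomorph M R4) (U : TwoForm M) (x : R4)
    (j : Fin 4) : ℝ :=
  - interior (S.g e x) (S.codiff e U x) (twoComp e (S.star U) x) j
    - interior (S.g e x) (S.codiff e (S.star U) x) (twoComp e U x) j

/-- The self-dual 2-form `𝒰 = (1/√2) (U - i *U)`. -/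
def calU (S : OrientedSpacetime M) (e : OpenPartialHomeomorph M R4) (U : TwoForm M) (x : R4)
    (i j : Fin 4) : ℂ :=
  selfDual (twoComp e U x i j) (twoComp e (S.star U) x i j)

/-- The codifferential `δ𝒰 = (1/√2) (δU - i δ*U)`. -/
def codiffCalU (S : OrientedSpacetime M) (e : OpenPartialHomeomorph M R4) (U : TwoForm M)
    (x : R4) (i : Fin 4) : ℂ :=
  selfDual (S.codiff e U x i) (S.codiff e (S.star U) x i)

/-- The covariant derivative `∇𝒰 = (1/√2) (∇U - i ∇*U)`. -/
def nablaCalU (S : OrientedSpacetime M) (e : OpenPartialHomeomorph M R4) (U : TwoForm M)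
    (x : R4) (k i j : Fin 4) : ℂ :=
  selfDual (S.nablaTwo e U x k i j) (S.nablaTwo e (S.star U) x k i j)

/-- The tensor `Σ[U] = ∇𝒰 - i(δ𝒰)𝒰 ⊗ 𝒰 - i(δ𝒰)𝒢`, in the chart `e`; the interior product
contracts the first index of `𝒢`. -/
def Sig (S : OrientedSpacetime M) (e : OpenPartialHomeomorph M R4) (U : TwoForm M) (x : R4)
    (k i j : Fin 4) : ℂ :=
  S.nablaCalU e U x k i j
    - interior (S.g e x) (S.codiffCalU e U x) (S.calU e U x) k * S.calU e U x i j
    - interior (S.g e x) (S.codiffCalU e U x)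
        (fun m n => selfDualMetric (S.g e x) (S.eta e x) m n i j) k

/-- `Σ[U] = 0`. -/
def SigVanishes (S : OrientedSpacetime M) (U : TwoForm M) : Prop :=
  ∀ e ∈ charts M, ∀ x ∈ e.target, ∀ k i j, S.Sig e U x k i j = 0

/-- `dΦ[U] = 0`. -/
def PhiClosed (S : OrientedSpacetime M) (U : TwoForm M) : Prop :=
  ∀ e ∈ charts M, ∀ x ∈ e.target, ∀ i j, dOne (S.Phi e U) x i j = 0

/-- `dΨ[U] = 0`. -/
def PsiClosed (S : OrientedSpacetime M) (U : TwoForm M) : Prop :=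
  ∀ e ∈ charts M, ∀ x ∈ e.target, ∀ i j, dOne (S.Psi e U) x i j = 0

/-- `-2 dφ = Φ[U]` on `W`. -/
def PhiPotential (S : OrientedSpacetime M) (U : TwoForm M) (W : Set M) (φ : M → ℝ) : Prop :=
  ∀ e ∈ charts M, ∀ x ∈ e.target, e.symm x ∈ W →
    ∀ i, -2 * pd i (φ ∘ e.symm) x = S.Phi e U x i

/-- `-2 dψ = Ψ[U]` on `W`. -/
def PsiPotential (S : OrientedSpacetime M) (U : TwoForm M) (W : Set M) (ψ : M → ℝ) : Prop :=
  ∀ e ∈ charts M, ∀ x ∈ e.target, e.symm x ∈ W →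
    ∀ i, -2 * pd i (ψ ∘ e.symm) x = S.Psi e U x i

/-! #### Conformal Killing-Yano tensors, Maxwell fields and the associated structures -/

/-- `A` is a conformal Killing-Yano tensor on `W`:
`∇_{(i} A_{j)k} = g_{ij} a_k - a_{(i} g_{j)k}` with `3 a = - δA`. -/
def IsCKYOn (S : OrientedSpacetime M) (A : TwoForm M) (W : Set M) : Prop :=
  SmoothOn A W ∧ ∀ e ∈ charts M, ∀ x ∈ e.target, e.symm x ∈ W → ∃ a : Fin 4 → ℝ,
    (∀ i, 3 * a i = - S.codiff e A x i) ∧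
    ∀ i j k, (1 / 2) * (S.nablaTwo e A x i j k + S.nablaTwo e A x j i k) =
      S.g e x i j * a k - (1 / 2) * (a i * S.g e x j k + a j * S.g e x i k)

/-- `F` is a source-free Maxwell field on `W`: `δF = 0` and `δ*F = 0`. -/
def IsMaxwellOn (S : OrientedSpacetime M) (F : TwoForm M) (W : Set M) : Prop :=
  SmoothOn F W ∧ ∀ e ∈ charts M, ∀ x ∈ e.target, e.symm x ∈ W →
    ∀ i, S.codiff e F x i = 0 ∧ S.codiff e (S.star F) x i = 0

/-- `U` defines a conformal Killing-Yano structure: around every point it is the canonical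
unitary 2-form of a regular conformal Killing-Yano tensor. -/
def DefinesCKY (S : OrientedSpacetime M) (U : TwoForm M) : Prop :=
  ∀ p : M, ∃ W : Set M, IsOpen W ∧ p ∈ W ∧ ∃ A : TwoForm M,
    S.IsCKYOn A W ∧ (∀ q ∈ W, S.RegularAt A q) ∧ S.HasCanonicalForm U A W

/-- `U` defines a maxwellian structure: around every point it is the canonical unitary 2-form of a
regular source-free Maxwell field. -/
def DefinesMaxwell (S : OrientedSpacetime M) (U : TwoForm M) : Prop :=
  ∀ p : M, ∃ W : Set M, IsOpen W ∧ p ∈ W ∧ ∃ F : TwoForm M,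
    S.IsMaxwellOn F W ∧ (∀ q ∈ W, S.RegularAt F q) ∧ S.HasCanonicalForm U F W

/-- The projector `v = U²`, `v_{ij} = U_{ia} g^{ab} U_{bj}`, onto the time-like planes. -/
def projV (S : OrientedSpacetime M) (e : OpenPartialHomeomorph M R4) (U : TwoForm M) (x : R4)
    (i j : Fin 4) : ℝ :=
  ∑ a, ∑ b, twoComp e U x i a * (S.g e x)⁻¹ a b * twoComp e U x b j

/-- The projector `h = g - v` onto the space-like planes. -/
def projH (S : OrientedSpacetime M) (e : OpenPartialHomeomorph M R4) (U : TwoForm M) (x : R4)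
    (i j : Fin 4) : ℝ :=
  S.g e x i j - S.projV e U x i j

/-- The 2+2 structure of `U` is umbilical: both of its plane fields are. -/
def IsUmbilical (S : OrientedSpacetime M) (U : TwoForm M) : Prop :=
  ∀ e ∈ charts M, ∀ x ∈ e.target,
    UmbilicalPlaneAt (S.g e) (S.projV e U) (S.projH e U) x ∧
    UmbilicalPlaneAt (S.g e) (S.projH e U) (S.projV e U) x

end OrientedSpacetime

end

end CKY

/-! At a point, take an oriented orthonormal frame whose first two vectors span `V`; there `U` and
`*U` are the fixed matrices `timelikeForm` and `spacelikeForm`. Differentiating `U·*U = 0` and `U² -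
(*U)² = g` shows that `∇U` has no component along `U` or `*U`, and that `∇*U` is its dual. The
first-order geometry is thus four covectors `e, f, b, c` (`UnitaryComponents.exists_triple`).

Let `A = αU + β*U` and write `d(α + iβ) = (p + iq)(α + iβ)`. Then `∇A` is the duality rotation by `α
+ iβ` of the array obtained from `∇U` by putting `-p` and `q` in the two missing components. The CKY
and Maxwell equations are invariant under such rotations, so `α` and `β` drop out
(`cky_rotated_iff`, `maxwell_rotated_iff`), leaving linear equations in `p, q, e, f, b, c`. The CKY
ones amount to the eight equations `UmbilicalEqs` together with `-2p = Φ` and `-2q = Ψ`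
(`cky_triple_iff`); the Maxwell ones amount to `p = Φ` and `q = Ψ`, with no condition on the
geometry (`maxwell_triple_iff`). The same eight equations express both `Σ = 0` (`sig_triple_iff`)
and umbilicity (`umbilical_triple_iff`).

What remains is integrability. A logarithmic derivative `p + iq` is closed, so a CKY tensor or a
Maxwell field aligned with `U` forces `dΦ = dΨ = 0` (`dOne_eq_zero_of_rotation`). Conversely the
Poincaré lemma gives potentials `φ, ψ` (`exists_potentials`): the pair `(φ, ψ)` yields a CKY tensor
when `Σ = 0`, and `(-2φ, -2ψ)` always yields a Maxwell field. So being maxwellian means exactly that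
`Φ` and `Ψ` are closed, and the three assertions follow.

The adapted frame is used at one point at a time: derivatives are taken in coordinates and the
resulting arrays are carried to the frame by `tr1`, ..., `tr4`. No smooth adapted frame is needed.
-/

open Filter Topology

namespace CKY

noncomputable section

section

/-! ### Arrays of components and changes of frame -/

/-- Components of a covector in the frame whose vectors are the columns of `P`. -/
def tr1 (P : Matrix (Fin 4) (Fin 4) ℝ) (w : Fin 4 → ℝ) (i : Fin 4) : ℝ := ∑ a, P a i * w a

/-- Components of a covariant 2-tensor in the frame whose vectors are the columns of `P`. -/
def tr2 (P : Matrix (Fin 4) (Fin 4) ℝ) (A : Fin 4 → Fin 4 → ℝ) (i j : Fin 4) : ℝ :=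
  tr1 P (fun a => tr1 P (A a) j) i

/-- Components of a covariant 3-tensor in the frame whose vectors are the columns of `P`. -/
def tr3 (P : Matrix (Fin 4) (Fin 4) ℝ) (T : Fin 4 → Fin 4 → Fin 4 → ℝ) (i j k : Fin 4) : ℝ :=
  tr1 P (fun a => tr2 P (T a) j k) i

/-- Components of a covariant 4-tensor in the frame whose vectors are the columns of `P`. -/
def tr4 (P : Matrix (Fin 4) (Fin 4) ℝ) (V : Fin 4 → Fin 4 → Fin 4 → Fin 4 → ℝ)
    (i j k l : Fin 4) : ℝ :=
  tr1 P (fun a => tr3 P (V a) j k l) i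

variable (P : Matrix (Fin 4) (Fin 4) ℝ)

lemma tr1_add (v w : Fin 4 → ℝ) (i : Fin 4) :
    tr1 P (fun a => v a + w a) i = tr1 P v i + tr1 P w i := by
  simp [tr1, mul_add, Finset.sum_add_distrib]

lemma tr1_sub (v w : Fin 4 → ℝ) (i : Fin 4) :
    tr1 P (fun a => v a - w a) i = tr1 P v i - tr1 P w i := by
  simp [tr1, mul_sub, Finset.sum_sub_distrib]

lemma tr1_neg (w : Fin 4 → ℝ) (i : Fin 4) : tr1 P (fun a => -w a) i = -tr1 P w i := by
  simp [tr1]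

lemma tr1_mul (c : ℝ) (w : Fin 4 → ℝ) (i : Fin 4) :
    tr1 P (fun a => c * w a) i = c * tr1 P w i := by
  simp only [tr1, Finset.mul_sum]
  exact Finset.sum_congr rfl fun _ _ => by ring

lemma tr1_mul_right (c : ℝ) (w : Fin 4 → ℝ) (i : Fin 4) :
    tr1 P (fun a => w a * c) i = tr1 P w i * c := by
  simp only [tr1, Finset.sum_mul]
  exact Finset.sum_congr rfl fun _ _ => by ring

lemma tr1_sum {ι : Type*} (s : Finset ι) (w : ι → Fin 4 → ℝ) (i : Fin 4) :
    tr1 P (fun a => ∑ r ∈ s, w r a) i = ∑ r ∈ s, tr1 P (w r) i := by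
  simp only [tr1, Finset.mul_sum]
  exact Finset.sum_comm

lemma tr1_comm (Q : Matrix (Fin 4) (Fin 4) ℝ) (A : Fin 4 → Fin 4 → ℝ) (i j : Fin 4) :
    tr1 P (fun a => tr1 Q (fun b => A a b) j) i = tr1 Q (fun b => tr1 P (fun a => A a b) i) j := by
  simp only [tr1, Finset.mul_sum]
  rw [Finset.sum_comm]
  exact Finset.sum_congr rfl fun _ _ => Finset.sum_congr rfl fun _ _ => by ring

lemma tr2_comm (A : Fin 4 → Fin 4 → ℝ) (i j : Fin 4) :
    tr2 P (fun a b => A b a) i j = tr2 P A j i := tr1_comm P P (fun a b => A b a) i j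

lemma tr3_swap (T : Fin 4 → Fin 4 → Fin 4 → ℝ) (i j k : Fin 4) :
    tr3 P (fun a b c => T b a c) i j k = tr3 P T j i k :=
  tr1_comm P P (fun a b => tr1 P (T b a) k) i j

lemma tr3_swap' (T : Fin 4 → Fin 4 → Fin 4 → ℝ) (i j k : Fin 4) :
    tr3 P (fun a b c => T a c b) i j k = tr3 P T i k j := by
  simp only [tr3, tr2_comm]

lemma tr3_rotate (T : Fin 4 → Fin 4 → Fin 4 → ℝ) (i j k : Fin 4) :
    tr3 P (fun a b c => T b c a) i j k = tr3 P T j k i := by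
  rw [tr3_swap' P (fun a b c => T c b a)]
  rw [tr3_swap P (fun a b c => T c a b)]
  rw [tr3_swap' P (fun a b c => T b a c), tr3_swap, tr3_swap']

lemma tr1_reverse (F : Fin 4 → Fin 4 → Fin 4 → ℝ) (i j k : Fin 4) :
    tr1 P (fun z => tr1 P (fun y => tr1 P (fun x => F x y z) i) j) k
      = tr1 P (fun x => tr1 P (fun y => tr1 P (fun z => F x y z) k) j) i := by
  rw [tr1_comm P P (fun z y => tr1 P (fun x => F x y z) i),
    tr1_comm P P (fun x y => tr1 P (fun z => F x y z) k)]
  congr 1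
  funext y
  exact tr1_comm P P (fun z x => F x y z) k i

variable {P}

lemma tr1_injective (hP : IsUnit P.det) {w : Fin 4 → ℝ} (h : ∀ i, tr1 P w i = 0) (a : Fin 4) :
    w a = 0 := by
  have h1 : Matrix.vecMul w P = 0 := by
    funext i
    simpa [Matrix.vecMul, dotProduct, tr1, mul_comm] using h i
  have h2 : Matrix.vecMul (Matrix.vecMul w P) P⁻¹ = w := by
    rw [Matrix.vecMul_vecMul, Matrix.mul_nonsing_inv _ hP, Matrix.vecMul_one]
  rw [← h2, h1, Matrix.zero_vecMul]; rfl

lemma tr2_injective (hP : IsUnit P.det) {A : Fin 4 → Fin 4 → ℝ} (h : ∀ i j, tr2 P A i j = 0)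
    (a b : Fin 4) : A a b = 0 :=
  tr1_injective hP (fun j => tr1_injective hP (fun i => h i j) a) b

lemma tr3_injective (hP : IsUnit P.det) {T : Fin 4 → Fin 4 → Fin 4 → ℝ}
    (h : ∀ i j k, tr3 P T i j k = 0) (a b c : Fin 4) : T a b c = 0 :=
  tr2_injective hP (fun j k => tr1_injective hP (fun i => h i j k) a) b c

lemma tr1_eq_zero_iff (hP : IsUnit P.det) (w : Fin 4 → ℝ) :
    (∀ i, w i = 0) ↔ ∀ i, tr1 P w i = 0 :=
  ⟨fun h i => by simp [tr1, h], tr1_injective hP⟩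

lemma tr3_eq_zero_iff (hP : IsUnit P.det) (T : Fin 4 → Fin 4 → Fin 4 → ℝ) :
    (∀ i j k, T i j k = 0) ↔ ∀ i j k, tr3 P T i j k = 0 :=
  ⟨fun h i j k => by simp [tr3, tr2, tr1, h], tr3_injective hP⟩

lemma tr1_surjective (hP : IsUnit P.det) (v : Fin 4 → ℝ) : ∃ w, tr1 P w = v := by
  refine ⟨Matrix.vecMul v P⁻¹, ?_⟩
  have h2 : Matrix.vecMul (Matrix.vecMul v P⁻¹) P = v := by
    rw [Matrix.vecMul_vecMul, Matrix.nonsing_inv_mul _ hP, Matrix.vecMul_one]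
  funext i
  have := congrFun h2 i
  simpa [Matrix.vecMul, dotProduct, tr1, mul_comm] using this

lemma tr2_eq_mul (P A : Matrix (Fin 4) (Fin 4) ℝ) :
    Matrix.of (tr2 P A) = P.transpose * A * P := by
  ext i j
  simp only [Matrix.of_apply, tr2, tr1, Matrix.mul_apply, Matrix.transpose_apply, Finset.mul_sum,
    Finset.sum_mul]
  rw [Finset.sum_comm]
  exact Finset.sum_congr rfl fun _ _ => Finset.sum_congr rfl fun _ _ => by ring

/-! ### Contractions -/

/-- The contraction `g^{ij} F_{ij}`. -/
def ctr (G : Matrix (Fin 4) (Fin 4) ℝ) (F : Fin 4 → Fin 4 → ℝ) : ℝ :=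
  ∑ i, ∑ a, G⁻¹ i a * F i a

lemma inv_eq_of_frame (hP : IsUnit P.det) (G : Matrix (Fin 4) (Fin 4) ℝ) :
    G⁻¹ = P * (P.transpose * G * P)⁻¹ * P.transpose := by
  have hPt : IsUnit P.transpose.det := by rwa [Matrix.det_transpose]
  rw [Matrix.mul_inv_rev, Matrix.mul_inv_rev, ← Matrix.mul_assoc, ← Matrix.mul_assoc,
    Matrix.mul_nonsing_inv _ hP, Matrix.one_mul, Matrix.mul_assoc, Matrix.nonsing_inv_mul _ hPt,
    Matrix.mul_one]

/-- The contraction is the trace of `G⁻¹ Fᵀ`; the factors `P` and `Pᵀ` coming from `inv_eq_of_frame`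
are absorbed into `F` by cyclicity of the trace. Every invariance statement below reduces to this
one. -/
lemma ctr_tr (hP : IsUnit P.det) {G G' : Matrix (Fin 4) (Fin 4) ℝ}
    (hG : P.transpose * G * P = G') (F : Fin 4 → Fin 4 → ℝ) :
    ctr G F = ctr G' (tr2 P F) := by
  have key : ∀ X : Matrix (Fin 4) (Fin 4) ℝ, ∑ i, ∑ a, X i a * F i a
      = (X * (Matrix.of F).transpose).trace := by
    intro X
    simp [Matrix.trace, Matrix.mul_apply]
  have key' : ∀ X : Matrix (Fin 4) (Fin 4) ℝ, ∑ i, ∑ a, X i a * tr2 P F i a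
      = (X * (Matrix.of (tr2 P F)).transpose).trace := by
    intro X
    simp [Matrix.trace, Matrix.mul_apply]
  rw [ctr, ctr, key, key', inv_eq_of_frame hP G, hG]
  have : Matrix.of (tr2 P F) = P.transpose * Matrix.of F * P := tr2_eq_mul P (Matrix.of F)
  rw [this, Matrix.transpose_mul, Matrix.transpose_mul, Matrix.transpose_transpose,
    Matrix.mul_assoc, Matrix.mul_assoc, Matrix.trace_mul_comm]
  simp only [Matrix.mul_assoc]

lemma ctr_congr (G : Matrix (Fin 4) (Fin 4) ℝ) {F F' : Fin 4 → Fin 4 → ℝ}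
    (h : ∀ i j, F i j = F' i j) : ctr G F = ctr G F' := by
  simp only [ctr, h]

lemma tr1_ctr (G : Matrix (Fin 4) (Fin 4) ℝ) (F : Fin 4 → Fin 4 → Fin 4 → ℝ) (l : Fin 4) :
    tr1 P (fun c => ctr G (F c)) l = ctr G (fun i j => tr1 P (fun c => F c i j) l) := by
  simp only [ctr]
  rw [tr1_sum]
  refine Finset.sum_congr rfl fun i _ => ?_
  rw [tr1_sum]
  exact Finset.sum_congr rfl fun j _ => tr1_mul P _ _ _

lemma tr2_mul (X Y : Fin 4 → ℝ) (i j : Fin 4) :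
    tr2 P (fun a b => X a * Y b) i j = tr1 P X i * tr1 P Y j := by
  simp only [tr2, tr1_mul, tr1_mul_right]

lemma ctr_minkowski (F : Fin 4 → Fin 4 → ℝ) :
    ctr minkowski F = -F 0 0 + F 1 1 + F 2 2 + F 3 3 := by
  have h : minkowski⁻¹ = minkowski := by
    apply Matrix.inv_eq_right_inv
    ext i j
    fin_cases i <;> fin_cases j <;> simp [minkowski]
  simp only [ctr, h]
  simp [minkowski, Fin.sum_univ_four, Matrix.diagonal_apply]

lemma interior_eq_ctr (G : Matrix (Fin 4) (Fin 4) ℝ) (w : Fin 4 → ℝ) (A : Fin 4 → Fin 4 → ℝ)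
    (j : Fin 4) : interior G w A j = ctr G (fun i a => w a * A i j) := by
  simp [interior, ctr]

lemma interior_tr (hP : IsUnit P.det) {G G' : Matrix (Fin 4) (Fin 4) ℝ}
    (hG : P.transpose * G * P = G') (w : Fin 4 → ℝ) (A : Fin 4 → Fin 4 → ℝ) (j : Fin 4) :
    tr1 P (interior G w A) j = interior G' (tr1 P w) (tr2 P A) j := by
  have : interior G w A = fun j => ctr G (fun i a => w a * A i j) := by
    funext j; exact interior_eq_ctr G w A j
  rw [this, tr1_ctr, ctr_tr hP hG, interior_eq_ctr]
  refine ctr_congr _ fun i a => ?_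
  simp only [tr1_mul]
  have h := tr2_mul (P := P) (fun i => tr1 P (fun c => A i c) j) w i a
  simp only [mul_comm] at h ⊢
  rw [h]; rfl

/-- Nesting three contractions lets `ctr_tr` change frame one index pair at a time. -/
lemma starThree_eq_ctr (G : Matrix (Fin 4) (Fin 4) ℝ) (V : Fin 4 → Fin 4 → Fin 4 → Fin 4 → ℝ)
    (B : Fin 4 → Fin 4 → Fin 4 → ℝ) (l : Fin 4) :
    starThree G V B l = (1 / 6) * ctr G (fun i a => ctr G (fun j b => ctr G (fun k c =>
      B a b c * V i j k l))) := by
  have swap : ∀ F : Fin 4 → Fin 4 → Fin 4 → ℝ,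
      ∑ j, ∑ k, ∑ a, F j k a = ∑ a, ∑ j, ∑ k, F j k a := by
    intro F
    exact (Finset.sum_congr rfl fun j _ => Finset.sum_comm).trans Finset.sum_comm
  simp only [starThree, ctr, Finset.mul_sum]
  refine Finset.sum_congr rfl fun i _ => ?_
  rw [swap]
  refine Finset.sum_congr rfl fun a _ => Finset.sum_congr rfl fun j _ => ?_
  rw [Finset.sum_comm]
  refine Finset.sum_congr rfl fun b _ => Finset.sum_congr rfl fun k _ =>
    Finset.sum_congr rfl fun c _ => ?_
  ring

lemma starThree_tr (hP : IsUnit P.det) {G G' : Matrix (Fin 4) (Fin 4) ℝ}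
    (hG : P.transpose * G * P = G') (V : Fin 4 → Fin 4 → Fin 4 → Fin 4 → ℝ)
    (B : Fin 4 → Fin 4 → Fin 4 → ℝ) (l : Fin 4) :
    tr1 P (starThree G V B) l = starThree G' (tr4 P V) (tr3 P B) l := by
  have h : starThree G V B = fun l => (1 / 6) * ctr G (fun i a => ctr G (fun j b =>
      ctr G (fun k c => B a b c * V i j k l))) := by
    funext l; exact starThree_eq_ctr G V B l
  have one : ∀ F : Fin 4 → Fin 4 → Fin 4 → Fin 4 → ℝ, ∀ i a : Fin 4,
      tr2 P (fun i a => ctr G (F i a)) i a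
        = ctr G (fun j b => tr2 P (fun i a => F i a j b) i a) := by
    intro F i a
    simp only [tr2, tr1_ctr]
  rw [h, starThree_eq_ctr, tr1_mul]
  simp only [tr1_ctr]
  congr 1
  rw [ctr_tr hP hG]
  refine ctr_congr _ fun i a => ?_
  rw [one, ctr_tr hP hG]
  refine ctr_congr _ fun j b => ?_
  simp only [one]
  rw [ctr_tr hP hG]
  refine ctr_congr _ fun k c => ?_
  simp only [tr2, tr3, tr4, tr1_mul, tr1_mul_right]
  congr 1
  · exact tr1_reverse P (fun x y z => B x y z) a b c
  · exact tr1_reverse P (fun x y z => tr1 P (V x y z) l) i j k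

/-- The contraction `A_{ia} g^{ab} B_{bj}`. -/
def mulG (G : Matrix (Fin 4) (Fin 4) ℝ) (A B : Fin 4 → Fin 4 → ℝ) (i j : Fin 4) : ℝ :=
  ∑ a, ∑ b, A i a * G⁻¹ a b * B b j

lemma mulG_eq_ctr (G : Matrix (Fin 4) (Fin 4) ℝ) (A B : Fin 4 → Fin 4 → ℝ) (i j : Fin 4) :
    mulG G A B i j = ctr G (fun a b => A i a * B b j) := by
  simp only [mulG, ctr]
  exact Finset.sum_congr rfl fun _ _ => Finset.sum_congr rfl fun _ _ => by ring

lemma mulG_eq_mul (G A B : Matrix (Fin 4) (Fin 4) ℝ) :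
    Matrix.of (mulG G A B) = A * G⁻¹ * B := by
  ext i j
  simp only [mulG, Matrix.of_apply, Matrix.mul_apply, Finset.sum_mul]
  rw [Finset.sum_comm]

lemma mulG_tr (hP : IsUnit P.det) {G G' : Matrix (Fin 4) (Fin 4) ℝ}
    (hG : P.transpose * G * P = G') (A B : Fin 4 → Fin 4 → ℝ) (i j : Fin 4) :
    tr2 P (mulG G A B) i j = mulG G' (tr2 P A) (tr2 P B) i j := by
  have h : mulG G A B = fun i j => ctr G (fun a b => A i a * B b j) := by
    funext i j; exact mulG_eq_ctr G A B i j
  rw [h, mulG_eq_ctr]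
  simp only [tr2, tr1_ctr]
  rw [ctr_tr hP hG]
  refine ctr_congr _ fun a b => ?_
  simp only [tr1_mul, tr1_mul_right, tr2]
  congr 1
  · exact tr1_comm P P (fun a i => A i a) a i

/-- The tensor `(x, y, z) ↦ D(px, py, qz)`. -/
def projectThree (G : Matrix (Fin 4) (Fin 4) ℝ) (p q : Fin 4 → Fin 4 → ℝ)
    (D : Fin 4 → Fin 4 → Fin 4 → ℝ) (i j k : Fin 4) : ℝ :=
  ∑ a, ∑ b, ∑ c, (G⁻¹ * Matrix.of p) a i * (G⁻¹ * Matrix.of p) b j *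
    (G⁻¹ * Matrix.of q) c k * D a b c

lemma tr1_tr1 (P Q : Matrix (Fin 4) (Fin 4) ℝ) (w : Fin 4 → ℝ) (i : Fin 4) :
    tr1 P (tr1 Q w) i = tr1 (Q * P) w i := by
  simp only [tr1, Matrix.mul_apply, Finset.mul_sum, Finset.sum_mul]
  rw [Finset.sum_comm]
  exact Finset.sum_congr rfl fun _ _ => Finset.sum_congr rfl fun _ _ => by ring

/-- The mixed tensor `G⁻¹p` is conjugated by `P`, so applying it commutes with the change of frame.
-/
lemma tr1_mixed (hP : IsUnit P.det) {G G' : Matrix (Fin 4) (Fin 4) ℝ}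
    (hG : P.transpose * G * P = G') (p : Fin 4 → Fin 4 → ℝ) (w : Fin 4 → ℝ) (i : Fin 4) :
    tr1 P (tr1 (G⁻¹ * Matrix.of p) w) i = tr1 (G'⁻¹ * Matrix.of (tr2 P p)) (tr1 P w) i := by
  rw [tr1_tr1, tr1_tr1, inv_eq_of_frame hP G, hG]
  have : Matrix.of (tr2 P p) = P.transpose * Matrix.of p * P := tr2_eq_mul P (Matrix.of p)
  rw [this]
  simp only [Matrix.mul_assoc]

lemma projectThree_eq (G : Matrix (Fin 4) (Fin 4) ℝ) (p q : Fin 4 → Fin 4 → ℝ)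
    (D : Fin 4 → Fin 4 → Fin 4 → ℝ) (i j k : Fin 4) :
    projectThree G p q D i j k = tr1 (G⁻¹ * Matrix.of p) (fun a => tr1 (G⁻¹ * Matrix.of p)
      (fun b => tr1 (G⁻¹ * Matrix.of q) (fun c => D a b c) k) j) i := by
  simp only [projectThree, tr1, Finset.mul_sum]
  exact Finset.sum_congr rfl fun _ _ => Finset.sum_congr rfl fun _ _ =>
    Finset.sum_congr rfl fun _ _ => by ring

lemma projectThree_tr (hP : IsUnit P.det) {G G' : Matrix (Fin 4) (Fin 4) ℝ}
    (hG : P.transpose * G * P = G') (p q : Fin 4 → Fin 4 → ℝ)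
    (D : Fin 4 → Fin 4 → Fin 4 → ℝ) (i j k : Fin 4) :
    tr3 P (projectThree G p q D) i j k
      = projectThree G' (tr2 P p) (tr2 P q) (tr3 P D) i j k := by
  have h : projectThree G p q D = fun i j k => tr1 (G⁻¹ * Matrix.of p) (fun a =>
      tr1 (G⁻¹ * Matrix.of p) (fun b => tr1 (G⁻¹ * Matrix.of q) (fun c => D a b c) k) j) i := by
    funext i j k; exact projectThree_eq G p q D i j k
  rw [h, projectThree_eq]
  have hp := tr1_mixed hP hG p
  have hq := tr1_mixed hP hG q
  generalize G⁻¹ * Matrix.of p = X at *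
  generalize G⁻¹ * Matrix.of q = Z at *
  generalize G'⁻¹ * Matrix.of (tr2 P p) = X' at *
  generalize G'⁻¹ * Matrix.of (tr2 P q) = Z' at *
  have hp' : ∀ F : Fin 4 → ℝ, ∀ i, tr1 P (fun b => tr1 X (fun a => F a) b) i
      = tr1 X' (fun a => tr1 P F a) i := hp
  have hq' : ∀ F : Fin 4 → ℝ, ∀ i, tr1 P (fun b => tr1 Z (fun a => F a) b) i
      = tr1 Z' (fun a => tr1 P F a) i := hq
  simp only [tr3, tr2, tr1_comm P X, hq', hp']
  simp only [tr1_comm P X', tr1_comm P Z']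

end

section

/-! ### Algebra in an orthonormal frame adapted to a 2+2 structure -/

/-- The Levi-Civita symbol, as a Vandermonde product. -/
def levi (i j k l : Fin 4) : ℝ :=
  (((j : ℤ) - i) * ((k : ℤ) - i) * ((l : ℤ) - i) * ((k : ℤ) - j) * ((l : ℤ) - j) *
    ((l : ℤ) - k) : ℤ) / 12

/-- On distinct indices both sides change by the sign of the permutation; a repeated index makes
both vanish, the right one because the Vandermonde product has a zero factor. -/
lemma levi_eq_of_alternating {E : Type*} [AddCommGroup E] [Module ℝ E]
    (V : E [⋀^Fin 4]→ₗ[ℝ] ℝ) (b : Fin 4 → E) (i j k l : Fin 4) :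
    V ![b i, b j, b k, b l] = V b * levi i j k l := by
  have hb : ![b i, b j, b k, b l] = b ∘ ![i, j, k, l] := by
    funext m; fin_cases m <;> rfl
  rw [hb]
  by_cases hinj : Function.Injective ![i, j, k, l]
  · have hσ : ![i, j, k, l] = ⇑(Equiv.ofBijective _ (Finite.injective_iff_bijective.mp hinj)) := rfl
    generalize Equiv.ofBijective _ (Finite.injective_iff_bijective.mp hinj) = σ at hσ
    -- Here `12` is the Vandermonde product of `0, 1, 2, 3`.
    have hsign : ∀ σ : Equiv.Perm (Fin 4), ((Equiv.Perm.sign σ : ℤ)) * 12 =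
      ((σ 1 : ℤ) - σ 0) * ((σ 2 : ℤ) - σ 0) * ((σ 3 : ℤ) - σ 0) * ((σ 2 : ℤ) - σ 1) *
        ((σ 3 : ℤ) - σ 1) * ((σ 3 : ℤ) - σ 2) := by decide
    have h0 : σ 0 = i := (congrFun hσ 0).symm
    have h1 : σ 1 = j := (congrFun hσ 1).symm
    have h2 : σ 2 = k := (congrFun hσ 2).symm
    have h3 : σ 3 = l := (congrFun hσ 3).symm
    have h := hsign σ
    rw [h0, h1, h2, h3] at h
    rw [hσ, AlternatingMap.map_perm, levi, ← h]
    simp [Units.smul_def, mul_comm]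
  · rw [AlternatingMap.map_eq_zero_of_not_injective]
    · have : levi i j k l = 0 := by
        by_contra hne
        apply hinj
        have : ∀ i j k l : Fin 4, ((j : ℤ) - i) * ((k : ℤ) - i) * ((l : ℤ) - i) * ((k : ℤ) - j) *
          ((l : ℤ) - j) * ((l : ℤ) - k) ≠ 0 → Function.Injective ![i, j, k, l] := by decide
        apply this
        intro h
        exact hne (by rw [levi, h]; simp)
      rw [this, mul_zero]
    · intro h; exact hinj h.of_comp

/-- The 2-form with `A_{0 i} = E_i` and `(A_{23}, A_{31}, A_{12}) = B`, for each value of the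
derivation index `k`. -/
def form (E B : Fin 4 → Fin 3 → ℝ) (k : Fin 4) : Fin 4 → Fin 4 → ℝ :=
  !![0, E k 0, E k 1, E k 2; -E k 0, 0, B k 2, -B k 1; -E k 1, -B k 2, 0, B k 0;
    -E k 2, B k 1, -B k 0, 0]

/-- The components of the volume element of the time-like plane of the frame. -/
def timelikeForm : Fin 4 → Fin 4 → ℝ := !![0, -1, 0, 0; 1, 0, 0, 0; 0, 0, 0, 0; 0, 0, 0, 0]

/-- The components of the Hodge dual of `timelikeForm`. -/
def spacelikeForm : Fin 4 → Fin 4 → ℝ := !![0, 0, 0, 0; 0, 0, 0, 0; 0, 0, 0, 1; 0, 0, -1, 0]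

/-- The codifferential, read off the components of the covariant derivative. -/
def divForm (E B : Fin 4 → Fin 3 → ℝ) : Fin 4 → ℝ :=
  ![E 1 0 + E 2 1 + E 3 2, E 0 0 + B 2 2 - B 3 1, E 0 1 - B 1 2 + B 3 0, E 0 2 + B 1 1 - B 2 0]

/-- The cyclic sum of a 3-tensor. -/
def cyc (T : Fin 4 → Fin 4 → Fin 4 → ℝ) (i j k : Fin 4) : ℝ := T i j k + T j k i + T k i j

/-- In an orthonormal frame the Hodge dual sends `(E, B)` to `(B, -E)`, and the exterior derivative
is the cyclic sum of the covariant one. This is therefore `*d*` applied to a form with covariant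
derivative `form E B`. -/
lemma starThree_form (E B : Fin 4 → Fin 3 → ℝ) (l : Fin 4) :
    starThree minkowski levi (cyc (form B (-E))) l = divForm E B l := by
  rw [starThree_eq_ctr]
  simp only [ctr_minkowski]
  fin_cases l <;> simp [levi, cyc, form, divForm] <;> ring

end

/-! ### The structure equations as linear algebra in an adapted frame. -/

section

/-- The 1-form `i(a)U - i(b)W`. -/
def phiArr (G : Matrix (Fin 4) (Fin 4) ℝ) (U W : Fin 4 → Fin 4 → ℝ) (a b : Fin 4 → ℝ)
    (k : Fin 4) : ℝ :=
  interior G a U k - interior G b W k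

/-- The 1-form `-i(a)W - i(b)U`. -/
def psiArr (G : Matrix (Fin 4) (Fin 4) ℝ) (U W : Fin 4 → Fin 4 → ℝ) (a b : Fin 4 → ℝ)
    (k : Fin 4) : ℝ :=
  -interior G a W k - interior G b U k

/-- The induced metric on 2-forms, contracted with `a` on its first index. -/
def interiorMetric (G : Matrix (Fin 4) (Fin 4) ℝ) (a : Fin 4 → ℝ) (k i j : Fin 4) : ℝ :=
  interior G a (fun m n => G m i * G n j - G m j * G n i) k

/-- The volume element, contracted with `a` on its first index. -/
def interiorVol (G : Matrix (Fin 4) (Fin 4) ℝ) (V : Fin 4 → Fin 4 → Fin 4 → Fin 4 → ℝ)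
    (a : Fin 4 → ℝ) (k i j : Fin 4) : ℝ :=
  interior G a (fun m n => V m n i j) k

/-- `√2` times the real part of `Σ`, for `∇U = N`, `δU = a` and `δ*U = b`. -/
def sigRe (G : Matrix (Fin 4) (Fin 4) ℝ) (V : Fin 4 → Fin 4 → Fin 4 → Fin 4 → ℝ)
    (U W : Fin 4 → Fin 4 → ℝ) (N : Fin 4 → Fin 4 → Fin 4 → ℝ) (a b : Fin 4 → ℝ)
    (k i j : Fin 4) : ℝ :=
  N k i j - 1 / 2 * (phiArr G U W a b k * U i j + psiArr G U W a b k * W i j)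
    - 1 / 2 * (interiorMetric G a k i j - interiorVol G V b k i j)

/-- `√2` times the imaginary part of `Σ`, for `∇*U = M`, `δU = a` and `δ*U = b`. -/
def sigIm (G : Matrix (Fin 4) (Fin 4) ℝ) (V : Fin 4 → Fin 4 → Fin 4 → Fin 4 → ℝ)
    (U W : Fin 4 → Fin 4 → ℝ) (M : Fin 4 → Fin 4 → Fin 4 → ℝ) (a b : Fin 4 → ℝ)
    (k i j : Fin 4) : ℝ :=
  -M k i j - 1 / 2 * (psiArr G U W a b k * U i j - phiArr G U W a b k * W i j)
    + 1 / 2 * (interiorMetric G b k i j + interiorVol G V a k i j)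

/-- The defect of the conformal Killing-Yano equation for a 2-form with covariant derivative `T`
and codifferential `d`. -/
def ckyArr (G : Matrix (Fin 4) (Fin 4) ℝ) (T : Fin 4 → Fin 4 → Fin 4 → ℝ) (d : Fin 4 → ℝ)
    (i j k : Fin 4) : ℝ :=
  1 / 2 * (T i j k + T j i k)
    + 1 / 3 * (G i j * d k - 1 / 2 * (d i * G j k + d j * G i k))

/-- Symmetric part of the second fundamental form proportional to the induced metric. -/
def UmbilicalArr (P : Fin 4 → Fin 4 → ℝ) (F : Fin 4 → Fin 4 → Fin 4 → ℝ) : Prop :=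
  ∃ c : Fin 4 → ℝ, ∀ i j k, (1 / 2) * (F i j k + F j i k) = P i j * c k

/-- The triple of components `(x, y, z)`, for each value of the derivation index. -/
def triple (x y z : Fin 4 → ℝ) (k : Fin 4) : Fin 3 → ℝ := ![x k, y k, z k]

/-- The umbilicity equations in an adapted frame. -/
def UmbilicalEqs (e f b c : Fin 4 → ℝ) : Prop :=
  (c 0 + e 1 = 0 ∧ e 0 + c 1 = 0 ∧ -b 0 + f 1 = 0 ∧ f 0 - b 1 = 0) ∧
    -b 2 + c 3 = 0 ∧ c 2 + b 3 = 0 ∧ f 2 + e 3 = 0 ∧ e 2 - f 3 = 0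

/-- Half of the conformal Killing-Yano equations in an orthonormal frame; the other half is their
Hodge dual. -/
def ckyRes (E B : Fin 4 → Fin 3 → ℝ) : Fin 8 → ℝ :=
  ![E 1 0 - E 2 1, E 1 0 - E 3 2, E 0 0 - B 2 2, E 0 0 + B 3 1, E 0 1 + B 1 2, E 0 1 - B 3 0,
    E 0 2 - B 1 1, E 0 2 + B 2 0]

lemma phiArr_frame (a b : Fin 4 → ℝ) :
    phiArr minkowski timelikeForm spacelikeForm a b = ![a 1, a 0, b 3, -b 2] := by
  funext k
  simp only [phiArr, interior_eq_ctr, ctr_minkowski]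
  fin_cases k <;> simp [timelikeForm, spacelikeForm]

lemma psiArr_frame (a b : Fin 4 → ℝ) :
    psiArr minkowski timelikeForm spacelikeForm a b = ![-b 1, -b 0, a 3, -a 2] := by
  funext k
  simp only [psiArr, interior_eq_ctr, ctr_minkowski]
  fin_cases k <;> simp [timelikeForm, spacelikeForm]

lemma interiorMetric_frame (a : Fin 4 → ℝ) (k i j : Fin 4) :
    interiorMetric minkowski a k i j = a i * minkowski k j - a j * minkowski k i := by
  simp only [interiorMetric, interior_eq_ctr, ctr_minkowski]
  fin_cases i <;> fin_cases j <;> simp [minkowski] <;> try ring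

lemma interiorVol_frame (a : Fin 4 → ℝ) (k : Fin 4) :
    interiorVol minkowski levi a k = form
      ![![0, 0, 0], ![0, a 3, -a 2], ![-a 3, 0, a 1], ![a 2, -a 1, 0]]
      ![![-a 1, -a 2, -a 3], ![-a 0, 0, 0], ![0, -a 0, 0], ![0, 0, -a 0]] k := by
  funext i j
  simp only [interiorVol, interior_eq_ctr, ctr_minkowski]
  fin_cases k <;> fin_cases i <;> fin_cases j <;> simp [levi, form]

set_option maxHeartbeats 2000000 in
-- A covariant derivative of a 2-form has 24 components: 4 in the divergence, 4 in the exterior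
-- derivative, and 16 in the remaining mixed-symmetry trace-free part. The CKY equation kills the
-- last part, and its 16 equations are exchanged in two groups of 8 by duality.
lemma cky_form_iff (E B : Fin 4 → Fin 3 → ℝ) :
    (∀ i j k, ckyArr minkowski (form E B) (divForm E B) i j k = 0) ↔
      ckyRes E B = 0 ∧ ckyRes B (-E) = 0 := by
  constructor
  · intro h
    -- The components with a repeated pair of indices, then two for each triple of distinct indices;
    -- the third one follows because the cyclic sum of the symmetrised derivative vanishes.
    have h110 := h 1 1 0
    have h220 := h 2 2 0
    have h330 := h 3 3 0
    have h001 := h 0 0 1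
    have h221 := h 2 2 1
    have h331 := h 3 3 1
    have h002 := h 0 0 2
    have h112 := h 1 1 2
    have h332 := h 3 3 2
    have h003 := h 0 0 3
    have h113 := h 1 1 3
    have h223 := h 2 2 3
    have a1 := h 1 2 3
    have a2 := h 2 3 1
    have a3 := h 0 2 3
    have a4 := h 2 3 0
    have a5 := h 0 1 3
    have a6 := h 1 3 0
    have a7 := h 0 1 2
    have a8 := h 1 2 0
    clear h
    simp [ckyArr, form, divForm, minkowski] at *
    constructor <;> funext m <;> fin_cases m <;> simp [ckyRes] <;> linarith
  · rintro ⟨h1, h2⟩ i j k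
    have a0 := congrFun h1 0
    have a1 := congrFun h1 1
    have a2 := congrFun h1 2
    have a3 := congrFun h1 3
    have a4 := congrFun h1 4
    have a5 := congrFun h1 5
    have a6 := congrFun h1 6
    have a7 := congrFun h1 7
    have b0 := congrFun h2 0
    have b1 := congrFun h2 1
    have b2 := congrFun h2 2
    have b3 := congrFun h2 3
    have b4 := congrFun h2 4
    have b5 := congrFun h2 5
    have b6 := congrFun h2 6
    have b7 := congrFun h2 7
    clear h1 h2
    simp [ckyRes] at *
    fin_cases i <;> fin_cases j <;> fin_cases k <;>
      simp [ckyArr, form, divForm, minkowski] <;> linarith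

/-- The linear system in `(x i, y i)` has determinant `α² + β²` up to sign. -/
lemma duality_rotation_eq_zero {ι : Type*} {α β : ℝ} (hρ : α ^ 2 + β ^ 2 ≠ 0) {x y : ι → ℝ}
    (h1 : ∀ i, α * x i + β * y i = 0) (h2 : ∀ i, α * y i - β * x i = 0) : x = 0 ∧ y = 0 := by
  constructor <;> funext i
  · have : (α ^ 2 + β ^ 2) * x i = 0 := by linear_combination α * h1 i - β * h2 i
    simpa [hρ] using this
  · have : (α ^ 2 + β ^ 2) * y i = 0 := by linear_combination β * h1 i + α * h2 i
    simpa [hρ] using this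

end

/-! ### Elimination of the duality rotation and reduction to the umbilicity equations. -/

section

lemma inv_minkowski : minkowski⁻¹ = minkowski := by
  apply Matrix.inv_eq_right_inv
  ext i j
  fin_cases i <;> fin_cases j <;> simp [minkowski]

lemma neg_triple (x y z : Fin 4 → ℝ) : -triple x y z = triple (-x) (-y) (-z) := by
  funext k i; fin_cases i <;> simp [triple]

/-- The conformal Killing-Yano equation for `e^φ (cos ψ U + sin ψ *U)`, in an adapted frame; `p` and
`q` are the components of `dφ` and `dψ`. -/
lemma cky_rotated_iff {α β : ℝ} (hρ : α ^ 2 + β ^ 2 ≠ 0) (E B : Fin 4 → Fin 3 → ℝ) :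
    (∀ i j k, ckyArr minkowski (form (α • E + β • B) (α • B - β • E))
      (divForm (α • E + β • B) (α • B - β • E)) i j k = 0) ↔
      ckyRes E B = 0 ∧ ckyRes B (-E) = 0 := by
  -- The two dual halves of the equations are mixed by the same rotation as `E` and `B`.
  have hE : ∀ i, ckyRes (α • E + β • B) (α • B - β • E) i
      = α * ckyRes E B i + β * ckyRes B (-E) i := by
    intro i; fin_cases i <;> simp [ckyRes] <;> ring
  have hB : ∀ i, ckyRes (α • B - β • E) (-(α • E + β • B)) i
      = α * ckyRes B (-E) i - β * ckyRes E B i := by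
    intro i; fin_cases i <;> simp [ckyRes] <;> ring
  rw [cky_form_iff, funext_iff, funext_iff]
  simp only [hE, hB, Pi.zero_apply]
  constructor
  · rintro ⟨h1, h2⟩
    exact duality_rotation_eq_zero hρ h1 h2
  · rintro ⟨h1, h2⟩
    simp [h1, h2]

/-- Maxwell equations. -/
lemma maxwell_rotated_iff {α β : ℝ} (hρ : α ^ 2 + β ^ 2 ≠ 0) (E B : Fin 4 → Fin 3 → ℝ) :
    ((∀ i, divForm (α • E + β • B) (α • B - β • E) i = 0) ∧
      ∀ i, divForm (α • B - β • E) (-(α • E + β • B)) i = 0) ↔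
      divForm E B = 0 ∧ divForm B (-E) = 0 := by
  have hE : ∀ i, divForm (α • E + β • B) (α • B - β • E) i
      = α * divForm E B i + β * divForm B (-E) i := by
    intro i; fin_cases i <;> simp [divForm] <;> ring
  have hB : ∀ i, divForm (α • B - β • E) (-(α • E + β • B)) i
      = α * divForm B (-E) i - β * divForm E B i := by
    intro i; fin_cases i <;> simp [divForm] <;> ring
  simp only [hE, hB]
  constructor
  · rintro ⟨h1, h2⟩
    exact duality_rotation_eq_zero hρ h1 h2
  · rintro ⟨h1, h2⟩
    simp [h1, h2]

/-- The sixteen CKY equations split evenly: eliminating `p` and `q` leaves the eight umbilicity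
equations, and modulo these the other eight solve for `p` and `q`. For example `-p₁ = e₂` and `-p₁ =
f₃` give `e₂ = f₃` by difference and `-2p₁ = e₂ + f₃ = Φ₁` by sum. -/
lemma cky_triple_iff (p q e f b c : Fin 4 → ℝ) :
    (ckyRes (triple (-p) e f) (triple q b c) = 0 ∧
      ckyRes (triple q b c) (-triple (-p) e f) = 0) ↔
    UmbilicalEqs e f b c ∧
      (∀ i, -2 * p i = phiArr minkowski timelikeForm spacelikeForm
        (divForm (triple 0 e f) (triple 0 b c)) (divForm (triple 0 b c) (-triple 0 e f)) i) ∧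
      ∀ i, -2 * q i = psiArr minkowski timelikeForm spacelikeForm
        (divForm (triple 0 e f) (triple 0 b c)) (divForm (triple 0 b c) (-triple 0 e f)) i := by
  rw [phiArr_frame, psiArr_frame]
  simp only [neg_triple]
  constructor
  · rintro ⟨h1, h2⟩
    have a0 := congrFun h1 0
    have a1 := congrFun h1 1
    have a2 := congrFun h1 2
    have a3 := congrFun h1 3
    have a4 := congrFun h1 4
    have a5 := congrFun h1 5
    have a6 := congrFun h1 6
    have a7 := congrFun h1 7
    have b0 := congrFun h2 0
    have b1 := congrFun h2 1
    have b2 := congrFun h2 2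
    have b3 := congrFun h2 3
    have b4 := congrFun h2 4
    have b5 := congrFun h2 5
    have b6 := congrFun h2 6
    have b7 := congrFun h2 7
    clear h1 h2
    simp [ckyRes, triple] at *
    refine ⟨⟨⟨?_, ?_, ?_, ?_⟩, ?_, ?_, ?_, ?_⟩, fun i => ?_, fun i => ?_⟩ <;> try linarith
    all_goals fin_cases i <;> simp [divForm, triple] <;> linarith
  · rintro ⟨⟨⟨a0, a1, a2, a3⟩, a4, a5, a6, a7⟩, h1, h2⟩
    have b0 := h1 0
    have b1 := h1 1
    have b2 := h1 2
    have b3 := h1 3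
    have b4 := h2 0
    have b5 := h2 1
    have b6 := h2 2
    have b7 := h2 3
    clear h1 h2
    simp [divForm, triple] at *
    constructor <;> funext i <;> fin_cases i <;> simp [ckyRes, triple] <;> linarith

/-- Each of the eight Maxwell equations contains exactly one component of `p` or `q`, so they only
determine `p` and `q` and leave `e, f, b, c` free. The factor `-2` of the CKY case is absent. -/
lemma maxwell_triple_iff (p q e f b c : Fin 4 → ℝ) :
    (divForm (triple (-p) e f) (triple q b c) = 0 ∧
      divForm (triple q b c) (-triple (-p) e f) = 0) ↔
      (∀ i, p i = phiArr minkowski timelikeForm spacelikeForm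
        (divForm (triple 0 e f) (triple 0 b c)) (divForm (triple 0 b c) (-triple 0 e f)) i) ∧
      ∀ i, q i = psiArr minkowski timelikeForm spacelikeForm
        (divForm (triple 0 e f) (triple 0 b c)) (divForm (triple 0 b c) (-triple 0 e f)) i := by
  rw [phiArr_frame, psiArr_frame]
  simp only [funext_iff, Fin.forall_fin_succ, divForm, neg_triple]
  simp [triple]
  constructor <;> rintro ⟨⟨h0, h1, h2, h3⟩, h4, h5, h6, h7⟩ <;>
    refine ⟨⟨?_, ?_, ?_, ?_⟩, ?_, ?_, ?_, ?_⟩ <;> linarith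

set_option maxHeartbeats 4000000 in
-- The terms subtracted from `∇𝒰` are its value when it is determined by `δ𝒰`; the remainder
-- vanishes exactly under the umbilicity equations, which involve no potential `p` or `q`.
lemma sig_triple_iff (e f b c : Fin 4 → ℝ) :
    (∀ k i j, sigRe minkowski levi timelikeForm spacelikeForm (form (triple 0 e f) (triple 0 b c))
        (divForm (triple 0 e f) (triple 0 b c)) (divForm (triple 0 b c) (-triple 0 e f)) k i j = 0 ∧
      sigIm minkowski levi timelikeForm spacelikeForm (form (triple 0 b c) (-triple 0 e f))
        (divForm (triple 0 e f) (triple 0 b c)) (divForm (triple 0 b c) (-triple 0 e f)) k i j = 0)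
      ↔ UmbilicalEqs e f b c := by
  simp only [sigRe, sigIm, phiArr_frame, psiArr_frame, interiorMetric_frame, interiorVol_frame,
    neg_triple]
  constructor
  · intro h
    -- The real part on index pairs mixing `V` and `H` is enough: these components already contain
    -- all of `e, f, b, c`.
    have h002 := (h 0 0 2).1
    have h003 := (h 0 0 3).1
    have h012 := (h 0 1 2).1
    have h013 := (h 0 1 3).1
    have h102 := (h 1 0 2).1
    have h103 := (h 1 0 3).1
    have h112 := (h 1 1 2).1
    have h113 := (h 1 1 3).1
    have h202 := (h 2 0 2).1
    have h203 := (h 2 0 3).1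
    have h212 := (h 2 1 2).1
    have h213 := (h 2 1 3).1
    have h302 := (h 3 0 2).1
    have h303 := (h 3 0 3).1
    have h312 := (h 3 1 2).1
    have h313 := (h 3 1 3).1
    clear h
    simp [divForm, triple, form, timelikeForm, spacelikeForm, minkowski] at *
    refine ⟨⟨?_, ?_, ?_, ?_⟩, ?_, ?_, ?_, ?_⟩ <;> linarith
  · rintro ⟨⟨a0, a1, a2, a3⟩, a4, a5, a6, a7⟩ k i j
    fin_cases k <;> fin_cases i <;> fin_cases j <;> constructor <;>
      simp [divForm, triple, form, timelikeForm, spacelikeForm, minkowski] <;> linarith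

lemma inv_minkowski_mul_v :
    minkowski⁻¹ * Matrix.of (mulG minkowski timelikeForm timelikeForm)
      = Matrix.diagonal ![1, 1, 0, 0] := by
  ext i j
  simp only [inv_minkowski, Matrix.mul_apply, Matrix.of_apply, mulG_eq_ctr, ctr_minkowski]
  fin_cases i <;> fin_cases j <;> simp [Fin.sum_univ_four, minkowski, timelikeForm]

lemma inv_minkowski_mul_h :
    minkowski⁻¹ * Matrix.of
      (fun i j => minkowski i j - mulG minkowski timelikeForm timelikeForm i j)
      = Matrix.diagonal ![0, 0, 1, 1] := by
  ext i j
  simp only [inv_minkowski, Matrix.mul_apply, Matrix.of_apply, mulG_eq_ctr, ctr_minkowski]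
  fin_cases i <;> fin_cases j <;> simp [Fin.sum_univ_four, minkowski, timelikeForm]

lemma projectThree_of_diagonal {G : Matrix (Fin 4) (Fin 4) ℝ} {p q : Fin 4 → Fin 4 → ℝ}
    {v h : Fin 4 → ℝ} (hp : G⁻¹ * Matrix.of p = Matrix.diagonal v)
    (hq : G⁻¹ * Matrix.of q = Matrix.diagonal h) (D : Fin 4 → Fin 4 → Fin 4 → ℝ)
    (i j k : Fin 4) :
    projectThree G p q D i j k = v i * v j * h k * D i j k := by
  rw [projectThree, hp, hq]
  simp [Matrix.diagonal_apply]

end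

/-! ### Umbilicity of both planes in an adapted frame. -/

section

set_option maxHeartbeats 1000000 in
-- `D` is `∇v = ∇(U²)` expanded by the Leibniz rule, and `∇h = -∇v`. For each plane the trace-free
-- symmetric part of the second fundamental form has two components along each of two normals. The
-- derivation index lies in the plane, so `V` gives the equations at indices `0, 1` and `H` those at
-- `2, 3`.
lemma umbilical_triple_iff (e f b c : Fin 4 → ℝ) {D : Fin 4 → Fin 4 → Fin 4 → ℝ}
    (hD : ∀ k i j, D k i j
      = mulG minkowski (form (triple 0 e f) (triple 0 b c) k) timelikeForm i j
        + mulG minkowski timelikeForm (form (triple 0 e f) (triple 0 b c) k) i j) :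
    (UmbilicalArr (mulG minkowski timelikeForm timelikeForm)
        (projectThree minkowski (mulG minkowski timelikeForm timelikeForm)
          (fun i j => minkowski i j - mulG minkowski timelikeForm timelikeForm i j) D) ∧
      UmbilicalArr (fun i j => minkowski i j - mulG minkowski timelikeForm timelikeForm i j)
        (projectThree minkowski
          (fun i j => minkowski i j - mulG minkowski timelikeForm timelikeForm i j)
          (mulG minkowski timelikeForm timelikeForm) (fun k i j => -D k i j))) ↔
      UmbilicalEqs e f b c := by
  simp only [UmbilicalArr, projectThree_of_diagonal inv_minkowski_mul_v inv_minkowski_mul_h,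
    projectThree_of_diagonal inv_minkowski_mul_h inv_minkowski_mul_v]
  simp only [hD, mulG_eq_ctr, ctr_minkowski]
  clear hD
  constructor
  · rintro ⟨⟨v, hv⟩, ⟨h, hh⟩⟩
    have v1 := hv 0 1 2
    have v2 := hv 0 0 2
    have v3 := hv 1 1 2
    have v4 := hv 0 1 3
    have v5 := hv 0 0 3
    have v6 := hv 1 1 3
    have h1 := hh 2 3 0
    have h2 := hh 2 2 0
    have h3 := hh 3 3 0
    have h4 := hh 2 3 1
    have h5 := hh 2 2 1
    have h6 := hh 3 3 1
    clear hv hh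
    simp [triple, form, timelikeForm, minkowski] at *
    refine ⟨⟨?_, ?_, ?_, ?_⟩, ?_, ?_, ?_, ?_⟩ <;> linarith
  · rintro ⟨⟨a0, a1, a2, a3⟩, a4, a5, a6, a7⟩
    -- These normal vectors are forced: they are read off the `(0,0,·)` components for `V`, where
    -- the induced metric is `-1`, and the `(2,2,·)` components for `H`.
    refine ⟨⟨![0, 0, c 0, -b 0], ?_⟩, ⟨![c 2, e 2, 0, 0], ?_⟩⟩ <;> intro i j k <;>
      fin_cases i <;> fin_cases j <;> fin_cases k <;>
        simp [triple, form, timelikeForm, minkowski] <;> linarith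

end

section

/-! ### Change of frame for the composite arrays -/

variable {P : Matrix (Fin 4) (Fin 4) ℝ} {G G' : Matrix (Fin 4) (Fin 4) ℝ}

lemma tr2_metric (hG : P.transpose * G * P = G') (i j : Fin 4) :
    tr2 P (fun i j => G i j) i j = G' i j := by
  rw [← hG, ← tr2_eq_mul]; rfl

lemma interior_tr_three (hP : IsUnit P.det) (hG : P.transpose * G * P = G') (a : Fin 4 → ℝ)
    (F : Fin 4 → Fin 4 → Fin 4 → Fin 4 → ℝ) (k i j : Fin 4) :
    tr3 P (fun k i j => interior G a (fun m n => F m n i j) k) k i j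
      = interior G' (tr1 P a) (fun m n => tr4 P F m n i j) k := by
  simp only [interior_eq_ctr, tr3, tr2, tr1_ctr, tr1_mul]
  rw [ctr_tr hP hG]
  refine ctr_congr _ fun m n => ?_
  have h := tr2_mul (P := P)
    (fun m => tr1 P (fun x => tr1 P (fun y => tr1 P (F m x y) j) i) k) a m n
  simp only [mul_comm] at h ⊢
  rw [h]; rfl

lemma tr3_add (S T : Fin 4 → Fin 4 → Fin 4 → ℝ) (i j k : Fin 4) :
    tr3 P (fun i j k => S i j k + T i j k) i j k = tr3 P S i j k + tr3 P T i j k := by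
  simp only [tr3, tr2, tr1_add]

lemma tr3_cyc (T : Fin 4 → Fin 4 → Fin 4 → ℝ) (i j k : Fin 4) :
    tr3 P (cyc T) i j k = cyc (tr3 P T) i j k := by
  have h : cyc T = fun i j k => T i j k + T j k i + T k i j := rfl
  rw [h, tr3_add, tr3_add, tr3_rotate P T, ← tr3_rotate P (fun a b c => T c a b) k i j, cyc]

lemma interiorMetric_tr (hP : IsUnit P.det) (hG : P.transpose * G * P = G') (a : Fin 4 → ℝ)
    (k i j : Fin 4) :
    tr3 P (interiorMetric G a) k i j = interiorMetric G' (tr1 P a) k i j := by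
  have h : interiorMetric G a = fun k i j =>
    interior G a (fun m n => (fun m n i j => G m i * G n j - G m j * G n i) m n i j) k := rfl
  rw [h, interior_tr_three hP hG, interiorMetric]
  congr 1
  funext m n
  simp only [tr4, tr3, tr2, tr1_sub, tr1_mul, tr1_mul_right]
  have e : ∀ i j, tr1 P (fun a => tr1 P (fun b => G a b) j) i = G' i j := tr2_metric hG
  simp only [e]

lemma interiorVol_tr (hP : IsUnit P.det) (hG : P.transpose * G * P = G')
    (V : Fin 4 → Fin 4 → Fin 4 → Fin 4 → ℝ) (a : Fin 4 → ℝ) (k i j : Fin 4) :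
    tr3 P (interiorVol G V a) k i j = interiorVol G' (tr4 P V) (tr1 P a) k i j :=
  interior_tr_three hP hG a V k i j

lemma phiArr_tr (hP : IsUnit P.det) (hG : P.transpose * G * P = G') (U W : Fin 4 → Fin 4 → ℝ)
    (a b : Fin 4 → ℝ) (k : Fin 4) :
    tr1 P (phiArr G U W a b) k
      = phiArr G' (tr2 P U) (tr2 P W) (tr1 P a) (tr1 P b) k := by
  have h : phiArr G U W a b = fun k => interior G a U k - interior G b W k := rfl
  rw [h, tr1_sub, interior_tr hP hG, interior_tr hP hG, phiArr]

lemma psiArr_tr (hP : IsUnit P.det) (hG : P.transpose * G * P = G') (U W : Fin 4 → Fin 4 → ℝ)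
    (a b : Fin 4 → ℝ) (k : Fin 4) :
    tr1 P (psiArr G U W a b) k
      = psiArr G' (tr2 P U) (tr2 P W) (tr1 P a) (tr1 P b) k := by
  have h : psiArr G U W a b = fun k => -interior G a W k - interior G b U k := rfl
  rw [h, tr1_sub, tr1_neg, interior_tr hP hG, interior_tr hP hG, psiArr]

lemma tr3_mul (w : Fin 4 → ℝ) (A : Fin 4 → Fin 4 → ℝ) (k i j : Fin 4) :
    tr3 P (fun k i j => w k * A i j) k i j = tr1 P w k * tr2 P A i j := by
  simp only [tr3, tr2, tr1_mul, tr1_mul_right]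

lemma tr3_sub (S T : Fin 4 → Fin 4 → Fin 4 → ℝ) (i j k : Fin 4) :
    tr3 P (fun i j k => S i j k - T i j k) i j k = tr3 P S i j k - tr3 P T i j k := by
  simp only [tr3, tr2, tr1_sub]

lemma tr3_neg (T : Fin 4 → Fin 4 → Fin 4 → ℝ) (i j k : Fin 4) :
    tr3 P (fun i j k => -T i j k) i j k = -tr3 P T i j k := by
  simp only [tr3, tr2, tr1_neg]

lemma tr3_const_mul (c : ℝ) (T : Fin 4 → Fin 4 → Fin 4 → ℝ) (i j k : Fin 4) :
    tr3 P (fun i j k => c * T i j k) i j k = c * tr3 P T i j k := by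
  simp only [tr3, tr2, tr1_mul]

lemma sigRe_tr (hP : IsUnit P.det) (hG : P.transpose * G * P = G')
    (V : Fin 4 → Fin 4 → Fin 4 → Fin 4 → ℝ) (U W : Fin 4 → Fin 4 → ℝ)
    (N : Fin 4 → Fin 4 → Fin 4 → ℝ) (a b : Fin 4 → ℝ) (k i j : Fin 4) :
    tr3 P (sigRe G V U W N a b) k i j
      = sigRe G' (tr4 P V) (tr2 P U) (tr2 P W) (tr3 P N) (tr1 P a) (tr1 P b) k i j := by
  have h : sigRe G V U W N a b = fun k i j => N k i j
      - 1 / 2 * (phiArr G U W a b k * U i j + psiArr G U W a b k * W i j)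
      - 1 / 2 * (interiorMetric G a k i j - interiorVol G V b k i j) := rfl
  rw [h, sigRe]
  simp only [tr3_sub, tr3_const_mul, tr3_add, tr3_mul, phiArr_tr hP hG, psiArr_tr hP hG]
  rw [← interiorMetric_tr hP hG, ← interiorVol_tr hP hG]

lemma sigIm_tr (hP : IsUnit P.det) (hG : P.transpose * G * P = G')
    (V : Fin 4 → Fin 4 → Fin 4 → Fin 4 → ℝ) (U W : Fin 4 → Fin 4 → ℝ)
    (M : Fin 4 → Fin 4 → Fin 4 → ℝ) (a b : Fin 4 → ℝ) (k i j : Fin 4) :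
    tr3 P (sigIm G V U W M a b) k i j
      = sigIm G' (tr4 P V) (tr2 P U) (tr2 P W) (tr3 P M) (tr1 P a) (tr1 P b) k i j := by
  have h : sigIm G V U W M a b = fun k i j => -M k i j
      - 1 / 2 * (psiArr G U W a b k * U i j - phiArr G U W a b k * W i j)
      + 1 / 2 * (interiorMetric G b k i j + interiorVol G V a k i j) := rfl
  rw [h, sigIm]
  simp only [tr3_sub, tr3_const_mul, tr3_add, tr3_neg, tr3_mul, phiArr_tr hP hG, psiArr_tr hP hG]
  rw [← interiorMetric_tr hP hG, ← interiorVol_tr hP hG]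

lemma ckyArr_tr (hG : P.transpose * G * P = G') (T : Fin 4 → Fin 4 → Fin 4 → ℝ)
    (d : Fin 4 → ℝ) (i j k : Fin 4) :
    tr3 P (ckyArr G T d) i j k = ckyArr G' (tr3 P T) (tr1 P d) i j k := by
  have h : ckyArr G T d = fun i j k => 1 / 2 * (T i j k + (fun i j k => T j i k) i j k)
      + 1 / 3 * ((fun i j k => G i j * d k) i j k
        - 1 / 2 * ((fun i j k => d i * G j k) i j k + (fun i j k => d j * G i k) i j k)) := rfl
  have e : ∀ i j, tr1 P (fun a => tr1 P (fun b => G a b) j) i = G' i j := tr2_metric hG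
  rw [h, ckyArr]
  rw [tr3_add, tr3_const_mul, tr3_add, tr3_swap P T, tr3_const_mul, tr3_sub, tr3_const_mul,
    tr3_add]
  congr 3
  · simp only [tr3, tr2, tr1_mul, tr1_mul_right, e]
  · congr 1
    simp only [tr3, tr2, tr1_mul, tr1_mul_right, e]

/-- The normal covector is existentially quantified, so the converse needs every covector of the new
frame to come from the old one (`tr1_surjective`). -/
lemma UmbilicalArr_tr (hP : IsUnit P.det) (p : Fin 4 → Fin 4 → ℝ)
    (F : Fin 4 → Fin 4 → Fin 4 → ℝ) :
    UmbilicalArr p F ↔ UmbilicalArr (tr2 P p) (tr3 P F) := by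
  have key : ∀ c : Fin 4 → ℝ, ∀ i j k,
      tr3 P (fun i j k => (1 / 2) * (F i j k + (fun i j k => F j i k) i j k) - p i j * c k) i j k
        = (1 / 2) * (tr3 P F i j k + tr3 P F j i k) - tr2 P p i j * tr1 P c k := by
    intro c i j k
    rw [tr3_sub, tr3_const_mul, tr3_add, tr3_swap P F]
    simp only [tr3, tr2, tr1_mul, tr1_mul_right]
  constructor
  · rintro ⟨c, hc⟩
    refine ⟨tr1 P c, fun i j k => ?_⟩
    rw [← sub_eq_zero, ← key]
    exact (tr3_eq_zero_iff hP _).1 (fun i j k => sub_eq_zero.2 (hc i j k)) i j k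
  · rintro ⟨c', hc⟩
    obtain ⟨c, rfl⟩ := tr1_surjective hP c'
    refine ⟨c, fun i j k => ?_⟩
    rw [← sub_eq_zero]
    exact (tr3_eq_zero_iff hP _).2 (fun i j k => by rw [key, sub_eq_zero]; exact hc i j k) i j k

/-! ### The shape of the derivatives of a unitary 2-form -/

/-- The hypotheses are the derivatives of `U·*U = 0` and `U² - (*U)² = g`. They remove the
components of `N` and `M` along `U` and `*U` and tie the others by duality. So `∇*U = *∇U` is
obtained here without differentiating the volume element. -/
lemma exists_triple_of_relations {N M : Fin 4 → Fin 4 → Fin 4 → ℝ}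
    (hN : ∀ k i j, N k i j = -N k j i) (hM : ∀ k i j, M k i j = -M k j i)
    (h1 : ∀ k i j, mulG minkowski (N k) spacelikeForm i j
      + mulG minkowski timelikeForm (M k) i j = 0)
    (h2 : ∀ k i j, mulG minkowski (N k) timelikeForm i j + mulG minkowski timelikeForm (N k) i j
      - (mulG minkowski (M k) spacelikeForm i j + mulG minkowski spacelikeForm (M k) i j) = 0) :
    ∃ e f b c : Fin 4 → ℝ, N = form (triple 0 e f) (triple 0 b c) ∧
      M = form (triple 0 b c) (-triple 0 e f) := by
  -- The entries of `form` other than its first electric and magnetic ones: `E₁ = N₀₂`, `E₂ = N₀₃`,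
  -- `B₁ = N₃₁`, `B₂ = N₁₂`.
  refine ⟨fun k => N k 0 2, fun k => N k 0 3, fun k => N k 3 1, fun k => N k 1 2, ?_, ?_⟩
  all_goals
    funext k i j
    have hN := hN k
    have hM := hM k
    have n00 := hN 0 0
    have n11 := hN 1 1
    have n22 := hN 2 2
    have n33 := hN 3 3
    have m00 := hM 0 0
    have m11 := hM 1 1
    have m22 := hM 2 2
    have m33 := hM 3 3
    have n01 := hN 0 1
    have n02 := hN 0 2
    have n03 := hN 0 3
    have n12 := hN 1 2
    have n13 := hN 1 3
    have n23 := hN 2 3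
    have m01 := hM 0 1
    have m02 := hM 0 2
    have m03 := hM 0 3
    have m12 := hM 1 2
    have m13 := hM 1 3
    have m23 := hM 2 3
    have a1 := h1 k 0 1
    have a2 := h1 k 0 0
    have a3 := h1 k 2 3
    have a4 := h1 k 2 2
    have a5 := h1 k 0 2
    have a6 := h1 k 0 3
    have a7 := h1 k 1 2
    have a8 := h1 k 1 3
    have b1 := h2 k 0 0
    have b2 := h2 k 2 2
    clear h1 h2 hN hM
    simp only [mulG_eq_ctr, ctr_minkowski] at *
    simp [timelikeForm, spacelikeForm] at *
    fin_cases i <;> fin_cases j <;> simp [form, triple] <;> linarith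

end

section

/-! ### Partial derivatives and covariant derivatives in `ℝ⁴` -/

lemma pd_congr {f h : R4 → ℝ} {x : R4} (H : f =ᶠ[𝓝 x] h) (i : Fin 4) : pd i f x = pd i h x := by
  rw [pd, pd, H.fderiv_eq]

lemma pd_add {f h : R4 → ℝ} {x : R4} (hf : DifferentiableAt ℝ f x) (hh : DifferentiableAt ℝ h x)
    (i : Fin 4) : pd i (fun y => f y + h y) x = pd i f x + pd i h x := by
  simp [pd, fderiv_fun_add hf hh]

lemma pd_sub {f h : R4 → ℝ} {x : R4} (hf : DifferentiableAt ℝ f x) (hh : DifferentiableAt ℝ h x)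
    (i : Fin 4) : pd i (fun y => f y - h y) x = pd i f x - pd i h x := by
  simp [pd, fderiv_fun_sub hf hh]

lemma pd_neg (f : R4 → ℝ) (x : R4) (i : Fin 4) : pd i (fun y => -f y) x = -pd i f x := by
  simp [pd, fderiv_fun_neg]

lemma pd_const (c : ℝ) (x : R4) (i : Fin 4) : pd i (fun _ => c) x = 0 := by
  simp [pd]

lemma pd_mul {f h : R4 → ℝ} {x : R4} (hf : DifferentiableAt ℝ f x) (hh : DifferentiableAt ℝ h x)
    (i : Fin 4) : pd i (fun y => f y * h y) x = pd i f x * h x + f x * pd i h x := by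
  simp [pd, fderiv_fun_mul hf hh]
  ring

lemma pd_sum {ι : Type*} {s : Finset ι} {f : ι → R4 → ℝ} {x : R4}
    (hf : ∀ r ∈ s, DifferentiableAt ℝ (f r) x) (i : Fin 4) :
    pd i (fun y => ∑ r ∈ s, f r y) x = ∑ r ∈ s, pd i (f r) x := by
  simp [pd, fderiv_fun_sum hf]

/-- The matrix of the partial derivatives of the entries. -/
def pdM (k : Fin 4) (A : R4 → Matrix (Fin 4) (Fin 4) ℝ) (x : R4) : Matrix (Fin 4) (Fin 4) ℝ :=
  Matrix.of fun i j => pd k (fun y => A y i j) x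

/-- Differentiability of the entries. -/
def DiffM (A : R4 → Matrix (Fin 4) (Fin 4) ℝ) (x : R4) : Prop :=
  ∀ i j, DifferentiableAt ℝ (fun y => A y i j) x

lemma DiffM.mul {A B : R4 → Matrix (Fin 4) (Fin 4) ℝ} {x : R4} (hA : DiffM A x)
    (hB : DiffM B x) : DiffM (fun y => A y * B y) x := by
  intro i j
  simp only [Matrix.mul_apply]
  exact DifferentiableAt.fun_sum fun a _ => (hA i a).mul (hB a j)

lemma pdM_mul {A B : R4 → Matrix (Fin 4) (Fin 4) ℝ} {x : R4} (hA : DiffM A x)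
    (hB : DiffM B x) (k : Fin 4) :
    pdM k (fun y => A y * B y) x = pdM k A x * B x + A x * pdM k B x := by
  ext i j
  simp only [pdM, Matrix.of_apply, Matrix.add_apply, Matrix.mul_apply]
  rw [pd_sum (f := fun a y => A y i a * B y a j) fun a _ => (hA i a).mul (hB a j), ← Finset.sum_add_distrib]
  exact Finset.sum_congr rfl fun a _ => pd_mul (hA i a) (hB a j) k

lemma pdM_congr {A B : R4 → Matrix (Fin 4) (Fin 4) ℝ} {x : R4} (H : A =ᶠ[𝓝 x] B) (k : Fin 4) :
    pdM k A x = pdM k B x := by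
  ext i j
  exact pd_congr (H.mono fun y hy => by rw [hy]) k

lemma contDiffOn_det {n : WithTop ℕ∞} {s : Set R4} {A : R4 → Matrix (Fin 4) (Fin 4) ℝ}
    (hA : ∀ i j, ContDiffOn ℝ n (fun y => A y i j) s) : ContDiffOn ℝ n (fun y => (A y).det) s := by
  simp only [Matrix.det_apply]
  refine ContDiffOn.sum fun σ _ => ContDiffOn.const_smul _ ?_
  exact contDiffOn_prod fun i _ => hA _ _

lemma contDiffOn_inv {n : WithTop ℕ∞} {s : Set R4} {A : R4 → Matrix (Fin 4) (Fin 4) ℝ}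
    (hA : ∀ i j, ContDiffOn ℝ n (fun y => A y i j) s) (h0 : ∀ y ∈ s, (A y).det ≠ 0)
    (i j : Fin 4) : ContDiffOn ℝ n (fun y => (A y)⁻¹ i j) s := by
  simp only [Matrix.inv_def, Matrix.smul_apply, Ring.inverse_eq_inv', smul_eq_mul]
  refine ((contDiffOn_det hA).inv h0).mul ?_
  simp only [Matrix.adjugate_apply]
  refine contDiffOn_det fun a b => ?_
  by_cases h : a = j
  · subst h
    simp only [Matrix.updateRow_self]
    exact contDiffOn_const
  · simp only [Matrix.updateRow_ne h]
    exact hA a b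

lemma contDiffOn_pd {s : Set R4} (hs : IsOpen s) {f : R4 → ℝ} (hf : ContDiffOn ℝ ∞ f s)
    (i : Fin 4) : ContDiffOn ℝ ∞ (pd i f) s := by
  have h := hf.fderiv_of_isOpen hs (m := ∞) (by simp)
  exact h.clm_apply contDiffOn_const

lemma pd_comm {s : Set R4} (hs : IsOpen s) {f : R4 → ℝ} (hf : ContDiffOn ℝ ∞ f s) {x : R4}
    (hx : x ∈ s) (i j : Fin 4) : pd i (pd j f) x = pd j (pd i f) x := by
  have h2 : ContDiffAt ℝ 2 f x := (hf.contDiffAt (hs.mem_nhds hx)).of_le 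
    ENat.LEInfty.out
  have hsymm : IsSymmSndFDerivAt ℝ f x := h2.isSymmSndFDerivAt (by simp)
  have hd : DifferentiableAt ℝ (fderiv ℝ f) x :=
    (h2.fderiv_right (m := 1) (by norm_num)).differentiableAt (by norm_num)
  have e : ∀ a b : Fin 4, pd a (pd b f) x
      = fderiv ℝ (fderiv ℝ f) x (EuclideanSpace.single a 1) (EuclideanSpace.single b 1) := by
    intro a b
    have : pd b f = fun y => fderiv ℝ f y (EuclideanSpace.single b 1) := rfl
    rw [this, pd, fderiv_clm_apply hd (differentiableAt_const _)]
    simp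
  rw [e, e]
  exact hsymm _ _

/-- The matrix of the Christoffel symbols `Γ^l_{ki}`, for fixed `k`. -/
def christoffelM (g : R4 → Matrix (Fin 4) (Fin 4) ℝ) (x : R4) (k : Fin 4) :
    Matrix (Fin 4) (Fin 4) ℝ :=
  Matrix.of fun l i => christoffel g x l k i

variable {g : R4 → Matrix (Fin 4) (Fin 4) ℝ} {x : R4}

lemma christoffel_comm (hg : ∀ y i j, g y i j = g y j i) (k i j : Fin 4) :
    christoffel g x k i j = christoffel g x k j i := by
  simp only [christoffel]
  congr 1
  refine Finset.sum_congr rfl fun l _ => ?_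
  have h : (fun y => g y i j) = fun y => g y j i := by funext y; exact hg y i j
  rw [h]; ring

lemma nabla_eq (A : R4 → Matrix (Fin 4) (Fin 4) ℝ) (k : Fin 4) :
    (Matrix.of (nabla g (fun y => A y) x k) : Matrix (Fin 4) (Fin 4) ℝ)
      = pdM k A x - (christoffelM g x k).transpose * A x - A x * christoffelM g x k := by
  ext i j
  simp only [nabla, pdM, christoffelM, Matrix.of_apply, Matrix.sub_apply, Matrix.mul_apply,
    Matrix.transpose_apply]
  congr 1
  exact Finset.sum_congr rfl fun _ _ => mul_comm _ _

lemma nabla_antisymm {A : R4 → Fin 4 → Fin 4 → ℝ} (hA : ∀ y i j, A y i j = -A y j i)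
    (k i j : Fin 4) : nabla g A x k i j = -nabla g A x k j i := by
  have h : (fun y => A y i j) = fun y => -A y j i := by funext y; exact hA y i j
  simp only [nabla]
  rw [h, pd_neg]
  have e1 : ∑ l, christoffel g x l k i * A x l j = -∑ l, christoffel g x l k i * A x j l := by
    rw [← Finset.sum_neg_distrib]
    exact Finset.sum_congr rfl fun l _ => by rw [hA x l j]; ring
  have e2 : ∑ l, christoffel g x l k j * A x i l = -∑ l, christoffel g x l k j * A x l i := by
    rw [← Finset.sum_neg_distrib]
    exact Finset.sum_congr rfl fun l _ => by rw [hA x i l]; ring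
  rw [e1, e2]; ring

/-- The connection is torsion-free: Christoffel symbols, symmetric in their lower indices, cancel in
pairs against the antisymmetric `A`. -/
lemma dTwo_eq_cyc (hg : ∀ y i j, g y i j = g y j i) {A : R4 → Fin 4 → Fin 4 → ℝ}
    (hA : ∀ y i j, A y i j = -A y j i) (i j k : Fin 4) :
    dTwo A x i j k = cyc (nabla g A x) i j k := by
  have key : ∀ i j k, ∑ l, christoffel g x l i j * A x l k
      = -∑ l, christoffel g x l j i * A x k l := by
    intro i j k
    rw [← Finset.sum_neg_distrib]
    exact Finset.sum_congr rfl fun l _ => by rw [hA x l k, christoffel_comm hg]; ring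
  simp only [cyc, dTwo, nabla]
  rw [key i j k, key j k i, key k i j]
  ring

lemma nabla_congr {A B : R4 → Fin 4 → Fin 4 → ℝ} (H : A =ᶠ[𝓝 x] B) (k i j : Fin 4) :
    nabla g A x k i j = nabla g B x k i j := by
  simp only [nabla]
  rw [pd_congr (H.mono fun y hy => congrFun (congrFun hy i) j :
    (fun y => A y i j) =ᶠ[𝓝 x] fun y => B y i j),
    H.eq_of_nhds]

lemma nabla_add {A B : R4 → Fin 4 → Fin 4 → ℝ}
    (hA : ∀ i j, DifferentiableAt ℝ (fun y => A y i j) x)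
    (hB : ∀ i j, DifferentiableAt ℝ (fun y => B y i j) x) (k i j : Fin 4) :
    nabla g (fun y i j => A y i j + B y i j) x k i j = nabla g A x k i j + nabla g B x k i j := by
  simp only [nabla]
  rw [pd_add (hA i j) (hB i j)]
  simp only [mul_add, Finset.sum_add_distrib]
  ring

lemma nabla_sub {A B : R4 → Fin 4 → Fin 4 → ℝ}
    (hA : ∀ i j, DifferentiableAt ℝ (fun y => A y i j) x)
    (hB : ∀ i j, DifferentiableAt ℝ (fun y => B y i j) x) (k i j : Fin 4) :
    nabla g (fun y i j => A y i j - B y i j) x k i j = nabla g A x k i j - nabla g B x k i j := by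
  simp only [nabla]
  rw [pd_sub (hA i j) (hB i j)]
  simp only [mul_sub, Finset.sum_sub_distrib]
  ring

lemma nabla_smul {a : R4 → ℝ} {A : R4 → Fin 4 → Fin 4 → ℝ} (ha : DifferentiableAt ℝ a x)
    (hA : ∀ i j, DifferentiableAt ℝ (fun y => A y i j) x) (k i j : Fin 4) :
    nabla g (fun y i j => a y * A y i j) x k i j
      = pd k a x * A x i j + a x * nabla g A x k i j := by
  simp only [nabla]
  rw [pd_mul ha (hA i j)]
  have e1 : ∑ l, christoffel g x l k i * (a x * A x l j)
      = a x * ∑ l, christoffel g x l k i * A x l j := by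
    rw [Finset.mul_sum]; exact Finset.sum_congr rfl fun _ _ => by ring
  have e2 : ∑ l, christoffel g x l k j * (a x * A x i l)
      = a x * ∑ l, christoffel g x l k j * A x i l := by
    rw [Finset.mul_sum]; exact Finset.sum_congr rfl fun _ _ => by ring
  rw [e1, e2]; ring

/-- Lowering the upper index of the Christoffel symbol leaves the three-term combination of
derivatives of `g`; two such combinations add up to `∂g`. -/
lemma nabla_metric (hg : ∀ y i j, g y i j = g y j i) (hdet : IsUnit (g x).det) (k i j : Fin 4) :
    nabla g (fun y => g y) x k i j = 0 := by
  have lower : ∀ k i j, ∑ l, christoffel g x l k i * g x l j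
      = (1 / 2) * (pd k (fun y => g y i j) x + pd i (fun y => g y k j) x
        - pd j (fun y => g y k i) x) := by
    intro k i j
    have hinv : ∀ m, ∑ l, g x j l * (g x)⁻¹ l m = if j = m then 1 else 0 := by
      intro m
      have := congrFun (congrFun (Matrix.mul_nonsing_inv (g x) hdet) j) m
      rwa [Matrix.mul_apply, Matrix.one_apply] at this
    simp only [christoffel]
    calc ∑ l, (1 / 2) * (∑ m, (g x)⁻¹ l m * (pd k (fun y => g y i m) x + pd i (fun y => g y k m) x
          - pd m (fun y => g y k i) x)) * g x l j
        = ∑ m, (1 / 2) * (∑ l, g x j l * (g x)⁻¹ l m) * (pd k (fun y => g y i m) x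
          + pd i (fun y => g y k m) x - pd m (fun y => g y k i) x) := by
          simp only [Finset.mul_sum, Finset.sum_mul]
          rw [Finset.sum_comm]
          refine Finset.sum_congr rfl fun _ _ => Finset.sum_congr rfl fun l _ => ?_
          rw [hg x j l]; ring
      _ = _ := by
          simp only [hinv]
          simp
  have e2 : ∑ l, christoffel g x l k j * g x i l = ∑ l, christoffel g x l k j * g x l i :=
    Finset.sum_congr rfl fun l _ => by rw [hg x i l]
  have s : ∀ i j, (fun y => g y i j) = fun y => g y j i := fun i j => by
    funext y; exact hg y i j
  simp only [nabla]
  rw [e2, lower, lower, s j i, s k j, s k i]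
  ring

lemma pdM_inv (hdiff : DiffM g x) (hdiff' : DiffM (fun y => (g y)⁻¹) x)
    (hdet : ∀ᶠ y in 𝓝 x, IsUnit (g y).det) (k : Fin 4) :
    pdM k (fun y => (g y)⁻¹) x = -((g x)⁻¹ * pdM k g x * (g x)⁻¹) := by
  have h1 : pdM k (fun y => g y * (g y)⁻¹) x = 0 := by
    have : (fun y => g y * (g y)⁻¹) =ᶠ[𝓝 x] fun _ => 1 :=
      hdet.mono fun y hy => Matrix.mul_nonsing_inv _ hy
    rw [pdM_congr this]
    ext i j
    simp [pdM, pd_const]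
  rw [pdM_mul hdiff hdiff'] at h1
  have hx := hdet.self_of_nhds
  have h2 := congrArg (fun X => (g x)⁻¹ * X) h1
  simp only [Matrix.mul_add, Matrix.mul_zero] at h2
  rw [← Matrix.mul_assoc (g x)⁻¹ (g x), Matrix.nonsing_inv_mul _ hx, Matrix.one_mul,
    ← Matrix.mul_assoc] at h2
  exact eq_neg_of_add_eq_zero_right h2

/-- Metricity `∂g = Γᵀg + gΓ` gives `∂g⁻¹ = -g⁻¹Γᵀ - Γg⁻¹`. These terms supply the missing
connection terms at the contracted index, so the ordinary product rule becomes the covariant one. -/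
lemma nabla_mulG (hg : ∀ y i j, g y i j = g y j i) (hdiff : DiffM g x)
    (hdiff' : DiffM (fun y => (g y)⁻¹) x) (hdet : ∀ᶠ y in 𝓝 x, IsUnit (g y).det)
    {A B : R4 → Fin 4 → Fin 4 → ℝ} (hA : ∀ i j, DifferentiableAt ℝ (fun y => A y i j) x)
    (hB : ∀ i j, DifferentiableAt ℝ (fun y => B y i j) x) (k i j : Fin 4) :
    nabla g (fun y => mulG (g y) (A y) (B y)) x k i j
      = mulG (g x) (nabla g A x k) (B x) i j + mulG (g x) (A x) (nabla g B x k) i j := by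
  set A' : R4 → Matrix (Fin 4) (Fin 4) ℝ := A with hA'
  set B' : R4 → Matrix (Fin 4) (Fin 4) ℝ := B with hB'
  have hx := hdet.self_of_nhds
  have hΓ : pdM k g x = (christoffelM g x k).transpose * g x + g x * christoffelM g x k := by
    have h := nabla_eq (g := g) (x := x) g k
    have h0 : (Matrix.of (nabla g (fun y => g y) x k) : Matrix (Fin 4) (Fin 4) ℝ) = 0 := by
      ext i j; exact nabla_metric hg hx k i j
    rw [h0] at h
    rw [eq_comm, sub_sub, sub_eq_zero] at h
    exact h
  have hinv : pdM k (fun y => (g y)⁻¹) x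
      = -((g x)⁻¹ * (christoffelM g x k).transpose) - christoffelM g x k * (g x)⁻¹ := by
    rw [pdM_inv hdiff hdiff' hdet, hΓ, Matrix.mul_add, Matrix.add_mul, ← Matrix.mul_assoc,
      Matrix.mul_assoc _ (g x), Matrix.mul_nonsing_inv _ hx, ← Matrix.mul_assoc (g x)⁻¹ (g x),
      Matrix.nonsing_inv_mul _ hx, Matrix.mul_one, Matrix.one_mul, neg_add, sub_eq_add_neg]
  have h1 : (fun y => mulG (g y) (A y) (B y)) = fun y => (A' y * (g y)⁻¹ * B' y) := by
    funext y
    exact mulG_eq_mul (g y) (A' y) (B' y)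
  have h2 : (Matrix.of (nabla g (fun y => (A' y * (g y)⁻¹ * B' y)) x k) :
      Matrix (Fin 4) (Fin 4) ℝ)
      = Matrix.of (nabla g A' x k) * (g x)⁻¹ * B' x
        + A' x * (g x)⁻¹ * Matrix.of (nabla g B' x k) := by
    have hA'' : DiffM A' x := hA
    have hB'' : DiffM B' x := hB
    rw [nabla_eq (fun y => (A' y * (g y)⁻¹ * B' y)), nabla_eq A', nabla_eq B',
      pdM_mul (hA''.mul hdiff') hB'', pdM_mul hA'' hdiff', hinv]
    noncomm_ring
  have h3 := congrFun (congrFun h2 i) j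
  rw [h1]
  rw [← mulG_eq_mul, ← mulG_eq_mul] at h3
  exact h3

end

section

/-! ### The equations at a point of a coordinate domain -/

/-- The columns of `P` are an oriented orthonormal frame adapted to the 2+2 structure of `U`, whose
Hodge dual is `W`. -/
structure AdaptedFrame (G : Matrix (Fin 4) (Fin 4) ℝ) (V : Fin 4 → Fin 4 → Fin 4 → Fin 4 → ℝ)
    (U W : Fin 4 → Fin 4 → ℝ) (P : Matrix (Fin 4) (Fin 4) ℝ) : Prop where
  isUnit_det : IsUnit P.det
  metric : P.transpose * G * P = minkowski
  vol : tr4 P V = levi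
  timelike : tr2 P U = timelikeForm
  spacelike : tr2 P W = spacelikeForm

/-- The components, in a coordinate domain `s`, of the metric `g`, its volume element `V`, a unitary
2-form `U` and its Hodge dual `W`. -/
structure UnitaryComponents (g : R4 → Matrix (Fin 4) (Fin 4) ℝ)
    (V : R4 → Fin 4 → Fin 4 → Fin 4 → Fin 4 → ℝ) (U W : R4 → Fin 4 → Fin 4 → ℝ)
    (s : Set R4) : Prop where
  isOpen : IsOpen s
  symm : ∀ y i j, g y i j = g y j i
  antisymm_U : ∀ y i j, U y i j = -U y j i
  antisymm_W : ∀ y i j, W y i j = -W y j i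
  smooth_g : ∀ i j, ContDiffOn ℝ ∞ (fun y => g y i j) s
  smooth_V : ∀ i j k l, ContDiffOn ℝ ∞ (fun y => V y i j k l) s
  smooth_U : ∀ i j, ContDiffOn ℝ ∞ (fun y => U y i j) s
  smooth_W : ∀ i j, ContDiffOn ℝ ∞ (fun y => W y i j) s
  exists_frame : ∀ y ∈ s, ∃ P, AdaptedFrame (g y) (V y) (U y) (W y) P

/-- The codifferential of a 2-form with Hodge dual `W`. -/
def codiffArr (g : R4 → Matrix (Fin 4) (Fin 4) ℝ) (V : R4 → Fin 4 → Fin 4 → Fin 4 → Fin 4 → ℝ)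
    (W : R4 → Fin 4 → Fin 4 → ℝ) (x : R4) : Fin 4 → ℝ :=
  starThree (g x) (V x) (dTwo W x)

lemma AdaptedFrame.isUnit_det_metric {G P : Matrix (Fin 4) (Fin 4) ℝ}
    {V : Fin 4 → Fin 4 → Fin 4 → Fin 4 → ℝ} {U W : Fin 4 → Fin 4 → ℝ}
    (h : AdaptedFrame G V U W P) : IsUnit G.det := by
  have := congrArg Matrix.det h.metric
  rw [Matrix.det_mul, Matrix.det_mul, Matrix.det_transpose] at this
  have hm : minkowski.det = -1 := by simp [minkowski, Fin.prod_univ_four]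
  rw [hm] at this
  rw [isUnit_iff_ne_zero]
  rintro h0
  rw [h0] at this
  norm_num at this

lemma diffAt_of_contDiffOn {s : Set R4} (hs : IsOpen s) {f : R4 → ℝ} (hf : ContDiffOn ℝ ∞ f s)
    {x : R4} (hx : x ∈ s) : DifferentiableAt ℝ f x :=
  (hf.contDiffAt (hs.mem_nhds hx)).differentiableAt (by simp)

namespace UnitaryComponents

variable {g : R4 → Matrix (Fin 4) (Fin 4) ℝ} {V : R4 → Fin 4 → Fin 4 → Fin 4 → Fin 4 → ℝ}
  {U W : R4 → Fin 4 → Fin 4 → ℝ} {s : Set R4}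


lemma isUnit_det (H : UnitaryComponents g V U W s) {y : R4} (hy : y ∈ s) : IsUnit (g y).det := by
  obtain ⟨P, hP⟩ := H.exists_frame y hy
  exact hP.isUnit_det_metric

lemma smooth_inv (H : UnitaryComponents g V U W s) (i j : Fin 4) : ContDiffOn ℝ ∞ (fun y => (g y)⁻¹ i j) s :=
  contDiffOn_inv H.smooth_g (fun _ hy => (H.isUnit_det hy).ne_zero) i j

lemma nabla_mulG (H : UnitaryComponents g V U W s) {x : R4} (hx : x ∈ s) {A B : R4 → Fin 4 → Fin 4 → ℝ}
    (hA : ∀ i j, ContDiffOn ℝ ∞ (fun y => A y i j) s)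
    (hB : ∀ i j, ContDiffOn ℝ ∞ (fun y => B y i j) s) (k i j : Fin 4) :
    nabla g (fun y => mulG (g y) (A y) (B y)) x k i j
      = mulG (g x) (nabla g A x k) (B x) i j + mulG (g x) (A x) (nabla g B x k) i j :=
  CKY.nabla_mulG H.symm (fun i j => diffAt_of_contDiffOn H.isOpen (H.smooth_g i j) hx)
    (fun i j => diffAt_of_contDiffOn H.isOpen (H.smooth_inv i j) hx)
    ((H.isOpen.eventually_mem hx).mono fun _ hy => H.isUnit_det hy)
    (fun i j => diffAt_of_contDiffOn H.isOpen (hA i j) hx)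
    (fun i j => diffAt_of_contDiffOn H.isOpen (hB i j) hx) k i j

lemma smooth_mulG (H : UnitaryComponents g V U W s) {A B : R4 → Fin 4 → Fin 4 → ℝ}
    (hA : ∀ i j, ContDiffOn ℝ ∞ (fun y => A y i j) s)
    (hB : ∀ i j, ContDiffOn ℝ ∞ (fun y => B y i j) s) (i j : Fin 4) :
    ContDiffOn ℝ ∞ (fun y => mulG (g y) (A y) (B y) i j) s := by
  simp only [mulG]
  exact ContDiffOn.sum fun a _ => ContDiffOn.sum fun b _ =>
    ((hA i a).mul (H.smooth_inv a b)).mul (hB b j)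

/-- `U` lives on `V` and `*U` on the orthogonal plane `H`. -/
lemma mulG_U_W (H : UnitaryComponents g V U W s) {y : R4} (hy : y ∈ s) (i j : Fin 4) : mulG (g y) (U y) (W y) i j = 0 := by
  obtain ⟨P, hP⟩ := H.exists_frame y hy
  refine tr2_injective hP.isUnit_det (fun i j => ?_) i j
  rw [mulG_tr hP.isUnit_det hP.metric, hP.timelike, hP.spacelike, mulG_eq_ctr, ctr_minkowski]
  fin_cases i <;> fin_cases j <;> simp [timelikeForm, spacelikeForm]

/-- This is `v + h = g`, because `U² = v` and `(*U)² = -h`. -/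
lemma mulG_U_U (H : UnitaryComponents g V U W s) {y : R4} (hy : y ∈ s) (i j : Fin 4) :
    mulG (g y) (U y) (U y) i j - mulG (g y) (W y) (W y) i j - g y i j = 0 := by
  obtain ⟨P, hP⟩ := H.exists_frame y hy
  refine tr2_injective (A := fun i j => mulG (g y) (U y) (U y) i j - mulG (g y) (W y) (W y) i j
    - g y i j) hP.isUnit_det (fun i j => ?_) i j
  have h1 := mulG_tr hP.isUnit_det hP.metric (U y) (U y) i j
  have h2 := mulG_tr hP.isUnit_det hP.metric (W y) (W y) i j
  have h3 := tr2_metric hP.metric i j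
  simp only [tr2, tr1_sub] at h1 h2 h3 ⊢
  rw [h1, h2, h3]
  have e1 := hP.timelike
  have e2 := hP.spacelike
  simp only [funext_iff, tr2] at e1 e2
  simp only [mulG_eq_ctr, ctr_minkowski, tr2, e1, e2]
  fin_cases i <;> fin_cases j <;> simp [timelikeForm, spacelikeForm, minkowski]

lemma nabla_relation_one (H : UnitaryComponents g V U W s) {x : R4} (hx : x ∈ s) (k i j : Fin 4) :
    mulG (g x) (nabla g U x k) (W x) i j + mulG (g x) (U x) (nabla g W x k) i j = 0 := by
  rw [← H.nabla_mulG hx H.smooth_U H.smooth_W]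
  have h : (fun y => mulG (g y) (U y) (W y)) =ᶠ[𝓝 x] fun _ _ _ => 0 :=
    (H.isOpen.eventually_mem hx).mono fun y hy => by
      funext i j; exact H.mulG_U_W hy i j
  rw [nabla_congr h]
  simp [nabla, pd_const]

lemma nabla_relation_two (H : UnitaryComponents g V U W s) {x : R4} (hx : x ∈ s) (k i j : Fin 4) :
    mulG (g x) (nabla g U x k) (U x) i j + mulG (g x) (U x) (nabla g U x k) i j
      - (mulG (g x) (nabla g W x k) (W x) i j + mulG (g x) (W x) (nabla g W x k) i j) = 0 := by
  rw [← H.nabla_mulG hx H.smooth_U H.smooth_U, ← H.nabla_mulG hx H.smooth_W H.smooth_W,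
    ← nabla_sub
      (fun i j => diffAt_of_contDiffOn H.isOpen (H.smooth_mulG H.smooth_U H.smooth_U i j) hx)
      (fun i j => diffAt_of_contDiffOn H.isOpen (H.smooth_mulG H.smooth_W H.smooth_W i j) hx)]
  have h : (fun y i j => mulG (g y) (U y) (U y) i j - mulG (g y) (W y) (W y) i j)
      =ᶠ[𝓝 x] fun y => g y :=
    (H.isOpen.eventually_mem hx).mono fun y hy => by
      funext i j
      exact sub_eq_zero.1 (H.mulG_U_U hy i j)
  rw [nabla_congr h]
  exact nabla_metric H.symm (H.isUnit_det hx) k i j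

lemma tr3_mulG_left {x : R4} {P : Matrix (Fin 4) (Fin 4) ℝ}
    (hP : AdaptedFrame (g x) (V x) (U x) (W x) P) (T : Fin 4 → Fin 4 → Fin 4 → ℝ)
    (X : Fin 4 → Fin 4 → ℝ) (k i j : Fin 4) :
    tr3 P (fun k i j => mulG (g x) (T k) X i j) k i j
      = mulG minkowski (tr3 P T k) (tr2 P X) i j := by
  have e : tr3 P (fun k i j => mulG (g x) (T k) X i j) k i j
      = tr1 P (fun a => mulG minkowski (tr2 P (T a)) (tr2 P X) i j) k := by
    simp only [tr3]
    congr 1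
    funext a
    exact mulG_tr hP.isUnit_det hP.metric (T a) X i j
  rw [e]
  simp only [mulG_eq_ctr, tr1_ctr, tr1_mul_right]
  rfl

lemma tr3_mulG_right {x : R4} {P : Matrix (Fin 4) (Fin 4) ℝ}
    (hP : AdaptedFrame (g x) (V x) (U x) (W x) P) (T : Fin 4 → Fin 4 → Fin 4 → ℝ)
    (X : Fin 4 → Fin 4 → ℝ) (k i j : Fin 4) :
    tr3 P (fun k i j => mulG (g x) X (T k) i j) k i j
      = mulG minkowski (tr2 P X) (tr3 P T k) i j := by
  have e : tr3 P (fun k i j => mulG (g x) X (T k) i j) k i j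
      = tr1 P (fun a => mulG minkowski (tr2 P X) (tr2 P (T a)) i j) k := by
    simp only [tr3]
    congr 1
    funext a
    exact mulG_tr hP.isUnit_det hP.metric X (T a) i j
  rw [e]
  simp only [mulG_eq_ctr, tr1_ctr, tr1_mul]
  rfl

/-- The two algebraic relations hold throughout a neighbourhood, so they may be differentiated in
coordinates; only the result is transferred to the frame at `x`. -/
lemma exists_triple (H : UnitaryComponents g V U W s) {x : R4} (hx : x ∈ s) {P : Matrix (Fin 4) (Fin 4) ℝ}
    (hP : AdaptedFrame (g x) (V x) (U x) (W x) P) :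
    ∃ e f b c : Fin 4 → ℝ, tr3 P (nabla g U x) = form (triple 0 e f) (triple 0 b c) ∧
      tr3 P (nabla g W x) = form (triple 0 b c) (-triple 0 e f) := by
  have anti : ∀ {A : R4 → Fin 4 → Fin 4 → ℝ}, (∀ y i j, A y i j = -A y j i) → ∀ k i j,
      tr3 P (nabla g A x) k i j = -tr3 P (nabla g A x) k j i := by
    intro A hA k i j
    rw [← tr3_swap' P, ← tr3_neg]
    congr 1
    funext a b c
    exact nabla_antisymm hA a c b
  apply exists_triple_of_relations (anti H.antisymm_U) (anti H.antisymm_W)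
  · intro k i j
    rw [← hP.timelike, ← hP.spacelike, ← tr3_mulG_left hP, ← tr3_mulG_right hP,
      ← tr3_add]
    exact (tr3_eq_zero_iff hP.isUnit_det _).1 (H.nabla_relation_one hx) k i j
  · intro k i j
    rw [← hP.timelike, ← hP.spacelike, ← tr3_mulG_left hP, ← tr3_mulG_right hP,
      ← tr3_mulG_left hP, ← tr3_mulG_right hP, ← tr3_add, ← tr3_add,
      ← tr3_sub]
    exact (tr3_eq_zero_iff hP.isUnit_det _).1 (H.nabla_relation_two hx) k i j

/-- The codifferential in an adapted frame. -/
lemma codiffArr_frame (H : UnitaryComponents g V U W s) {x : R4} {P : Matrix (Fin 4) (Fin 4) ℝ}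
    (hP : AdaptedFrame (g x) (V x) (U x) (W x) P) {A : R4 → Fin 4 → Fin 4 → ℝ}
    (hA : ∀ y i j, A y i j = -A y j i) {E B : Fin 4 → Fin 3 → ℝ}
    (hE : tr3 P (nabla g A x) = form B (-E)) :
    tr1 P (codiffArr g V A x) = divForm E B := by
  funext l
  have h : dTwo A x = cyc (nabla g A x) := by
    funext i j k; exact dTwo_eq_cyc H.symm hA i j k
  have h' : tr3 P (cyc (nabla g A x)) = cyc (tr3 P (nabla g A x)) := by
    funext i j k; exact tr3_cyc _ i j k
  rw [codiffArr, starThree_tr hP.isUnit_det hP.metric, hP.vol, h, h', hE, starThree_form]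

end UnitaryComponents

end

/-! ### The pointwise equivalences in a coordinate domain. -/

section

namespace UnitaryComponents

variable {g : R4 → Matrix (Fin 4) (Fin 4) ℝ} {V : R4 → Fin 4 → Fin 4 → Fin 4 → Fin 4 → ℝ}
  {U W : R4 → Fin 4 → Fin 4 → ℝ} {s : Set R4}

lemma codiffArr_U_frame (H : UnitaryComponents g V U W s) {x : R4}
    {P : Matrix (Fin 4) (Fin 4) ℝ} (hP : AdaptedFrame (g x) (V x) (U x) (W x) P)
    {e f b c : Fin 4 → ℝ} (hM : tr3 P (nabla g W x) = form (triple 0 b c) (-triple 0 e f)) :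
    tr1 P (codiffArr g V W x) = divForm (triple 0 e f) (triple 0 b c) :=
  H.codiffArr_frame hP H.antisymm_W hM

/-- Since `**U = -U`, the array `-U` is the dual entering the codifferential of `*U`. -/
lemma codiffArr_W_frame (H : UnitaryComponents g V U W s) {x : R4}
    {P : Matrix (Fin 4) (Fin 4) ℝ} (hP : AdaptedFrame (g x) (V x) (U x) (W x) P)
    {e f b c : Fin 4 → ℝ} (hN : tr3 P (nabla g U x) = form (triple 0 e f) (triple 0 b c)) :
    tr1 P (codiffArr g V (fun y i j => -U y i j) x)
      = divForm (triple 0 b c) (-triple 0 e f) := by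
  refine H.codiffArr_frame hP (fun y i j => by rw [H.antisymm_U y i j]) ?_
  have h : nabla g (fun y i j => -U y i j) x = fun k i j => -nabla g U x k i j := by
    funext k i j
    simp only [nabla, pd_neg, mul_neg, Finset.sum_neg_distrib]
    ring
  funext k i j
  rw [h, tr3_neg, hN]
  fin_cases i <;> fin_cases j <;> simp [form]

/-- The equation `Σ = 0` at a point. -/
def SigZero (g : R4 → Matrix (Fin 4) (Fin 4) ℝ) (V : R4 → Fin 4 → Fin 4 → Fin 4 → Fin 4 → ℝ)
    (U W : R4 → Fin 4 → Fin 4 → ℝ) (x : R4) : Prop :=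
  ∀ k i j, sigRe (g x) (V x) (U x) (W x) (nabla g U x) (codiffArr g V W x)
      (codiffArr g V (fun y i j => -U y i j) x) k i j = 0 ∧
    sigIm (g x) (V x) (U x) (W x) (nabla g W x) (codiffArr g V W x)
      (codiffArr g V (fun y i j => -U y i j) x) k i j = 0

lemma sigZero_iff (H : UnitaryComponents g V U W s) {x : R4}
    {P : Matrix (Fin 4) (Fin 4) ℝ} (hP : AdaptedFrame (g x) (V x) (U x) (W x) P)
    {e f b c : Fin 4 → ℝ} (hN : tr3 P (nabla g U x) = form (triple 0 e f) (triple 0 b c))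
    (hM : tr3 P (nabla g W x) = form (triple 0 b c) (-triple 0 e f)) :
    SigZero g V U W x ↔ UmbilicalEqs e f b c := by
  rw [← sig_triple_iff, SigZero]
  have e1 := tr3_eq_zero_iff hP.isUnit_det (sigRe (g x) (V x) (U x) (W x) (nabla g U x)
    (codiffArr g V W x) (codiffArr g V (fun y i j => -U y i j) x))
  have e2 := tr3_eq_zero_iff hP.isUnit_det (sigIm (g x) (V x) (U x) (W x) (nabla g W x)
    (codiffArr g V W x) (codiffArr g V (fun y i j => -U y i j) x))
  simp only [sigRe_tr hP.isUnit_det hP.metric, sigIm_tr hP.isUnit_det hP.metric, hP.vol,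
    hP.timelike, hP.spacelike, hN, hM, H.codiffArr_U_frame hP hM,
    H.codiffArr_W_frame hP hN] at e1 e2
  simp only [forall_and, e1, e2]

/-- The projector on the time-like planes. -/
lemma projectors_frame {x : R4} {P : Matrix (Fin 4) (Fin 4) ℝ}
    (hP : AdaptedFrame (g x) (V x) (U x) (W x) P) :
    tr2 P (mulG (g x) (U x) (U x)) = mulG minkowski timelikeForm timelikeForm ∧
      tr2 P (fun i j => g x i j - mulG (g x) (U x) (U x) i j)
        = fun i j => minkowski i j - mulG minkowski timelikeForm timelikeForm i j := by
  have h1 : ∀ i j, tr2 P (mulG (g x) (U x) (U x)) i j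
      = mulG minkowski timelikeForm timelikeForm i j := by
    intro i j
    rw [mulG_tr hP.isUnit_det hP.metric, hP.timelike]
  refine ⟨funext₂ h1, ?_⟩
  funext i j
  rw [← h1, ← tr2_metric hP.metric]
  simp only [tr2, tr1_sub]

/-- Both conditions are tensorial, and in an adapted frame both become `UmbilicalEqs`. -/
lemma umbilical_iff_sigZero (H : UnitaryComponents g V U W s) {x : R4} (hx : x ∈ s) :
    (UmbilicalPlaneAt g (fun y => mulG (g y) (U y) (U y))
        (fun y i j => g y i j - mulG (g y) (U y) (U y) i j) x ∧
      UmbilicalPlaneAt g (fun y i j => g y i j - mulG (g y) (U y) (U y) i j)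
        (fun y => mulG (g y) (U y) (U y)) x) ↔ SigZero g V U W x := by
  obtain ⟨P, hP⟩ := H.exists_frame x hx
  obtain ⟨e, f, b, c, hN, hM⟩ := H.exists_triple hx hP
  obtain ⟨hv, hh⟩ := projectors_frame hP
  rw [H.sigZero_iff hP hN hM]
  have hnv : ∀ k i j, nabla g (fun y => mulG (g y) (U y) (U y)) x k i j
      = mulG (g x) (nabla g U x k) (U x) i j + mulG (g x) (U x) (nabla g U x k) i j :=
    H.nabla_mulG hx H.smooth_U H.smooth_U
  -- By metricity `∇h = -∇v`, so a single array `D` serves both planes.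
  have hnh : nabla g (fun y i j => g y i j - mulG (g y) (U y) (U y) i j) x
      = fun k i j => -nabla g (fun y => mulG (g y) (U y) (U y)) x k i j := by
    funext k i j
    rw [nabla_sub (A := fun y => g y)
      (fun i j => diffAt_of_contDiffOn H.isOpen (H.smooth_g i j) hx)
      (fun i j => diffAt_of_contDiffOn H.isOpen (H.smooth_mulG H.smooth_U H.smooth_U i j) hx),
      nabla_metric H.symm (H.isUnit_det hx), zero_sub]
  have hD : ∀ k i j, tr3 P (nabla g (fun y => mulG (g y) (U y) (U y)) x) k i j
      = mulG minkowski (form (triple 0 e f) (triple 0 b c) k) timelikeForm i j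
        + mulG minkowski timelikeForm (form (triple 0 e f) (triple 0 b c) k) i j := by
    intro k i j
    have : nabla g (fun y => mulG (g y) (U y) (U y)) x = fun k i j =>
        mulG (g x) (nabla g U x k) (U x) i j + mulG (g x) (U x) (nabla g U x k) i j := by
      funext k i j; exact hnv k i j
    rw [this, tr3_add, tr3_mulG_left hP, tr3_mulG_right hP, hN, hP.timelike]
  have hD' : tr3 P (fun k i j => -nabla g (fun y => mulG (g y) (U y) (U y)) x k i j)
      = fun k i j => -tr3 P (nabla g (fun y => mulG (g y) (U y) (U y)) x) k i j := by
    funext k i j; exact tr3_neg _ _ _ _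
  rw [← umbilical_triple_iff e f b c hD, ← hh, ← hv, ← hD']
  have pt : ∀ p q D, tr3 P (projectThree (g x) p q D)
      = projectThree minkowski (tr2 P p) (tr2 P q) (tr3 P D) := by
    intro p q D
    funext i j k
    exact projectThree_tr hP.isUnit_det hP.metric p q D i j k
  rw [← pt, ← pt, ← UmbilicalArr_tr hP.isUnit_det, ← UmbilicalArr_tr hP.isUnit_det, ← hnh]
  rfl

/-- The covariant derivatives of `αU + βW` and of its Hodge dual `αW - βU`, in an adapted frame;
`p` and `q` are the differentials of the logarithm and of the argument of `α + iβ`. -/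
lemma tr3_nabla_rotated (H : UnitaryComponents g V U W s) {x : R4} (hx : x ∈ s)
    {P : Matrix (Fin 4) (Fin 4) ℝ} (hP : AdaptedFrame (g x) (V x) (U x) (W x) P)
    {e f b c : Fin 4 → ℝ} (hN : tr3 P (nabla g U x) = form (triple 0 e f) (triple 0 b c))
    (hM : tr3 P (nabla g W x) = form (triple 0 b c) (-triple 0 e f))
    {α β : R4 → ℝ} (hα : DifferentiableAt ℝ α x) (hβ : DifferentiableAt ℝ β x)
    {p q : Fin 4 → ℝ} (hp : ∀ i, pd i α x = α x * p i - β x * q i)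
    (hq : ∀ i, pd i β x = β x * p i + α x * q i) :
    tr3 P (nabla g (fun y i j => α y * U y i j + β y * W y i j) x)
      = form (α x • triple (-tr1 P p) e f + β x • triple (tr1 P q) b c)
          (α x • triple (tr1 P q) b c - β x • triple (-tr1 P p) e f) := by
  have dU : ∀ i j, DifferentiableAt ℝ (fun y => U y i j) x :=
    fun i j => diffAt_of_contDiffOn H.isOpen (H.smooth_U i j) hx
  have dW : ∀ i j, DifferentiableAt ℝ (fun y => W y i j) x :=
    fun i j => diffAt_of_contDiffOn H.isOpen (H.smooth_W i j) hx
  have h : nabla g (fun y i j => α y * U y i j + β y * W y i j) x = fun k i j =>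
      ((α x * p k - β x * q k) * U x i j + α x * nabla g U x k i j)
        + ((β x * p k + α x * q k) * W x i j + β x * nabla g W x k i j) := by
    funext k i j
    rw [nabla_add (A := fun y i j => α y * U y i j) (B := fun y i j => β y * W y i j)
      (fun i j => hα.mul (dU i j)) (fun i j => hβ.mul (dW i j)), nabla_smul hα dU,
      nabla_smul hβ dW, hp, hq]
  funext k i j
  rw [h]
  simp only [tr3_add, tr3_const_mul, tr3_mul (P := P) (fun k => α x * p k - β x * q k),
    tr3_mul (P := P) (fun k => β x * p k + α x * q k), tr1_add, tr1_sub, tr1_mul, hN, hM,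
    hP.timelike, hP.spacelike]
  fin_cases i <;> fin_cases j <;> simp [form, triple, timelikeForm, spacelikeForm] <;> ring

lemma codiffArr_congr {A B : R4 → Fin 4 → Fin 4 → ℝ} {x : R4} (h : A =ᶠ[𝓝 x] B) :
    codiffArr g V A x = codiffArr g V B x := by
  have : dTwo A x = dTwo B x := by
    funext i j k
    simp only [dTwo]
    have e : ∀ i j, (fun y => A y i j) =ᶠ[𝓝 x] fun y => B y i j := fun i j =>
      h.mono fun y hy => congrFun (congrFun hy i) j
    rw [pd_congr (e j k), pd_congr (e k i), pd_congr (e i j)]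
  rw [codiffArr, codiffArr, this]

/-- The dual `αW - βU` is again a rotated form, with coefficient `i(α + iβ)` in place of `α + iβ`;
its logarithmic derivative is the same `p + iq`. -/
lemma codiffArr_rotated (H : UnitaryComponents g V U W s) {x : R4} (hx : x ∈ s)
    {P : Matrix (Fin 4) (Fin 4) ℝ} (hP : AdaptedFrame (g x) (V x) (U x) (W x) P)
    {e f b c : Fin 4 → ℝ} (hN : tr3 P (nabla g U x) = form (triple 0 e f) (triple 0 b c))
    (hM : tr3 P (nabla g W x) = form (triple 0 b c) (-triple 0 e f))
    {α β : R4 → ℝ} (hα : DifferentiableAt ℝ α x) (hβ : DifferentiableAt ℝ β x)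
    {p q : Fin 4 → ℝ} (hp : ∀ i, pd i α x = α x * p i - β x * q i)
    (hq : ∀ i, pd i β x = β x * p i + α x * q i) {A : R4 → Fin 4 → Fin 4 → ℝ}
    (hA : A =ᶠ[𝓝 x] fun y i j => α y * W y i j - β y * U y i j) :
    tr1 P (codiffArr g V A x)
      = divForm (α x • triple (-tr1 P p) e f + β x • triple (tr1 P q) b c)
          (α x • triple (tr1 P q) b c - β x • triple (-tr1 P p) e f) := by
  have e1 : (fun y i j => α y * W y i j - β y * U y i j)
      = fun y i j => (fun y => -β y) y * U y i j + α y * W y i j := by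
    funext y i j; ring
  rw [codiffArr_congr hA, e1]
  refine H.codiffArr_frame hP (fun y i j => ?_) ?_
  · rw [H.antisymm_U y i j, H.antisymm_W y i j]; ring
  · rw [H.tr3_nabla_rotated hx hP hN hM (α := fun y => -β y) hβ.neg hα (p := p) (q := q)
      (fun i => by rw [pd_neg, hq]; ring) (fun i => by rw [hp]; ring)]
    congr 1 <;> · funext i j; simp; ring

/-- `A'` stands for the Hodge dual of `A`. The equalities near `x` suffice because only first
derivatives at `x` enter. -/
theorem cky_iff (H : UnitaryComponents g V U W s) {x : R4} (hx : x ∈ s)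
    {α β : R4 → ℝ} (hα : DifferentiableAt ℝ α x) (hβ : DifferentiableAt ℝ β x)
    (hρ : α x ^ 2 + β x ^ 2 ≠ 0)
    {p q : Fin 4 → ℝ} (hp : ∀ i, pd i α x = α x * p i - β x * q i)
    (hq : ∀ i, pd i β x = β x * p i + α x * q i) {A A' : R4 → Fin 4 → Fin 4 → ℝ}
    (hA : A =ᶠ[𝓝 x] fun y i j => α y * U y i j + β y * W y i j)
    (hA' : A' =ᶠ[𝓝 x] fun y i j => α y * W y i j - β y * U y i j) :
    (∀ i j k, ckyArr (g x) (nabla g A x) (codiffArr g V A' x) i j k = 0) ↔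
      SigZero g V U W x ∧
      (∀ i, -2 * p i = phiArr (g x) (U x) (W x) (codiffArr g V W x)
        (codiffArr g V (fun y i j => -U y i j) x) i) ∧
      ∀ i, -2 * q i = psiArr (g x) (U x) (W x) (codiffArr g V W x)
        (codiffArr g V (fun y i j => -U y i j) x) i := by
  obtain ⟨P, hP⟩ := H.exists_frame x hx
  obtain ⟨e, f, b, c, hN, hM⟩ := H.exists_triple hx hP
  have hnA : nabla g A x = nabla g (fun y i j => α y * U y i j + β y * W y i j) x := by
    funext k i j; exact nabla_congr hA k i j
  rw [tr3_eq_zero_iff hP.isUnit_det]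
  simp only [ckyArr_tr hP.metric]
  rw [hnA, H.tr3_nabla_rotated hx hP hN hM hα hβ hp hq,
    H.codiffArr_rotated hx hP hN hM hα hβ hp hq hA', cky_rotated_iff hρ, cky_triple_iff,
    H.sigZero_iff hP hN hM]
  have key : ∀ (r : ℝ) (u v : Fin 4 → ℝ), (∀ i, r * u i = v i)
      ↔ ∀ i, r * tr1 P u i = tr1 P v i := by
    intro r u v
    have := tr1_eq_zero_iff hP.isUnit_det (fun i => r * u i - v i)
    simpa only [tr1_sub, tr1_mul, sub_eq_zero] using this
  rw [key (-2) p, key (-2) q]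
  simp only [phiArr_tr hP.isUnit_det hP.metric, psiArr_tr hP.isUnit_det hP.metric,
    hP.timelike, hP.spacelike, H.codiffArr_U_frame hP hM, H.codiffArr_W_frame hP hN]

theorem maxwell_iff (H : UnitaryComponents g V U W s) {x : R4} (hx : x ∈ s)
    {α β : R4 → ℝ} (hα : DifferentiableAt ℝ α x) (hβ : DifferentiableAt ℝ β x)
    (hρ : α x ^ 2 + β x ^ 2 ≠ 0)
    {p q : Fin 4 → ℝ} (hp : ∀ i, pd i α x = α x * p i - β x * q i)
    (hq : ∀ i, pd i β x = β x * p i + α x * q i) {A' A'' : R4 → Fin 4 → Fin 4 → ℝ}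
    (hA' : A' =ᶠ[𝓝 x] fun y i j => α y * W y i j - β y * U y i j)
    (hA'' : A'' =ᶠ[𝓝 x] fun y i j => -(α y * U y i j + β y * W y i j)) :
    (∀ i, codiffArr g V A' x i = 0 ∧ codiffArr g V A'' x i = 0) ↔
      (∀ i, p i = phiArr (g x) (U x) (W x) (codiffArr g V W x)
        (codiffArr g V (fun y i j => -U y i j) x) i) ∧
      ∀ i, q i = psiArr (g x) (U x) (W x) (codiffArr g V W x)
        (codiffArr g V (fun y i j => -U y i j) x) i := by
  obtain ⟨P, hP⟩ := H.exists_frame x hx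
  obtain ⟨e, f, b, c, hN, hM⟩ := H.exists_triple hx hP
  -- `A''` is the second dual of `A`, so `α + iβ` is again multiplied by `i`.
  have h2 : tr1 P (codiffArr g V A'' x)
      = divForm (α x • triple (tr1 P q) b c - β x • triple (-tr1 P p) e f)
          (-(α x • triple (-tr1 P p) e f + β x • triple (tr1 P q) b c)) := by
    rw [H.codiffArr_rotated hx hP hN hM (α := fun y => -β y) (β := α) hβ.neg hα (p := p) (q := q)
      (fun i => by rw [pd_neg, hq]; ring) (fun i => by rw [hp]; ring)
      (hA''.trans (Eventually.of_forall fun y => by funext i j; ring))]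
    congr 1 <;> · funext i j; simp; ring
  have key : ∀ (u v : Fin 4 → ℝ), (∀ i, u i = v i) ↔ ∀ i, tr1 P u i = tr1 P v i := by
    intro u v
    have := tr1_eq_zero_iff hP.isUnit_det (fun i => u i - v i)
    simpa only [tr1_sub, sub_eq_zero] using this
  rw [forall_and, tr1_eq_zero_iff hP.isUnit_det (codiffArr g V A' x),
    tr1_eq_zero_iff hP.isUnit_det (codiffArr g V A'' x), h2,
    H.codiffArr_rotated hx hP hN hM hα hβ hp hq hA', maxwell_rotated_iff hρ,
    maxwell_triple_iff, key p, key q]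
  simp only [phiArr_tr hP.isUnit_det hP.metric, psiArr_tr hP.isUnit_det hP.metric,
    hP.timelike, hP.spacelike, H.codiffArr_U_frame hP hM, H.codiffArr_W_frame hP hN]

end UnitaryComponents

end

section

/-! ### Multilinear algebra on a tangent space -/

variable {E : Type*} [AddCommGroup E] [Module ℝ E]

lemma alternating_vecCons_sum {n : ℕ} (A : E [⋀^Fin (n + 1)]→ₗ[ℝ] ℝ) (r : Fin 4 → ℝ)
    (v : Fin 4 → E) (w : Fin n → E) :
    A (Matrix.vecCons (∑ i, r i • v i) w) = ∑ i, r i * A (Matrix.vecCons (v i) w) := by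
  let L : E →ₗ[ℝ] ℝ :=
    { toFun := fun x => A (Matrix.vecCons x w)
      map_add' := fun x y => A.map_vecCons_add w x y
      map_smul' := fun c x => A.map_vecCons_smul w c x }
  have h : L (∑ i, r i • v i) = ∑ i, r i * L (v i) := by
    rw [map_sum]; simp
  exact h

variable {P : Matrix (Fin 4) (Fin 4) ℝ} {v c : Fin 4 → E}

lemma alternating_two_tr (A : E [⋀^Fin 2]→ₗ[ℝ] ℝ) (hc : ∀ a, c a = ∑ i, P i a • v i)
    (i j : Fin 4) : A ![c i, c j] = tr2 P (fun a b => A ![v a, v b]) i j := by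
  rw [hc i, alternating_vecCons_sum, tr2, tr1]
  refine Finset.sum_congr rfl fun a _ => ?_
  congr 1
  rw [← AlternatingMap.curryLeft_apply_apply, hc j]
  exact alternating_vecCons_sum (A.curryLeft (v a)) _ v ![]

lemma alternating_four_tr (A : E [⋀^Fin 4]→ₗ[ℝ] ℝ) (hc : ∀ a, c a = ∑ i, P i a • v i)
    (i j k l : Fin 4) :
    A ![c i, c j, c k, c l] = tr4 P (fun a b d e => A ![v a, v b, v d, v e]) i j k l := by
  rw [hc i, alternating_vecCons_sum, tr4, tr1]
  refine Finset.sum_congr rfl fun a _ => ?_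
  congr 1
  rw [← AlternatingMap.curryLeft_apply_apply, hc j, alternating_vecCons_sum, tr3, tr1]
  refine Finset.sum_congr rfl fun b _ => ?_
  congr 1
  rw [← AlternatingMap.curryLeft_apply_apply, alternating_two_tr _ hc]
  rfl

/-- The last two arguments are kept fixed. -/
lemma alternating_four_tr_left (A : E [⋀^Fin 4]→ₗ[ℝ] ℝ) (hc : ∀ a, c a = ∑ i, P i a • v i)
    (x y : E) (i j : Fin 4) :
    A ![c i, c j, x, y] = tr2 P (fun a b => A ![v a, v b, x, y]) i j := by
  rw [hc i, alternating_vecCons_sum, tr2, tr1]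
  refine Finset.sum_congr rfl fun a _ => ?_
  congr 1
  rw [← AlternatingMap.curryLeft_apply_apply, hc j]
  exact alternating_vecCons_sum (A.curryLeft (v a)) _ v ![x, y]

lemma bilin_tr (β : LinearMap.BilinForm ℝ E) (hc : ∀ a, c a = ∑ i, P i a • v i) (i j : Fin 4) :
    β (c i) (c j) = tr2 P (fun a b => β (v a) (v b)) i j := by
  simp only [hc, map_sum, map_smul, LinearMap.sum_apply, LinearMap.smul_apply, tr2, tr1,
    smul_eq_mul, Finset.mul_sum]
  rw [Finset.sum_comm]
  exact Finset.sum_congr rfl fun a _ => Finset.sum_congr rfl fun b _ => by ring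

lemma bilin_tr_matrix (β : LinearMap.BilinForm ℝ E) (hc : ∀ a, c a = ∑ i, P i a • v i) :
    P.transpose * Matrix.of (fun i j => β (v i) (v j)) * P
      = Matrix.of fun i j => β (c i) (c j) := by
  rw [← tr2_eq_mul]
  ext i j
  exact (bilin_tr β hc i j).symm

/-- The total contraction of two covariant 2-tensors. -/
def ctrTwo (G : Matrix (Fin 4) (Fin 4) ℝ) (A F : Fin 4 → Fin 4 → ℝ) : ℝ :=
  ctr G fun k a => ctr G fun l b => A a b * F k l

lemma ctrTwo_tr (hP : IsUnit P.det) {G G' : Matrix (Fin 4) (Fin 4) ℝ}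
    (hG : P.transpose * G * P = G') (A F : Fin 4 → Fin 4 → ℝ) :
    ctrTwo G A F = ctrTwo G' (tr2 P A) (tr2 P F) := by
  rw [ctrTwo, ctr_tr hP hG, ctrTwo]
  refine ctr_congr _ fun k a => ?_
  simp only [tr2, tr1_ctr]
  rw [ctr_tr hP hG]
  refine ctr_congr _ fun l b => ?_
  simp only [tr2, tr1_mul, tr1_mul_right]
  congr 1
  · exact tr1_comm P P (fun b a => A a b) b a
  · exact tr1_comm P P (fun l k => F k l) l k

lemma ctrTwo_eq_sum (G : Matrix (Fin 4) (Fin 4) ℝ) (A F : Fin 4 → Fin 4 → ℝ) :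
    ctrTwo G A F = ∑ k, ∑ l, (∑ a, ∑ b, G⁻¹ k a * G⁻¹ l b * A a b) * F k l := by
  simp only [ctrTwo, ctr, Finset.mul_sum, Finset.sum_mul]
  refine Finset.sum_congr rfl fun k _ => ?_
  rw [Finset.sum_comm]
  refine Finset.sum_congr rfl fun l _ => Finset.sum_congr rfl fun a _ =>
    Finset.sum_congr rfl fun b _ => ?_
  ring

/-- `b` is orthonormal for `β`, the first vector being time-like. -/
def OrthonormalFrame (β : LinearMap.BilinForm ℝ E) (b : Fin 4 → E) : Prop :=
  ∀ i j, β (b i) (b j) = minkowski i j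

lemma OrthonormalFrame.linearIndependent {β : LinearMap.BilinForm ℝ E} {b : Fin 4 → E}
    (hb : OrthonormalFrame β b) : LinearIndependent ℝ b := by
  rw [Fintype.linearIndependent_iff]
  intro r hr i
  have h : β (b i) (∑ j, r j • b j) = 0 := by rw [hr, map_zero]
  simp only [map_sum, map_smul, hb i, smul_eq_mul] at h
  fin_cases i <;> simpa [minkowski, Fin.sum_univ_four, Matrix.diagonal_apply] using h

/-- By Cauchy-Schwarz on the space parts, `Y₀²X₀² ≤ (Y₀² - 1)|X|²`. If `x` were not space-like, then
`|X|² ≤ X₀²`, which forces `|X| = 0` and hence `X₀ = 0`. -/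
lemma pos_of_orthogonal_timelike {β : LinearMap.BilinForm ℝ E}
    {b : Module.Basis (Fin 4) ℝ E} (hb : OrthonormalFrame β b) {u x : E} (hu : β u u = -1)
    (hx : β u x = 0) (hx0 : x ≠ 0) : 0 < β x x := by
  have e : ∀ x y : E, β x y = -(b.repr x 0 * b.repr y 0) + b.repr x 1 * b.repr y 1
      + b.repr x 2 * b.repr y 2 + b.repr x 3 * b.repr y 3 := by
    intro x y
    have hb' : ∀ i j, β (b i) (b j) = minkowski i j := hb
    conv_lhs => rw [← b.sum_repr x, ← b.sum_repr y]
    simp only [map_sum, map_smul, LinearMap.sum_apply, LinearMap.smul_apply, smul_eq_mul,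
      hb']
    simp [Fin.sum_univ_four, minkowski, Matrix.diagonal_apply]
    ring
  rw [e] at hu hx ⊢
  have hne : b.repr x ≠ 0 := by simpa using hx0
  generalize b.repr x = X at *
  generalize b.repr u = Y at *
  by_contra hcon
  push Not at hcon
  have hle : Y 0 * Y 0 * (X 1 * X 1 + X 2 * X 2 + X 3 * X 3) ≤ Y 0 * Y 0 * (X 0 * X 0) :=
    mul_le_mul_of_nonneg_left (by linarith) (mul_self_nonneg _)
  have hsq : Y 0 * Y 0 * (X 0 * X 0) = (Y 1 * X 1 + Y 2 * X 2 + Y 3 * X 3) ^ 2 := by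
    rw [← show Y 0 * X 0 = Y 1 * X 1 + Y 2 * X 2 + Y 3 * X 3 by linarith]; ring
  have hcs : (Y 1 * X 1 + Y 2 * X 2 + Y 3 * X 3) ^ 2
      ≤ (Y 0 * Y 0 - 1) * (X 1 * X 1 + X 2 * X 2 + X 3 * X 3) := by
    rw [show Y 0 * Y 0 - 1 = Y 1 * Y 1 + Y 2 * Y 2 + Y 3 * Y 3 by linarith]
    linarith [sq_nonneg (Y 1 * X 2 - Y 2 * X 1), sq_nonneg (Y 1 * X 3 - Y 3 * X 1),
      sq_nonneg (Y 2 * X 3 - Y 3 * X 2)]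
  have hs : X 1 * X 1 + X 2 * X 2 + X 3 * X 3 ≤ 0 := by linarith
  have h1 : X 1 = 0 := by
    have := mul_self_nonneg (X 2); have := mul_self_nonneg (X 3)
    exact mul_self_eq_zero.1 (le_antisymm (by linarith) (mul_self_nonneg (X 1)))
  have h2 : X 2 = 0 := by
    have := mul_self_nonneg (X 1); have := mul_self_nonneg (X 3)
    exact mul_self_eq_zero.1 (le_antisymm (by linarith) (mul_self_nonneg (X 2)))
  have h3 : X 3 = 0 := by
    have := mul_self_nonneg (X 1); have := mul_self_nonneg (X 2)
    exact mul_self_eq_zero.1 (le_antisymm (by linarith) (mul_self_nonneg (X 3)))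
  rw [h1, h2, h3] at hx
  have h0 : X 0 = 0 := by
    have hY : Y 0 ≠ 0 := by
      intro h
      rw [h] at hu
      linarith [mul_self_nonneg (Y 1), mul_self_nonneg (Y 2), mul_self_nonneg (Y 3)]
    have : Y 0 * X 0 = 0 := by linarith
    simpa [hY] using this
  apply hne
  ext i
  fin_cases i <;> simp [h0, h1, h2, h3]

/-- Fewer than four linear conditions on a four-dimensional space have a nonzero common solution. It
is space-like because `u` is among the `w j`, so it can be normalised. -/
lemma exists_unit_orthogonal {β : LinearMap.BilinForm ℝ E} {b : Module.Basis (Fin 4) ℝ E}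
    (hb : OrthonormalFrame β b) {u : E} (hu : β u u = -1) {n : ℕ} (hn : n < 4)
    (w : Fin n → E) (i : Fin n) (hi : w i = u) : ∃ x, β x x = 1 ∧ ∀ j, β (w j) x = 0 := by
  have : FiniteDimensional ℝ E := b.finiteDimensional_of_finite
  let L : E →ₗ[ℝ] (Fin n → ℝ) := LinearMap.pi fun j => β (w j)
  have hlt : Module.finrank ℝ (Fin n → ℝ) < Module.finrank ℝ E := by
    rw [Module.finrank_eq_card_basis b]; simpa using hn
  obtain ⟨x, hx, hx0⟩ := (Submodule.ne_bot_iff _).1 (LinearMap.ker_ne_bot_of_finrank_lt (f := L) hlt)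
  have hxj : ∀ j, β (w j) x = 0 := fun j => congrFun (LinearMap.mem_ker.1 hx) j
  have hpos := pos_of_orthogonal_timelike hb hu (by rw [← hi]; exact hxj i) hx0
  refine ⟨(Real.sqrt (β x x))⁻¹ • x, ?_, fun j => by simp [hxj j]⟩
  have hs : Real.sqrt (β x x) ≠ 0 := (Real.sqrt_pos.2 hpos).ne'
  simp only [map_smul, LinearMap.smul_apply, smul_eq_mul]
  field_simp
  rw [Real.sq_sqrt hpos.le]

lemma exists_orthonormalFrame {β : LinearMap.BilinForm ℝ E} (hβ : ∀ x y, β x y = β y x)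
    {b : Module.Basis (Fin 4) ℝ E} (hb : OrthonormalFrame β b) {u w : E} (hu : β u u = -1)
    (hw : β w w = 1) (huw : β u w = 0) :
    ∃ y z : E, OrthonormalFrame β ![u, w, y, z] := by
  obtain ⟨y, hy, hyw⟩ := exists_unit_orthogonal hb hu (by norm_num) ![u, w] 0 rfl
  obtain ⟨z, hz, hzw⟩ := exists_unit_orthogonal hb hu (by norm_num) ![u, w, y] 0 rfl
  have h1 : β u y = 0 := hyw 0
  have h2 : β w y = 0 := hyw 1
  have h3 : β u z = 0 := hzw 0
  have h4 : β w z = 0 := hzw 1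
  have h5 : β y z = 0 := hzw 2
  refine ⟨y, z, fun i j => ?_⟩
  fin_cases i <;> fin_cases j <;>
    simp [minkowski, hu, hw, hy, hz, huw, h1, h2, h3, h4, h5, hβ w u, hβ y u, hβ y w, hβ z u,
      hβ z w, hβ z y]

end

section

/-! ### Pointwise algebra of 2-forms on a spacetime -/

namespace OrientedSpacetime

variable {M : Type*} [TopologicalSpace M] [ChartedSpace R4 M] (S : OrientedSpacetime M)

/-- The Gram matrix of four tangent vectors. -/
def gram (p : M) (c : Fin 4 → TangentSpace (𝓡 4) p) : Matrix (Fin 4) (Fin 4) ℝ :=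
  Matrix.of fun i j => S.metric p (c i) (c j)

/-- This makes the contractions defined through `stdBasis` computable in any frame with invertible
Gram matrix. -/
lemma exists_coordinates (p : M) (c : Fin 4 → TangentSpace (𝓡 4) p)
    (hc : IsUnit (S.gram p c).det) : ∃ P : Matrix (Fin 4) (Fin 4) ℝ, IsUnit P.det ∧
      (∀ a, c a = ∑ i, P i a • stdBasis p i) ∧
      P.transpose * S.gram p (stdBasis p) * P = S.gram p c := by
  have h : ∀ a, c a = ∑ i, (Matrix.of fun i a => (stdBasis p).repr (c a) i) i a • stdBasis p i :=
    fun a => ((stdBasis p).sum_repr (c a)).symm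
  have hG := bilin_tr_matrix (S.metric p) h
  refine ⟨_, ?_, h, hG⟩
  have hd := congrArg Matrix.det hG
  rw [Matrix.det_mul] at hd
  have hc' : IsUnit (Matrix.of fun i j => S.metric p (c i) (c j)).det := hc
  rw [← hd] at hc'
  exact isUnit_of_mul_isUnit_right hc'

lemma star_apply (A : TwoForm M) (p : M) (c : Fin 4 → TangentSpace (𝓡 4) p)
    (hc : IsUnit (S.gram p c).det) (x y : TangentSpace (𝓡 4) p) :
    S.star A p ![x, y] = 1 / 2 * ctrTwo (S.gram p c) (fun i j => A p ![c i, c j])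
      (fun k l => S.vol p ![c k, c l, x, y]) := by
  obtain ⟨P, hP, h, hG⟩ := S.exists_coordinates p c hc
  have e1 : (fun i j => A p ![c i, c j]) = tr2 P (fun i j => A p ![stdBasis p i, stdBasis p j]) := by
    funext i j; exact alternating_two_tr (A p) h i j
  have e2 : (fun k l => S.vol p ![c k, c l, x, y])
      = tr2 P (fun k l => S.vol p ![stdBasis p k, stdBasis p l, x, y]) := by
    funext i j; exact alternating_four_tr_left (S.vol p) h x y i j
  rw [e1, e2, ← ctrTwo_tr hP hG, ctrTwo_eq_sum]
  simp only [star, raise, gram, AlternatingMap.smul_apply, smul_eq_mul]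
  rfl

lemma contract_apply (A B : TwoForm M) (p : M) (c : Fin 4 → TangentSpace (𝓡 4) p)
    (hc : IsUnit (S.gram p c).det) :
    S.contract A B p = ctrTwo (S.gram p c) (fun i j => A p ![c i, c j])
      (fun k l => B p ![c k, c l]) := by
  obtain ⟨P, hP, h, hG⟩ := S.exists_coordinates p c hc
  have e : ∀ A : TwoForm M, (fun i j => A p ![c i, c j])
      = tr2 P (fun i j => A p ![stdBasis p i, stdBasis p j]) := by
    intro A; funext i j; exact alternating_two_tr (A p) h i j
  rw [e, e, ← ctrTwo_tr hP hG, ctrTwo_eq_sum]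
  rfl

/-- An oriented orthonormal frame adapted to the 2+2 structure of `U`. -/
structure IsAdapted (U : TwoForm M) (p : M) (b : Fin 4 → TangentSpace (𝓡 4) p) : Prop where
  orthonormal : OrthonormalFrame (S.metric p) b
  vol : S.vol p b = 1
  timelike : ∀ i j, U p ![b i, b j] = timelikeForm i j
  spacelike : ∀ i j, S.star U p ![b i, b j] = spacelikeForm i j

variable {S}

lemma gram_of_orthonormal {p : M} {b : Fin 4 → TangentSpace (𝓡 4) p}
    (hb : OrthonormalFrame (S.metric p) b) : S.gram p b = minkowski := by
  ext i j; exact hb i j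

lemma isUnit_gram_of_orthonormal {p : M} {b : Fin 4 → TangentSpace (𝓡 4) p}
    (hb : OrthonormalFrame (S.metric p) b) : IsUnit (S.gram p b).det := by
  rw [gram_of_orthonormal hb]
  simp [minkowski, Fin.prod_univ_four]

lemma ext_of_orthonormal {p : M} {b : Fin 4 → TangentSpace (𝓡 4) p}
    (hb : OrthonormalFrame (S.metric p) b) {A B : TangentSpace (𝓡 4) p [⋀^Fin 2]→ₗ[ℝ] ℝ}
    (h : ∀ i j, A ![b i, b j] = B ![b i, b j]) : A = B := by
  have hcard : Fintype.card (Fin 4) = Module.finrank ℝ (TangentSpace (𝓡 4) p) :=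
    (Module.finrank_eq_card_basis (stdBasis p)).symm
  refine (basisOfLinearIndependentOfCardEqFinrank hb.linearIndependent hcard).ext_alternating
    fun v _ => ?_
  have e : (fun i => basisOfLinearIndependentOfCardEqFinrank hb.linearIndependent hcard (v i))
      = ![b (v 0), b (v 1)] := by
    funext i
    rw [coe_basisOfLinearIndependentOfCardEqFinrank]
    fin_cases i <;> rfl
  rw [e]
  exact h _ _

lemma star_of_orthonormal {p : M} {b : Fin 4 → TangentSpace (𝓡 4) p}
    (hb : OrthonormalFrame (S.metric p) b) (hv : S.vol p b = 1) (A : TwoForm M) (i j : Fin 4) :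
    S.star A p ![b i, b j]
      = 1 / 2 * ctrTwo minkowski (fun i j => A p ![b i, b j]) (fun k l => levi k l i j) := by
  rw [S.star_apply A p b (isUnit_gram_of_orthonormal hb), gram_of_orthonormal hb]
  simp only [levi_eq_of_alternating, hv, one_mul]

/-- The vectors `u, w` supplied by unitarity are completed by an orthonormal basis of `H`, whose
order is chosen to match the orientation. -/
lemma exists_isAdapted {U : TwoForm M} (hU : S.IsUnitary U) (p : M) :
    ∃ b, S.IsAdapted U p b := by
  obtain ⟨u, w, hu, hw, huw, hUp⟩ := hU.2 p
  obtain ⟨b₀, hb₀⟩ := S.metric_lorentzian p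
  obtain ⟨y, z, hyz⟩ := exists_orthonormalFrame (S.metric_symm p) hb₀ hu hw huw
  have key : ∀ y z, OrthonormalFrame (S.metric p) ![u, w, y, z] → S.vol p ![u, w, y, z] = 1 →
      S.IsAdapted U p ![u, w, y, z] := by
    intro y z ho hv
    have ht : ∀ i j, U p ![![u, w, y, z] i, ![u, w, y, z] j] = timelikeForm i j := by
      intro i j
      have h0 := fun i => ho 0 i
      have h1 := fun i => ho 1 i
      simp only [Matrix.cons_val_zero, Matrix.cons_val_one] at h0 h1
      rw [hUp, h0, h1, h0, h1]
      fin_cases i <;> fin_cases j <;> simp [minkowski, timelikeForm]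
    refine ⟨ho, hv, ht, fun i j => ?_⟩
    rw [star_of_orthonormal ho hv]
    simp only [ht, ctrTwo, ctr_minkowski]
    fin_cases i <;> fin_cases j <;> simp [timelikeForm, spacelikeForm, levi] <;> norm_num
  rcases S.vol_orthonormal p _ hyz with h | h
  · exact ⟨_, key y z hyz h⟩
  -- Wrong orientation: exchanging the two vectors of `H` flips the sign of the volume and leaves
  -- `U` alone.
  · refine ⟨_, key z y (fun i j => ?_) ?_⟩
    · have := hyz (Equiv.swap 2 3 i) (Equiv.swap 2 3 j)
      have e : ∀ i, ![u, w, y, z] (Equiv.swap 2 3 i) = ![u, w, z, y] i := by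
        intro i; fin_cases i <;> rfl
      rw [e, e] at this
      rw [this]
      have s0 : Equiv.swap (2 : Fin 4) 3 0 = 0 := by decide
      have s1 : Equiv.swap (2 : Fin 4) 3 1 = 1 := by decide
      fin_cases i <;> fin_cases j <;> simp [minkowski, s0, s1]
    · have e : ![u, w, z, y] = ![u, w, y, z] ∘ Equiv.swap 2 3 := by
        funext i; fin_cases i <;> rfl
      rw [e, AlternatingMap.map_swap _ _ (by decide), h, neg_neg]

lemma star_star {U : TwoForm M} (hU : S.IsUnitary U) : S.star (S.star U) = fun p => -U p := by
  funext p
  obtain ⟨b, hb⟩ := exists_isAdapted hU p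
  refine ext_of_orthonormal hb.orthonormal fun i j => ?_
  rw [star_of_orthonormal hb.orthonormal hb.vol, AlternatingMap.neg_apply, hb.timelike]
  simp only [hb.spacelike, ctrTwo, ctr_minkowski]
  fin_cases i <;> fin_cases j <;> simp [timelikeForm, spacelikeForm, levi] <;> norm_num

lemma star_combination (A B C : TwoForm M) (p : M) (a b : ℝ) (h : C p = a • A p + b • B p) :
    S.star C p = a • S.star A p + b • S.star B p := by
  obtain ⟨b₀, hb₀⟩ := S.metric_lorentzian p
  have ho : OrthonormalFrame (S.metric p) b₀ := hb₀
  refine ext_of_orthonormal ho fun i j => ?_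
  rw [AlternatingMap.add_apply, AlternatingMap.smul_apply, AlternatingMap.smul_apply]
  simp only [S.star_apply _ p b₀ (isUnit_gram_of_orthonormal ho), h,
    AlternatingMap.add_apply, AlternatingMap.smul_apply, smul_eq_mul, ctrTwo, gram_of_orthonormal ho,
    ctr_minkowski]
  ring

lemma contract_frame {U : TwoForm M} {p : M} {b : Fin 4 → TangentSpace (𝓡 4) p}
    (hb : S.IsAdapted U p b) (A B : TwoForm M) :
    S.contract A B p = ctrTwo minkowski (fun i j => A p ![b i, b j])
      (fun k l => B p ![b k, b l]) := by
  rw [S.contract_apply A B p b (isUnit_gram_of_orthonormal hb.orthonormal),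
    gram_of_orthonormal hb.orthonormal]

/-- From `U·U = -2`, `*U·*U = 2` and `U·*U = 0`. The first two values recover the coefficients from
`A`; the last two decide regularity. -/
lemma contract_rotated {U : TwoForm M} (hU : S.IsUnitary U) {A : TwoForm M} {p : M} {a b : ℝ}
    (h : A p = a • U p + b • S.star U p) :
    S.contract A U p = -2 * a ∧ S.contract A (S.star U) p = 2 * b ∧
      S.contract A A p = -2 * (a ^ 2 - b ^ 2) ∧ S.contract A (S.star A) p = 4 * a * b := by
  obtain ⟨c, hc⟩ := exists_isAdapted hU p
  have h' := star_combination (S := S) U (S.star U) A p a b h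
  rw [star_star hU] at h'
  simp only [contract_frame hc, h, h', AlternatingMap.add_apply, AlternatingMap.smul_apply,
    AlternatingMap.neg_apply, hc.timelike, hc.spacelike, smul_eq_mul, ctrTwo, ctr_minkowski]
  refine ⟨?_, ?_, ?_, ?_⟩ <;> simp [timelikeForm, spacelikeForm] <;> ring

/-- The two invariants are, up to nonzero factors, the real and imaginary parts of `(a + ib)²`. -/
lemma regularAt_of_rotated {U : TwoForm M} (hU : S.IsUnitary U) {A : TwoForm M} {p : M} {a b : ℝ}
    (h : A p = a • U p + b • S.star U p) (hab : a ^ 2 + b ^ 2 ≠ 0) : S.RegularAt A p := by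
  obtain ⟨-, -, h1, h2⟩ := contract_rotated hU h
  rw [RegularAt, h1, h2]
  by_contra hcon
  push Not at hcon
  obtain ⟨h3, h4⟩ := hcon
  apply hab
  have h5 : (a ^ 2 + b ^ 2) ^ 2 = 0 := by
    rw [show (a ^ 2 + b ^ 2) ^ 2 = (a ^ 2 - b ^ 2) ^ 2 + (2 * a * b) ^ 2 by ring,
      show a ^ 2 - b ^ 2 = 0 by linarith, show 2 * a * b = 0 by linarith]
    ring
  exact pow_eq_zero_iff (two_ne_zero) |>.1 h5

end OrientedSpacetime

end

section

/-! ### Components in a chart -/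

variable {M : Type*} [TopologicalSpace M] [ChartedSpace R4 M]

lemma twoComp_antisymm (e : OpenPartialHomeomorph M R4) (A : TwoForm M) (y : R4) (i j : Fin 4) :
    twoComp e A y i j = -twoComp e A y j i := by
  have h := (A (e.symm y)).map_swap (v := ![coordVec e y j, coordVec e y i])
    (show (0 : Fin 2) ≠ 1 by decide)
  have e1 : ![coordVec e y j, coordVec e y i] ∘ Equiv.swap (0 : Fin 2) 1
      = ![coordVec e y i, coordVec e y j] := by
    funext k; fin_cases k <;> rfl
  rw [e1] at h
  exact h

lemma mdifferentiable_of_mem_charts {e : OpenPartialHomeomorph M R4} (he : e ∈ charts M) :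
    e.MDifferentiable (𝓡 4) (𝓡 4) :=
  ⟨(contMDiffOn_of_mem_maximalAtlas he).mdifferentiableOn (by simp),
    (contMDiffOn_symm_of_mem_maximalAtlas he).mdifferentiableOn (by simp)⟩

variable [IsManifold (𝓡 4) ∞ M]

/-- The components in the chart `e` of a tangent vector. -/
def vecComp (e : OpenPartialHomeomorph M R4) (x : R4) (v : TangentSpace (𝓡 4) (e.symm x)) : R4 :=
  mfderiv (𝓡 4) (𝓡 4) e (e.symm x) v

/-- The derivatives of a chart and of its inverse are mutually inverse. -/
lemma sum_coordVec {e : OpenPartialHomeomorph M R4} (he : e ∈ charts M) {x : R4}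
    (hx : x ∈ e.target) (v : TangentSpace (𝓡 4) (e.symm x)) :
    v = ∑ i, vecComp e x v i • coordVec e x i := by
  have hd := mdifferentiable_of_mem_charts he
  let D : R4 →L[ℝ] R4 := mfderiv (𝓡 4) (𝓡 4) e (e.symm x)
  let D' : R4 → (R4 →L[ℝ] R4) := fun x' => mfderiv (𝓡 4) (𝓡 4) e.symm x'
  have h1 : (D' (e (e.symm x))).comp D = ContinuousLinearMap.id ℝ R4 :=
    hd.symm_comp_deriv (e.map_target hx)
  rw [e.right_inv hx] at h1
  have h2 : D' x (D v) = v := congrArg (fun L : R4 →L[ℝ] R4 => L v) h1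
  have h3 : D v = ∑ i, D v i • (EuclideanSpace.single i (1 : ℝ) : R4) := by
    have := (EuclideanSpace.basisFun (Fin 4) ℝ).sum_repr (D v)
    simpa using this.symm
  have h4 : D' x (D v) = ∑ i, D v i • D' x (EuclideanSpace.single i (1 : ℝ) : R4) := by
    conv_lhs => rw [h3]
    rw [map_sum]
    exact Finset.sum_congr rfl fun i _ => map_smul _ _ _
  exact h2.symm.trans h4

namespace OrientedSpacetime

variable {S : OrientedSpacetime M} {U : TwoForm M}

lemma exists_adaptedFrame (hU : S.IsUnitary U) {e : OpenPartialHomeomorph M R4}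
    (he : e ∈ charts M) {x : R4} (hx : x ∈ e.target) :
    ∃ P, AdaptedFrame (S.g e x) (S.eta e x) (twoComp e U x) (twoComp e (S.star U) x) P := by
  obtain ⟨b, hb⟩ := exists_isAdapted hU (e.symm x)
  have h : ∀ a, b a = ∑ i, (Matrix.of fun i a => vecComp e x (b a) i) i a • coordVec e x i :=
    fun a => sum_coordVec he hx (b a)
  have hG := bilin_tr_matrix (S.metric (e.symm x)) h
  have hgram : (Matrix.of fun i j => S.metric (e.symm x) (b i) (b j)) = minkowski :=
    gram_of_orthonormal hb.orthonormal
  rw [hgram] at hG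
  refine ⟨_, ?_, hG, ?_, ?_, ?_⟩
  · have hd := congrArg Matrix.det hG
    rw [Matrix.det_mul] at hd
    have hm : IsUnit minkowski.det := by simp [minkowski, Fin.prod_univ_four]
    rw [← hd] at hm
    exact isUnit_of_mul_isUnit_right hm
  · funext i j k l
    rw [← one_mul (levi i j k l), ← hb.vol, ← levi_eq_of_alternating]
    exact (alternating_four_tr _ h i j k l).symm
  · funext i j
    rw [← hb.timelike]
    exact (alternating_two_tr _ h i j).symm
  · funext i j
    rw [← hb.spacelike]
    exact (alternating_two_tr _ h i j).symm

lemma isUnit_det_g (hU : S.IsUnitary U) {e : OpenPartialHomeomorph M R4}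
    (he : e ∈ charts M) {x : R4} (hx : x ∈ e.target) : IsUnit (S.g e x).det := by
  obtain ⟨P, hP⟩ := exists_adaptedFrame hU he hx
  exact hP.isUnit_det_metric

lemma twoComp_star (hU : S.IsUnitary U) {e : OpenPartialHomeomorph M R4}
    (he : e ∈ charts M) {x : R4} (hx : x ∈ e.target) (A : TwoForm M) (i j : Fin 4) :
    twoComp e (S.star A) x i j
      = 1 / 2 * ctrTwo (S.g e x) (twoComp e A x) (fun k l => S.eta e x k l i j) :=
  S.star_apply A (e.symm x) (coordVec e x) (isUnit_det_g hU he hx) _ _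

lemma contract_chart (hU : S.IsUnitary U) {e : OpenPartialHomeomorph M R4}
    (he : e ∈ charts M) {x : R4} (hx : x ∈ e.target) (A B : TwoForm M) :
    S.contract A B (e.symm x) = ctrTwo (S.g e x) (twoComp e A x) (twoComp e B x) :=
  S.contract_apply A B (e.symm x) (coordVec e x) (isUnit_det_g hU he hx)

lemma contDiffOn_ctrTwo {s : Set R4} {g : R4 → Matrix (Fin 4) (Fin 4) ℝ}
    {A F : R4 → Fin 4 → Fin 4 → ℝ} (hg : ∀ i j, ContDiffOn ℝ ∞ (fun y => g y i j) s)
    (hdet : ∀ y ∈ s, IsUnit (g y).det) (hA : ∀ i j, ContDiffOn ℝ ∞ (fun y => A y i j) s)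
    (hF : ∀ i j, ContDiffOn ℝ ∞ (fun y => F y i j) s) :
    ContDiffOn ℝ ∞ (fun y => ctrTwo (g y) (A y) (F y)) s := by
  have hinv := contDiffOn_inv hg fun y hy => (hdet y hy).ne_zero
  simp only [ctrTwo, ctr]
  exact ContDiffOn.sum fun k _ => ContDiffOn.sum fun a _ => (hinv k a).mul
    (ContDiffOn.sum fun l _ => ContDiffOn.sum fun b _ => (hinv l b).mul ((hA a b).mul (hF k l)))

lemma smoothOn_star (hU : S.IsUnitary U) {A : TwoForm M} {W : Set M} (hA : SmoothOn A W) :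
    SmoothOn (S.star A) W := by
  intro e he i j
  have h : ContDiffOn ℝ ∞ (fun x => 1 / 2 * ctrTwo (S.g e x) (twoComp e A x)
      (fun k l => S.eta e x k l i j)) (e.target ∩ e.symm ⁻¹' W) :=
    contDiffOn_const.mul (contDiffOn_ctrTwo
      (fun i j => (S.metric_smooth e he i j).mono Set.inter_subset_left)
      (fun y hy => isUnit_det_g hU he hy.1) (hA e he)
      (fun k l => (S.vol_smooth e he k l i j).mono Set.inter_subset_left))
  exact h.congr fun x hx => twoComp_star hU he hx.1 A i j

lemma unitaryComponents (hU : S.IsUnitary U) {e : OpenPartialHomeomorph M R4}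
    (he : e ∈ charts M) :
    UnitaryComponents (S.g e) (S.eta e) (twoComp e U) (twoComp e (S.star U)) e.target where
  isOpen := e.open_target
  symm y i j := S.metric_symm _ _ _
  antisymm_U := twoComp_antisymm e U
  antisymm_W := twoComp_antisymm e _
  smooth_g := S.metric_smooth e he
  smooth_V := S.vol_smooth e he
  smooth_U i j := by simpa using hU.1 e he i j
  smooth_W i j := by simpa using smoothOn_star hU hU.1 e he i j
  exists_frame _ hy := exists_adaptedFrame hU he hy

lemma twoComp_star_star (hU : S.IsUnitary U) (e : OpenPartialHomeomorph M R4) :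
    twoComp e (S.star (S.star U)) = fun y i j => -twoComp e U y i j := by
  funext y i j
  rw [twoComp, star_star hU, AlternatingMap.neg_apply]
  rfl

lemma codiff_eq (e : OpenPartialHomeomorph M R4) (A : TwoForm M) (x : R4) :
    S.codiff e A x = codiffArr (S.g e) (S.eta e) (twoComp e (S.star A)) x := rfl

lemma codiff_star_eq (hU : S.IsUnitary U) (e : OpenPartialHomeomorph M R4) (x : R4) :
    S.codiff e (S.star U) x
      = codiffArr (S.g e) (S.eta e) (fun y i j => -twoComp e U y i j) x := by
  rw [codiff_eq, twoComp_star_star hU]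

lemma Phi_eq (hU : S.IsUnitary U) (e : OpenPartialHomeomorph M R4) (x : R4) :
    S.Phi e U x = phiArr (S.g e x) (twoComp e U x) (twoComp e (S.star U) x)
      (codiffArr (S.g e) (S.eta e) (twoComp e (S.star U)) x)
      (codiffArr (S.g e) (S.eta e) (fun y i j => -twoComp e U y i j) x) := by
  rw [← codiff_star_eq hU]; rfl

lemma Psi_eq (hU : S.IsUnitary U) (e : OpenPartialHomeomorph M R4) (x : R4) :
    S.Psi e U x = psiArr (S.g e x) (twoComp e U x) (twoComp e (S.star U) x)
      (codiffArr (S.g e) (S.eta e) (twoComp e (S.star U)) x)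
      (codiffArr (S.g e) (S.eta e) (fun y i j => -twoComp e U y i j) x) := by
  rw [← codiff_star_eq hU]; rfl

lemma interior_re (G : Matrix (Fin 4) (Fin 4) ℝ) (w : Fin 4 → ℂ)
    (A : Fin 4 → Fin 4 → ℂ) (j : Fin 4) :
    (interior G w A j).re = interior G (fun i => (w i).re) (fun m n => (A m n).re) j
      - interior G (fun i => (w i).im) (fun m n => (A m n).im) j := by
  simp [interior, mul_sub, Finset.sum_sub_distrib]

lemma interior_im (G : Matrix (Fin 4) (Fin 4) ℝ) (w : Fin 4 → ℂ)
    (A : Fin 4 → Fin 4 → ℂ) (j : Fin 4) :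
    (interior G w A j).im = interior G (fun i => (w i).re) (fun m n => (A m n).im) j
      + interior G (fun i => (w i).im) (fun m n => (A m n).re) j := by
  simp [interior, mul_add, Finset.sum_add_distrib]

lemma interior_mul (G : Matrix (Fin 4) (Fin 4) ℝ) (r s : ℝ) (w : Fin 4 → ℝ)
    (A : Fin 4 → Fin 4 → ℝ) (j : Fin 4) :
    interior G (fun i => r * w i) (fun m n => s * A m n) j = r * s * interior G w A j := by
  simp only [interior, Finset.mul_sum, smul_eq_mul]
  exact Finset.sum_congr rfl fun _ _ => Finset.sum_congr rfl fun _ _ => by ring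

lemma selfDual_re (s t : ℝ) : (selfDual s t).re = 1 / √2 * s := by
  rw [selfDual, Complex.re_ofReal_mul]; simp

lemma selfDual_im (s t : ℝ) : (selfDual s t).im = -(1 / √2) * t := by
  rw [selfDual, Complex.im_ofReal_mul]; simp

lemma selfDualMetric_re (G : Matrix (Fin 4) (Fin 4) ℝ)
    (V : Fin 4 → Fin 4 → Fin 4 → Fin 4 → ℝ) (a b m n : Fin 4) :
    (selfDualMetric G V a b m n).re = 1 / 2 * (G a m * G b n - G a n * G b m) := by
  simp [selfDualMetric]

lemma selfDualMetric_im (G : Matrix (Fin 4) (Fin 4) ℝ)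
    (V : Fin 4 → Fin 4 → Fin 4 → Fin 4 → ℝ) (a b m n : Fin 4) :
    (selfDualMetric G V a b m n).im = -(1 / 2) * V a b m n := by
  simp [selfDualMetric]

/-- Taking real and imaginary parts replaces the complex tensor by `sigRe` and `sigIm`, up to the
common factor `1/√2`. -/
lemma Sig_eq_zero_iff (hU : S.IsUnitary U) (e : OpenPartialHomeomorph M R4) (x : R4) :
    (∀ k i j, S.Sig e U x k i j = 0) ↔
      UnitaryComponents.SigZero (S.g e) (S.eta e) (twoComp e U) (twoComp e (S.star U)) x := by
  have hr : (1 / √2) ≠ 0 := by positivity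
  -- The quadratic term in `𝒰` carries `(1/√2)³`, to be compared with the single `1/√2` of `∇𝒰`;
  -- this produces the factor `1/2` in `sigRe` and `sigIm`.
  have hr2 : (1 / √2) * (1 / √2) = 1 / 2 := by
    rw [div_mul_div_comm, Real.mul_self_sqrt (by norm_num)]; norm_num
  refine forall_congr' fun k => forall_congr' fun i => forall_congr' fun j => ?_
  have hre : (S.Sig e U x k i j).re = 1 / √2 * sigRe (S.g e x) (S.eta e x) (twoComp e U x)
      (twoComp e (S.star U) x) (nabla (S.g e) (twoComp e U) x)
      (codiffArr (S.g e) (S.eta e) (twoComp e (S.star U)) x)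
      (codiffArr (S.g e) (S.eta e) (fun y i j => -twoComp e U y i j) x) k i j := by
    rw [← codiff_star_eq hU, ← codiff_eq]
    simp only [Sig, nablaCalU, calU, codiffCalU, nablaTwo, Complex.sub_re, Complex.mul_re,
      interior_re, interior_im, selfDual_re, selfDual_im, selfDualMetric_re, selfDualMetric_im,
      interior_mul, sigRe, phiArr, psiArr, interiorMetric, interiorVol]
    linear_combination (-(1 / √2) *
      (interior (S.g e x) (S.codiff e U x) (twoComp e U x) k * twoComp e U x i j
      - interior (S.g e x) (S.codiff e (S.star U) x) (twoComp e (S.star U) x) k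
        * twoComp e U x i j
      - interior (S.g e x) (S.codiff e U x) (twoComp e (S.star U) x) k * twoComp e (S.star U) x i j
      - interior (S.g e x) (S.codiff e (S.star U) x) (twoComp e U x) k
        * twoComp e (S.star U) x i j)) * hr2
  have him : (S.Sig e U x k i j).im = 1 / √2 * sigIm (S.g e x) (S.eta e x) (twoComp e U x)
      (twoComp e (S.star U) x) (nabla (S.g e) (twoComp e (S.star U)) x)
      (codiffArr (S.g e) (S.eta e) (twoComp e (S.star U)) x)
      (codiffArr (S.g e) (S.eta e) (fun y i j => -twoComp e U y i j) x) k i j := by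
    rw [← codiff_star_eq hU, ← codiff_eq]
    simp only [Sig, nablaCalU, calU, codiffCalU, nablaTwo, Complex.sub_im, Complex.mul_im,
      interior_re, interior_im, selfDual_re, selfDual_im, selfDualMetric_re, selfDualMetric_im,
      interior_mul, sigIm, phiArr, psiArr, interiorMetric, interiorVol]
    linear_combination ((1 / √2) *
      (interior (S.g e x) (S.codiff e U x) (twoComp e U x) k * twoComp e (S.star U) x i j
      - interior (S.g e x) (S.codiff e (S.star U) x) (twoComp e (S.star U) x) k
        * twoComp e (S.star U) x i j
      + interior (S.g e x) (S.codiff e U x) (twoComp e (S.star U) x) k * twoComp e U x i j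
      + interior (S.g e x) (S.codiff e (S.star U) x) (twoComp e U x) k
        * twoComp e U x i j)) * hr2
  rw [Complex.ext_iff, hre, him]
  simp

end OrientedSpacetime

end

section

/-! ### Smoothness of the concomitants -/

lemma contDiffOn_interior {s : Set R4} {g : R4 → Matrix (Fin 4) (Fin 4) ℝ} {w : R4 → Fin 4 → ℝ}
    {A : R4 → Fin 4 → Fin 4 → ℝ} (hg : ∀ i j, ContDiffOn ℝ ∞ (fun y => g y i j) s)
    (hdet : ∀ y ∈ s, IsUnit (g y).det) (hw : ∀ i, ContDiffOn ℝ ∞ (fun y => w y i) s)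
    (hA : ∀ i j, ContDiffOn ℝ ∞ (fun y => A y i j) s) (j : Fin 4) :
    ContDiffOn ℝ ∞ (fun y => interior (g y) (w y) (A y) j) s := by
  have hinv := contDiffOn_inv hg fun y hy => (hdet y hy).ne_zero
  simp only [interior, smul_eq_mul]
  exact ContDiffOn.sum fun i _ => ContDiffOn.sum fun a _ => (hinv i a).mul ((hw a).mul (hA i j))

lemma contDiffOn_codiffArr {s : Set R4} (hs : IsOpen s) {g : R4 → Matrix (Fin 4) (Fin 4) ℝ}
    {V : R4 → Fin 4 → Fin 4 → Fin 4 → Fin 4 → ℝ} {A : R4 → Fin 4 → Fin 4 → ℝ}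
    (hg : ∀ i j, ContDiffOn ℝ ∞ (fun y => g y i j) s) (hdet : ∀ y ∈ s, IsUnit (g y).det)
    (hV : ∀ i j k l, ContDiffOn ℝ ∞ (fun y => V y i j k l) s)
    (hA : ∀ i j, ContDiffOn ℝ ∞ (fun y => A y i j) s) (l : Fin 4) :
    ContDiffOn ℝ ∞ (fun y => codiffArr g V A y l) s := by
  have hinv := contDiffOn_inv hg fun y hy => (hdet y hy).ne_zero
  have hd : ∀ i j k, ContDiffOn ℝ ∞ (fun y => dTwo A y i j k) s := fun i j k =>
    ((contDiffOn_pd hs (hA j k) i).add (contDiffOn_pd hs (hA k i) j)).add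
      (contDiffOn_pd hs (hA i j) k)
  simp only [codiffArr, starThree]
  exact contDiffOn_const.mul (ContDiffOn.sum fun i _ => ContDiffOn.sum fun j _ =>
    ContDiffOn.sum fun k _ => ContDiffOn.sum fun a _ => ContDiffOn.sum fun b _ =>
    ContDiffOn.sum fun c _ => ((((hinv i a).mul (hinv j b)).mul (hinv k c)).mul (hd a b c)).mul
      (hV i j k l))

namespace UnitaryComponents

variable {g : R4 → Matrix (Fin 4) (Fin 4) ℝ} {V : R4 → Fin 4 → Fin 4 → Fin 4 → Fin 4 → ℝ}
  {U W : R4 → Fin 4 → Fin 4 → ℝ} {s : Set R4}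

lemma contDiffOn_phi_psi (H : UnitaryComponents g V U W s) (i : Fin 4) :
    ContDiffOn ℝ ∞ (fun y => phiArr (g y) (U y) (W y) (codiffArr g V W y)
        (codiffArr g V (fun y i j => -U y i j) y) i) s ∧
      ContDiffOn ℝ ∞ (fun y => psiArr (g y) (U y) (W y) (codiffArr g V W y)
        (codiffArr g V (fun y i j => -U y i j) y) i) s := by
  have hdet : ∀ y ∈ s, IsUnit (g y).det := fun _ hy => H.isUnit_det hy
  have ha := contDiffOn_codiffArr H.isOpen H.smooth_g hdet H.smooth_V H.smooth_W
  have hb := contDiffOn_codiffArr (A := fun y i j => -U y i j) H.isOpen H.smooth_g hdet H.smooth_V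
    fun i j => (H.smooth_U i j).neg
  have key : ∀ {w : R4 → Fin 4 → ℝ} {A : R4 → Fin 4 → Fin 4 → ℝ},
      (∀ i, ContDiffOn ℝ ∞ (fun y => w y i) s) → (∀ i j, ContDiffOn ℝ ∞ (fun y => A y i j) s) →
      ContDiffOn ℝ ∞ (fun y => interior (g y) (w y) (A y) i) s :=
    fun hw hA => contDiffOn_interior H.smooth_g hdet hw hA i
  exact ⟨(key ha H.smooth_U).sub (key hb H.smooth_W),
    (key ha H.smooth_W).neg.sub (key hb H.smooth_U)⟩

end UnitaryComponents

/-! ### Closed 1-forms -/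

/-- Mixed partials of `α + iβ` commute, so differentiating `d(α + iβ) = (p + iq)(α + iβ)` gives `(α
+ iβ) d(p + iq) = 0`. No branch of the argument has to be chosen. -/
lemma dOne_eq_zero_of_rotation {s : Set R4} (hs : IsOpen s) {α β : R4 → ℝ}
    (hα : ContDiffOn ℝ ∞ α s) (hβ : ContDiffOn ℝ ∞ β s) {p q : R4 → Fin 4 → ℝ}
    (hp : ∀ i, ContDiffOn ℝ ∞ (fun y => p y i) s) (hq : ∀ i, ContDiffOn ℝ ∞ (fun y => q y i) s)
    (h1 : ∀ y ∈ s, ∀ i, pd i α y = α y * p y i - β y * q y i)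
    (h2 : ∀ y ∈ s, ∀ i, pd i β y = β y * p y i + α y * q y i) {x : R4} (hx : x ∈ s)
    (hρ : α x ^ 2 + β x ^ 2 ≠ 0) (i j : Fin 4) :
    dOne p x i j = 0 ∧ dOne q x i j = 0 := by
  have da := diffAt_of_contDiffOn hs hα hx
  have db := diffAt_of_contDiffOn hs hβ hx
  have dp := fun i => diffAt_of_contDiffOn hs (hp i) hx
  have dq := fun i => diffAt_of_contDiffOn hs (hq i) hx
  have e1 : ∀ i j, pd j (pd i α) x = (α x * p x j - β x * q x j) * p x i
      + α x * pd j (fun y => p y i) x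
      - ((β x * p x j + α x * q x j) * q x i + β x * pd j (fun y => q y i) x) := by
    intro i j
    have h : pd i α =ᶠ[𝓝 x] fun y => α y * p y i - β y * q y i :=
      (hs.eventually_mem hx).mono fun y hy => h1 y hy i
    rw [pd_congr h, pd_sub (f := fun y => α y * p y i) (h := fun y => β y * q y i)
      (da.mul (dp i)) (db.mul (dq i)), pd_mul da (dp i), pd_mul db (dq i),
      h1 x hx, h2 x hx]
  have e2 : ∀ i j, pd j (pd i β) x = (β x * p x j + α x * q x j) * p x i
      + β x * pd j (fun y => p y i) x
      + ((α x * p x j - β x * q x j) * q x i + α x * pd j (fun y => q y i) x) := by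
    intro i j
    have h : pd i β =ᶠ[𝓝 x] fun y => β y * p y i + α y * q y i :=
      (hs.eventually_mem hx).mono fun y hy => h2 y hy i
    rw [pd_congr h, pd_add (f := fun y => β y * p y i) (h := fun y => α y * q y i)
      (db.mul (dp i)) (da.mul (dq i)), pd_mul db (dp i), pd_mul da (dq i),
      h1 x hx, h2 x hx]
  have c1 := pd_comm hs hα hx i j
  have c2 := pd_comm hs hβ hx i j
  rw [e1, e1] at c1
  rw [e2, e2] at c2
  have z := duality_rotation_eq_zero (ι := Unit) hρ (x := fun _ => dOne q x i j)
    (y := fun _ => dOne p x i j) (fun _ => by simp only [dOne]; linear_combination c2)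
    (fun _ => by simp only [dOne]; linear_combination c1)
  exact ⟨congrFun z.2 (), congrFun z.1 ()⟩

lemma eq_sum_single (v : R4) : v = ∑ i, v i • (EuclideanSpace.single i (1 : ℝ) : R4) := by
  have := (EuclideanSpace.basisFun (Fin 4) ℝ).sum_repr v
  simpa using this.symm

lemma fderiv_eq_sum_pd (f : R4 → ℝ) (x v : R4) : fderiv ℝ f x v = ∑ i, v i * pd i f x := by
  conv_lhs => rw [eq_sum_single v]
  simp [pd]

/-- The Poincaré lemma for 1-forms on an open convex set. -/
lemma exists_potential {s : Set R4} (hs : IsOpen s) (hc : Convex ℝ s) {w : R4 → Fin 4 → ℝ}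
    (hw : ∀ i, ContDiffOn ℝ ∞ (fun y => w y i) s) (hd : ∀ x ∈ s, ∀ i j, dOne w x i j = 0) :
    ∃ f : R4 → ℝ, ContDiffOn ℝ ∞ f s ∧ ∀ x ∈ s, ∀ i, pd i f x = w x i := by
  -- The 1-form as a field of linear functionals: closedness becomes symmetry of the derivative of
  -- `θ`.
  let θ : R4 → R4 →L[ℝ] ℝ := fun x => ∑ i, w x i • EuclideanSpace.proj (𝕜 := ℝ) i
  have hθ : ContDiffOn ℝ ∞ θ s := ContDiffOn.sum fun i _ => (hw i).smul contDiffOn_const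
  have hsymm : ∀ a ∈ s, ∀ x y, fderiv ℝ θ a x y = fderiv ℝ θ a y x := by
    intro a ha x y
    have dw := fun i => diffAt_of_contDiffOn hs (hw i) ha
    have e : ∀ x y, fderiv ℝ θ a x y = ∑ i, ∑ j, x j * y i * pd j (fun z => w z i) a := by
      intro x y
      have h1 : fderiv ℝ θ a = ∑ i, (fderiv ℝ (fun z => w z i) a).smulRight
          (EuclideanSpace.proj (𝕜 := ℝ) i : R4 →L[ℝ] ℝ) := by
        apply HasFDerivAt.fderiv
        have hi : ∀ i, HasFDerivAt (𝕜 := ℝ)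
            (fun z => w z i • (EuclideanSpace.proj (𝕜 := ℝ) i : R4 →L[ℝ] ℝ))
            ((fderiv ℝ (fun z => w z i) a).smulRight
              (EuclideanSpace.proj (𝕜 := ℝ) i : R4 →L[ℝ] ℝ)) a := fun i =>
          (dw i).hasFDerivAt.smul_const (EuclideanSpace.proj (𝕜 := ℝ) i : R4 →L[ℝ] ℝ)
        exact HasFDerivAt.fun_sum fun i _ => hi i
      rw [h1]
      simp only [sum_apply, ContinuousLinearMap.smulRight_apply,
        smul_apply, fderiv_eq_sum_pd, smul_eq_mul, Finset.sum_mul]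
      refine Finset.sum_congr rfl fun i _ => Finset.sum_congr rfl fun j _ => ?_
      simp only [PiLp.proj_apply]; ring
    rw [e, e, Finset.sum_comm]
    refine Finset.sum_congr rfl fun i _ => Finset.sum_congr rfl fun j _ => ?_
    have := hd a ha i j
    rw [dOne, sub_eq_zero] at this
    rw [this]; ring
  obtain ⟨f, hf⟩ := hc.exists_forall_hasFDerivAt_of_fderiv_symmetric hs
    (hθ.differentiableOn (by simp)) hsymm
  refine ⟨f, ?_, fun x hx i => ?_⟩
  · rw [contDiffOn_infty_iff_fderiv_of_isOpen hs]
    exact ⟨fun x hx => (hf x hx).differentiableAt.differentiableWithinAt,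
      hθ.congr fun x hx => (hf x hx).fderiv⟩
  · rw [pd, (hf x hx).fderiv]
    simp [θ]

/-! ### Change of coordinates -/

/-- The Jacobian matrix of a map between coordinate domains. -/
def jac (τ : R4 → R4) (x : R4) : Matrix (Fin 4) (Fin 4) ℝ :=
  Matrix.of fun a i => pd i (fun y => τ y a) x

lemma pd_comp {f : R4 → ℝ} {τ : R4 → R4} {x : R4} (hf : DifferentiableAt ℝ f (τ x))
    (hτ : DifferentiableAt ℝ τ x) (i : Fin 4) :
    pd i (fun y => f (τ y)) x = tr1 (jac τ x) (fun c => pd c f (τ x)) i := by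
  have h : ∀ a, (fderiv ℝ τ x (EuclideanSpace.single i 1)) a = pd i (fun y => τ y a) x := by
    intro a
    have hp := (EuclideanSpace.proj (𝕜 := ℝ) a : R4 →L[ℝ] ℝ).hasFDerivAt.comp x hτ.hasFDerivAt
    exact (congrArg (fun L : R4 →L[ℝ] ℝ => L (EuclideanSpace.single i 1)) hp.fderiv).symm
  have hc : fderiv ℝ (fun y => f (τ y)) x = (fderiv ℝ f (τ x)).comp (fderiv ℝ τ x) :=
    fderiv_comp x hf hτ
  rw [pd, hc, ContinuousLinearMap.comp_apply, fderiv_eq_sum_pd]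
  simp only [h, tr1, jac, Matrix.of_apply]

/-- Naturality of the exterior derivative. With the tensoriality of the Hodge star it gives the
covariance of the codifferential without the transformation law of the Christoffel symbols. -/
lemma dTwo_comp {o : Set R4} (ho : IsOpen o) {τ : R4 → R4} (hτ : ContDiffOn ℝ ∞ τ o) {x : R4}
    (hx : x ∈ o) {B B' : R4 → Fin 4 → Fin 4 → ℝ} (hB : ∀ y i j, B y i j = -B y j i)
    (hd : ∀ i j, DifferentiableAt ℝ (fun y => B y i j) (τ x))
    (h : ∀ y ∈ o, B' y = tr2 (jac τ y) (B (τ y))) :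
    dTwo B' x = tr3 (jac τ x) (dTwo B (τ x)) := by
  have hτ' : ∀ a, ContDiffOn ℝ ∞ (fun y => τ y a) o := fun a =>
    (EuclideanSpace.proj (𝕜 := ℝ) a : R4 →L[ℝ] ℝ).contDiff.comp_contDiffOn hτ
  have dτ : DifferentiableAt ℝ τ x := (hτ.contDiffAt (ho.mem_nhds hx)).differentiableAt (by simp)
  have dJ : ∀ a i, DifferentiableAt ℝ (fun y => jac τ y a i) x := fun a i =>
    diffAt_of_contDiffOn ho (contDiffOn_pd ho (hτ' a) i) hx
  have dB : ∀ a b, DifferentiableAt ℝ (fun y => B (τ y) a b) x := fun a b => (hd a b).comp x dτ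
  have hH : ∀ a k i, pd k (fun y => jac τ y a i) x = pd i (fun y => jac τ y a k) x := fun a k i =>
    pd_comm ho (hτ' a) hx k i
  -- The terms with second derivatives of `τ`. `X` is symmetric in its first two indices, so these
  -- terms cancel in the cyclic sum.
  let X : Fin 4 → Fin 4 → Fin 4 → ℝ := fun k i j =>
    ∑ a, ∑ b, pd k (fun y => jac τ y a i) x * (jac τ x b j * B (τ x) a b)
  have hX : ∀ k i j, X k i j = X i k j := fun k i j => by simp only [X, hH _ k i]
  have key : ∀ k i j, pd k (fun y => B' y i j) x
      = X k i j - X k j i + tr3 (jac τ x) (fun c a b => pd c (fun y => B y a b) (τ x)) k i j := by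
    intro k i j
    have e0 : (fun y => B' y i j) =ᶠ[𝓝 x] fun y =>
        ∑ a, jac τ y a i * ∑ b, jac τ y b j * B (τ y) a b :=
      (ho.eventually_mem hx).mono fun y hy => by
        have := congrFun (congrFun (h y hy) i) j
        simpa only [tr2, tr1] using this
    have dS : ∀ a, DifferentiableAt ℝ (fun y => ∑ b, jac τ y b j * B (τ y) a b) x := fun a =>
      DifferentiableAt.fun_sum fun b _ => (dJ b j).mul (dB a b)
    rw [pd_congr e0, pd_sum (f := fun a y => jac τ y a i * ∑ b, jac τ y b j * B (τ y) a b)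
      fun a _ => (dJ a i).mul (dS a)]
    have e1 : ∀ a, pd k (fun y => jac τ y a i * ∑ b, jac τ y b j * B (τ y) a b) x
        = ∑ b, pd k (fun y => jac τ y a i) x * (jac τ x b j * B (τ x) a b)
          + ∑ b, jac τ x a i * (pd k (fun y => jac τ y b j) x * B (τ x) a b)
          + jac τ x a i * ∑ b, jac τ x b j *
            tr1 (jac τ x) (fun c => pd c (fun y => B y a b) (τ x)) k := by
      intro a
      rw [pd_mul (dJ a i) (dS a), pd_sum (f := fun b y => jac τ y b j * B (τ y) a b)
        fun b _ => (dJ b j).mul (dB a b), add_assoc]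
      simp only [Finset.mul_sum, ← Finset.sum_add_distrib]
      refine Finset.sum_congr rfl fun b _ => ?_
      rw [pd_mul (dJ b j) (dB a b), pd_comp (hd a b) dτ]
      ring
    simp only [e1, Finset.sum_add_distrib]
    have e2 : ∑ a, ∑ b, jac τ x a i * (pd k (fun y => jac τ y b j) x * B (τ x) a b)
        = -X k j i := by
      simp only [X]
      rw [Finset.sum_comm, ← Finset.sum_neg_distrib]
      refine Finset.sum_congr rfl fun b _ => ?_
      rw [← Finset.sum_neg_distrib]
      refine Finset.sum_congr rfl fun a _ => ?_
      rw [hB (τ x) a b]; ring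
    have e3 : ∑ a, jac τ x a i * ∑ b, jac τ x b j *
        tr1 (jac τ x) (fun c => pd c (fun y => B y a b) (τ x)) k
        = tr3 (jac τ x) (fun c a b => pd c (fun y => B y a b) (τ x)) k i j := by
      have : ∑ a, jac τ x a i * ∑ b, jac τ x b j *
          tr1 (jac τ x) (fun c => pd c (fun y => B y a b) (τ x)) k
        = tr1 (jac τ x) (fun a => tr1 (jac τ x) (fun b =>
          tr1 (jac τ x) (fun c => pd c (fun y => B y a b) (τ x)) k) j) i := rfl
      have hin : ∀ a, tr1 (jac τ x) (fun b =>
          tr1 (jac τ x) (fun c => pd c (fun y => B y a b) (τ x)) k) j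
          = tr1 (jac τ x) (fun c =>
            tr1 (jac τ x) (fun b => pd c (fun y => B y a b) (τ x)) j) k := fun a =>
        tr1_comm (jac τ x) (jac τ x) (fun b c => pd c (fun y => B y a b) (τ x)) j k
      rw [this]
      simp only [hin]
      exact tr1_comm (jac τ x) (jac τ x) (fun a c =>
        tr1 (jac τ x) (fun b => pd c (fun y => B y a b) (τ x)) j) i k
    rw [e2, e3]
    ring
  have hfin : tr3 (jac τ x) (dTwo B (τ x))
      = cyc (tr3 (jac τ x) (fun c a b => pd c (fun y => B y a b) (τ x))) := by
    funext i j k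
    rw [← tr3_cyc]
    rfl
  rw [hfin]
  funext i j k
  simp only [dTwo, key, cyc]
  rw [hX i j k, hX j k i, hX k i j]
  ring

end

section

/-! ### Change of charts -/

variable {M : Type*} [TopologicalSpace M] [ChartedSpace R4 M] [IsManifold (𝓡 4) ∞ M]

/-- The coordinates of `e` as functions of the coordinates of `e'`. -/
def transition (e e' : OpenPartialHomeomorph M R4) (y : R4) : R4 := e (e'.symm y)

/-- The domain of the change of coordinates from `e'` to `e`. -/
def overlap (e e' : OpenPartialHomeomorph M R4) : Set R4 := e'.target ∩ e'.symm ⁻¹' e.source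

lemma isOpen_overlap (e e' : OpenPartialHomeomorph M R4) : IsOpen (overlap e e') :=
  e'.isOpen_inter_preimage_symm e.open_source

lemma contDiffOn_transition {e e' : OpenPartialHomeomorph M R4} (he : e ∈ charts M)
    (he' : e' ∈ charts M) : ContDiffOn ℝ ∞ (transition e e') (overlap e e') := by
  rw [← contMDiffOn_iff_contDiffOn]
  exact (contMDiffOn_of_mem_maximalAtlas he).comp
    ((contMDiffOn_symm_of_mem_maximalAtlas he').mono Set.inter_subset_left) fun y hy => hy.2

lemma transition_mem {e e' : OpenPartialHomeomorph M R4} {y : R4} (hy : y ∈ overlap e e') :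
    transition e e' y ∈ e.target := e.map_source hy.2

lemma symm_transition {e e' : OpenPartialHomeomorph M R4} {y : R4} (hy : y ∈ overlap e e') :
    e.symm (transition e e' y) = e'.symm y := e.left_inv hy.2

/-- Keeping `p` apart from `e.symm x` places the coordinate vectors of one chart in the tangent
space at a point named by another chart. -/
lemma exists_frame_of_chart {e : OpenPartialHomeomorph M R4} (he : e ∈ charts M) {x : R4}
    (hx : x ∈ e.target) {p : M} (h : e.symm x = p) :
    ∃ v : Fin 4 → TangentSpace (𝓡 4) p,
      (∀ u : TangentSpace (𝓡 4) p, u = ∑ i, (show R4 from mfderiv (𝓡 4) (𝓡 4) e p u) i • v i) ∧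
      (∀ (B : BilinField M) i j, B p (v i) (v j) = bilinComp e B x i j) ∧
      (∀ (A : TwoForm M) i j, A p ![v i, v j] = twoComp e A x i j) ∧
      ∀ (N : FourForm M) i j k l, N p ![v i, v j, v k, v l] = fourComp e N x i j k l := by
  subst h
  exact ⟨coordVec e x, sum_coordVec he hx, fun _ _ _ => rfl, fun _ _ _ => rfl,
    fun _ _ _ _ _ => rfl⟩

lemma mfderiv_coordVec {e e' : OpenPartialHomeomorph M R4} (he : e ∈ charts M)
    (he' : e' ∈ charts M) {y : R4} (hy : y ∈ overlap e e') (a i : Fin 4) :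
    (show R4 from mfderiv (𝓡 4) (𝓡 4) e (e'.symm y) (coordVec e' y a)) i
      = jac (transition e e') y i a := by
  have h1 := (mdifferentiable_of_mem_charts he).mdifferentiableAt hy.2
  have h2 := (mdifferentiable_of_mem_charts he').mdifferentiableAt_symm hy.1
  have h3 : mfderiv (𝓡 4) (𝓡 4) (transition e e') y
      = (mfderiv (𝓡 4) (𝓡 4) e (e'.symm y)).comp (mfderiv (𝓡 4) (𝓡 4) e'.symm y) :=
    mfderiv_comp y h1 h2
  rw [mfderiv_eq_fderiv] at h3
  have h4 : (show R4 from mfderiv (𝓡 4) (𝓡 4) e (e'.symm y) (coordVec e' y a))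
      = fderiv ℝ (transition e e') y (EuclideanSpace.single a 1) :=
    (congrArg (fun L : R4 →L[ℝ] R4 => L (EuclideanSpace.single a 1)) h3).symm
  rw [h4]
  have hd : DifferentiableAt ℝ (transition e e') y :=
    ((contDiffOn_transition he he').contDiffAt ((isOpen_overlap e e').mem_nhds hy)).differentiableAt
      (by simp)
  have hp := (EuclideanSpace.proj (𝕜 := ℝ) i : R4 →L[ℝ] ℝ).hasFDerivAt.comp y hd.hasFDerivAt
  exact (congrArg (fun L : R4 →L[ℝ] ℝ => L (EuclideanSpace.single a 1)) hp.fderiv).symm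

lemma comp_transition {e e' : OpenPartialHomeomorph M R4} (he : e ∈ charts M)
    (he' : e' ∈ charts M) {y : R4} (hy : y ∈ overlap e e') :
    (∀ B : BilinField M, (jac (transition e e') y).transpose *
        bilinComp e B (transition e e' y) * jac (transition e e') y = bilinComp e' B y) ∧
      (∀ A : TwoForm M, twoComp e' A y
        = tr2 (jac (transition e e') y) (twoComp e A (transition e e' y))) ∧
      ∀ N : FourForm M, fourComp e' N y
        = tr4 (jac (transition e e') y) (fourComp e N (transition e e' y)) := by
  obtain ⟨v, hv, hB, hA, hN⟩ := exists_frame_of_chart he (transition_mem hy) (symm_transition hy)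
  have hc : ∀ a, coordVec e' y a = ∑ i, jac (transition e e') y i a • v i := fun a => by
    refine (hv (coordVec e' y a)).trans (Finset.sum_congr rfl fun i _ => ?_)
    rw [mfderiv_coordVec he he' hy]
  refine ⟨fun B => ?_, fun A => ?_, fun N => ?_⟩
  · have h := bilin_tr_matrix (B (e'.symm y)) hc
    simp only [hB] at h
    exact h
  · funext i j
    have h := alternating_two_tr (A (e'.symm y)) hc i j
    simp only [hA] at h
    exact h
  · funext i j k l
    have h := alternating_four_tr (N (e'.symm y)) hc i j k l
    simp only [hN] at h
    exact h

/-- A covariant and closed family of 1-forms is locally exact. -/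
lemma exists_local_potential
    {w : OpenPartialHomeomorph M R4 → R4 → Fin 4 → ℝ}
    (hs : ∀ e ∈ charts M, ∀ i, ContDiffOn ℝ ∞ (fun y => w e y i) e.target)
    (hw : ∀ e ∈ charts M, ∀ e' ∈ charts M, ∀ y ∈ overlap e e',
      w e' y = tr1 (jac (transition e e') y) (w e (transition e e' y)))
    (hd : ∀ e ∈ charts M, ∀ x ∈ e.target, ∀ i j, dOne (w e) x i j = 0) (p : M) :
    ∃ W : Set M, IsOpen W ∧ p ∈ W ∧ ∃ φ : M → ℝ, ContMDiffOn (𝓡 4) 𝓘(ℝ, ℝ) ∞ φ W ∧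
      ∀ e ∈ charts M, ∀ x ∈ e.target, e.symm x ∈ W → ∀ i, pd i (φ ∘ e.symm) x = w e x i := by
  -- The potential is built on a ball in one chart; covariance of `w` and the chain rule make it a
  -- potential in every other chart.
  set e := chartAt R4 p with hedef
  have he : e ∈ charts M := IsManifold.chart_mem_maximalAtlas p
  have hp : p ∈ e.source := mem_chart_source R4 p
  obtain ⟨r, hr, hball⟩ := Metric.isOpen_iff.mp e.open_target (e p) (e.map_source hp)
  obtain ⟨f, hf, hfw⟩ := exists_potential Metric.isOpen_ball (convex_ball (e p) r)
    (fun i => (hs e he i).mono hball) fun x hx => hd e he x (hball hx)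
  refine ⟨e.source ∩ e ⁻¹' Metric.ball (e p) r, e.isOpen_inter_preimage Metric.isOpen_ball,
    ⟨hp, Metric.mem_ball_self hr⟩, f ∘ e, ?_, fun e' he' x hx hxW i => ?_⟩
  · exact (contMDiffOn_iff_contDiffOn.mpr hf).comp
      ((contMDiffOn_of_mem_maximalAtlas he).mono Set.inter_subset_left) fun q hq => hq.2
  · have hy : x ∈ overlap e e' := ⟨hx, hxW.1⟩
    have h := pd_comp (f := f) (τ := transition e e') (x := x)
      (diffAt_of_contDiffOn Metric.isOpen_ball hf hxW.2)
      (((contDiffOn_transition he he').contDiffAt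
        ((isOpen_overlap e e').mem_nhds hy)).differentiableAt (by simp)) i
    have h0 : (f ∘ e) ∘ e'.symm = fun y => f (transition e e' y) := rfl
    rw [h0, h, hw e he e' he' x hy]
    congr 1
    funext c
    exact hfw _ hxW.2 c

namespace OrientedSpacetime

variable {S : OrientedSpacetime M} {U : TwoForm M}

/-- The codifferentials transform as covectors, being `*d*`, and interior products are tensorial.
Hence the coordinate expressions of `Φ` and `Ψ` define 1-forms on the manifold. -/
lemma Phi_Psi_transition (hU : S.IsUnitary U) {e e' : OpenPartialHomeomorph M R4}
    (he : e ∈ charts M) (he' : e' ∈ charts M) {y : R4} (hy : y ∈ overlap e e') :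
    S.Phi e' U y = tr1 (jac (transition e e') y) (S.Phi e U (transition e e' y)) ∧
      S.Psi e' U y = tr1 (jac (transition e e') y) (S.Psi e U (transition e e' y)) := by
  obtain ⟨hB, hA, hN⟩ := comp_transition he he' hy
  have hG : (jac (transition e e') y).transpose * S.g e (transition e e' y)
      * jac (transition e e') y = S.g e' y := hB S.metric
  have hJ : IsUnit (jac (transition e e') y).det := by
    have hu := isUnit_det_g hU he' hy.1
    rw [← hG, Matrix.det_mul] at hu
    exact isUnit_of_mul_isUnit_right hu
  have hd : ∀ C C' : R4 → Fin 4 → Fin 4 → ℝ, (∀ y i j, C y i j = -C y j i) →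
      (∀ i j, ContDiffOn ℝ ∞ (fun y => C y i j) e.target) →
      (∀ y ∈ overlap e e', C' y = tr2 (jac (transition e e') y) (C (transition e e' y))) →
      codiffArr (S.g e') (S.eta e') C' y
        = tr1 (jac (transition e e') y) (codiffArr (S.g e) (S.eta e) C (transition e e' y)) := by
    intro C C' hC hs hCC
    have h := dTwo_comp (isOpen_overlap e e') (contDiffOn_transition he he') hy hC
      (fun i j => diffAt_of_contDiffOn e.open_target (hs i j) (transition_mem hy)) hCC
    funext l
    rw [codiffArr, h, codiffArr, starThree_tr hJ hG, eta, hN]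
    rfl
  have H := unitaryComponents hU he
  have h1 := hd (twoComp e (S.star U)) (twoComp e' (S.star U)) H.antisymm_W H.smooth_W
    fun z hz => (comp_transition he he' hz).2.1 _
  have h2 := hd (fun y i j => -twoComp e U y i j) (fun y i j => -twoComp e' U y i j)
    (fun y i j => by rw [H.antisymm_U y i j]) (fun i j => (H.smooth_U i j).neg) fun z hz => by
      rw [(comp_transition he he' hz).2.1 U]
      funext i j
      simp only [tr2, tr1_neg]
  constructor
  · funext k
    rw [Phi_eq hU, Phi_eq hU, phiArr_tr hJ hG, h1, h2, ← hG, hA, hA]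
  · funext k
    rw [Psi_eq hU, Psi_eq hU, psiArr_tr hJ hG, h1, h2, ← hG, hA, hA]

end OrientedSpacetime

end

/-! ### Duality-rotated forms on the manifold. -/

section

variable {M : Type*} [TopologicalSpace M] [ChartedSpace R4 M] [IsManifold (𝓡 4) ∞ M]

/-- The coordinates of the points of `W`. -/
def coordSet (e : OpenPartialHomeomorph M R4) (W : Set M) : Set R4 := e.target ∩ e.symm ⁻¹' W

lemma isOpen_coordSet (e : OpenPartialHomeomorph M R4) {W : Set M} (hW : IsOpen W) :
    IsOpen (coordSet e W) := e.isOpen_inter_preimage_symm hW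

lemma contDiffOn_comp_symm {φ : M → ℝ} {W : Set M} (hφ : ContMDiffOn (𝓡 4) 𝓘(ℝ, ℝ) ∞ φ W)
    {e : OpenPartialHomeomorph M R4} (he : e ∈ charts M) :
    ContDiffOn ℝ ∞ (φ ∘ e.symm) (coordSet e W) :=
  contMDiffOn_iff_contDiffOn.mp (hφ.comp ((contMDiffOn_symm_of_mem_maximalAtlas he).mono
    Set.inter_subset_left) fun _ hy => hy.2)

lemma exp_sq_ne_zero (a b : ℝ) :
    (Real.exp a * Real.cos b) ^ 2 + (Real.exp a * Real.sin b) ^ 2 ≠ 0 := by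
  have h : (Real.exp a * Real.cos b) ^ 2 + (Real.exp a * Real.sin b) ^ 2 = Real.exp a ^ 2 := by
    linear_combination Real.exp a ^ 2 * Real.sin_sq_add_cos_sq b
  rw [h]
  positivity

namespace OrientedSpacetime

variable {S : OrientedSpacetime M} {U : TwoForm M}

lemma isUmbilical_iff_sigVanishes (hU : S.IsUnitary U) : S.IsUmbilical U ↔ S.SigVanishes U := by
  refine forall_congr' fun e => forall_congr' fun he => forall_congr' fun x =>
    forall_congr' fun hx => ?_
  rw [Sig_eq_zero_iff hU]
  exact (unitaryComponents hU he).umbilical_iff_sigZero hx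

lemma contDiffOn_Phi_Psi (hU : S.IsUnitary U) {e : OpenPartialHomeomorph M R4}
    (he : e ∈ charts M) (i : Fin 4) :
    ContDiffOn ℝ ∞ (fun y => S.Phi e U y i) e.target ∧
      ContDiffOn ℝ ∞ (fun y => S.Psi e U y i) e.target := by
  simp only [Phi_eq hU, Psi_eq hU]
  exact (unitaryComponents hU he).contDiffOn_phi_psi i

lemma twoComp_rotated (hU : S.IsUnitary U) {A : TwoForm M} {e : OpenPartialHomeomorph M R4}
    {y : R4} {a b : ℝ} (h : A (e.symm y) = a • U (e.symm y) + b • S.star U (e.symm y)) :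
    twoComp e A y = (fun i j => a * twoComp e U y i j + b * twoComp e (S.star U) y i j) ∧
      twoComp e (S.star A) y
        = (fun i j => a * twoComp e (S.star U) y i j - b * twoComp e U y i j) ∧
      twoComp e (S.star (S.star A)) y
        = fun i j => -(a * twoComp e U y i j + b * twoComp e (S.star U) y i j) := by
  have h' : S.star A (e.symm y) = a • S.star U (e.symm y) + (-b) • U (e.symm y) := by
    rw [star_combination _ _ _ _ _ _ h, star_star hU]
    ext v
    simp
  have h'' : S.star (S.star A) (e.symm y)
      = (-a) • U (e.symm y) + (-b) • S.star U (e.symm y) := by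
    rw [star_combination _ _ _ _ _ _ h', star_star hU]
    ext v
    simp
  refine ⟨?_, ?_, ?_⟩
  · funext i j; simp [twoComp, h]
  · funext i j; simp [twoComp, h']; ring
  · funext i j; simp [twoComp, h'']; ring

/-- A 2-form obtained from `U` by a duality rotation and a dilation, in coordinates. -/
structure IsRotated (S : OrientedSpacetime M) (U A : TwoForm M) (e : OpenPartialHomeomorph M R4)
    (W : Set M) (α β : R4 → ℝ) : Prop where
  smooth_cos : ContDiffOn ℝ ∞ α (coordSet e W)
  smooth_sin : ContDiffOn ℝ ∞ β (coordSet e W)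
  ne_zero : ∀ y ∈ coordSet e W, α y ^ 2 + β y ^ 2 ≠ 0
  eq : ∀ y ∈ coordSet e W, A (e.symm y) = α y • U (e.symm y) + β y • S.star U (e.symm y)

/-- A canonical form provides `φ, ψ` only point by point, with no regularity. The coefficients of
`U` and `*U` are nevertheless smooth, being contractions of `A` with `U` and `*U`. -/
lemma exists_isRotated (hU : S.IsUnitary U) {A : TwoForm M} {W : Set M}
    (hA : SmoothOn A W) (hc : S.HasCanonicalForm U A W) {e : OpenPartialHomeomorph M R4}
    (he : e ∈ charts M) : ∃ α β, S.IsRotated U A e W α β := by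
  have H := unitaryComponents hU he
  have key : ∀ B : TwoForm M, (∀ i j, ContDiffOn ℝ ∞ (fun y => twoComp e B y i j) e.target) →
      ContDiffOn ℝ ∞ (fun y => S.contract A B (e.symm y)) (coordSet e W) := fun B hB =>
    (contDiffOn_ctrTwo (fun i j => (H.smooth_g i j).mono Set.inter_subset_left)
      (fun y hy => isUnit_det_g hU he hy.1) (hA e he)
      (fun i j => (hB i j).mono Set.inter_subset_left)).congr
      fun y hy => contract_chart hU he hy.1 A B
  have hrot : ∀ y ∈ coordSet e W, ∃ φ ψ : ℝ,
      -(1 / 2) * S.contract A U (e.symm y) = Real.exp φ * Real.cos ψ ∧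
      1 / 2 * S.contract A (S.star U) (e.symm y) = Real.exp φ * Real.sin ψ ∧
      A (e.symm y) = (Real.exp φ * Real.cos ψ) • U (e.symm y)
        + (Real.exp φ * Real.sin ψ) • S.star U (e.symm y) := by
    intro y hy
    obtain ⟨φ, ψ, h⟩ := hc _ hy.2
    rw [smul_add, smul_smul, smul_smul] at h
    obtain ⟨h1, h2, -, -⟩ := contract_rotated hU h
    exact ⟨φ, ψ, by rw [h1]; ring, by rw [h2]; ring, h⟩
  refine ⟨fun y => -(1 / 2) * S.contract A U (e.symm y),
    fun y => 1 / 2 * S.contract A (S.star U) (e.symm y),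
    contDiffOn_const.mul (key U H.smooth_U), contDiffOn_const.mul (key _ H.smooth_W),
    fun y hy => ?_, fun y hy => ?_⟩
  · obtain ⟨φ, ψ, h1, h2, -⟩ := hrot y hy
    simp only [h1, h2]
    exact exp_sq_ne_zero φ ψ
  · obtain ⟨φ, ψ, h1, h2, h3⟩ := hrot y hy
    simp only [h1, h2, h3]

namespace IsRotated

variable {A : TwoForm M} {e : OpenPartialHomeomorph M R4} {W : Set M} {α β : R4 → ℝ}

lemma eventually (R : S.IsRotated U A e W α β) (hU : S.IsUnitary U) (hW : IsOpen W) {x : R4}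
    (hx : x ∈ coordSet e W) :
    (twoComp e A =ᶠ[𝓝 x]
        fun y i j => α y * twoComp e U y i j + β y * twoComp e (S.star U) y i j) ∧
      (twoComp e (S.star A) =ᶠ[𝓝 x]
        fun y i j => α y * twoComp e (S.star U) y i j - β y * twoComp e U y i j) ∧
      (twoComp e (S.star (S.star A)) =ᶠ[𝓝 x]
        fun y i j => -(α y * twoComp e U y i j + β y * twoComp e (S.star U) y i j)) := by
  have h := (isOpen_coordSet e hW).eventually_mem hx
  exact ⟨h.mono fun y hy => (twoComp_rotated hU (R.eq y hy)).1,
    h.mono fun y hy => (twoComp_rotated hU (R.eq y hy)).2.1,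
    h.mono fun y hy => (twoComp_rotated hU (R.eq y hy)).2.2⟩

lemma smooth (R : S.IsRotated U A e W α β) (hU : S.IsUnitary U) (he : e ∈ charts M) (i j : Fin 4) :
    ContDiffOn ℝ ∞ (fun y => twoComp e A y i j) (coordSet e W) := by
  have H := unitaryComponents hU he
  have h : ContDiffOn ℝ ∞ (fun y => α y * twoComp e U y i j + β y * twoComp e (S.star U) y i j)
      (coordSet e W) :=
    (R.smooth_cos.mul ((H.smooth_U i j).mono Set.inter_subset_left)).add
      (R.smooth_sin.mul ((H.smooth_W i j).mono Set.inter_subset_left))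
  exact h.congr fun y hy => congrFun (congrFun (twoComp_rotated hU (R.eq y hy)).1 i) j

lemma cky_iff (R : S.IsRotated U A e W α β) (hU : S.IsUnitary U) (he : e ∈ charts M)
    (hW : IsOpen W) {x : R4} (hx : x ∈ coordSet e W) {p q : Fin 4 → ℝ}
    (hp : ∀ i, pd i α x = α x * p i - β x * q i)
    (hq : ∀ i, pd i β x = β x * p i + α x * q i) :
    (∃ a : Fin 4 → ℝ, (∀ i, 3 * a i = - S.codiff e A x i) ∧
      ∀ i j k, (1 / 2) * (S.nablaTwo e A x i j k + S.nablaTwo e A x j i k) =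
        S.g e x i j * a k - (1 / 2) * (a i * S.g e x j k + a j * S.g e x i k)) ↔
      (∀ k i j, S.Sig e U x k i j = 0) ∧ (∀ i, -2 * p i = S.Phi e U x i) ∧
        ∀ i, -2 * q i = S.Psi e U x i := by
  obtain ⟨h1, h2, -⟩ := R.eventually hU hW hx
  have ho := isOpen_coordSet e hW
  rw [Sig_eq_zero_iff hU, Phi_eq hU, Psi_eq hU,
    ← (unitaryComponents hU he).cky_iff hx.1 (diffAt_of_contDiffOn ho R.smooth_cos hx)
      (diffAt_of_contDiffOn ho R.smooth_sin hx) (R.ne_zero x hx) hp hq h1 h2]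
  constructor
  · rintro ⟨a, ha, h⟩ i j k
    have hi := ha i
    have hj := ha j
    have hk := ha k
    rw [codiff_eq] at hi hj hk
    have := h i j k
    simp only [nablaTwo] at this
    simp only [ckyArr]
    linear_combination this + (S.g e x i j / 3) * hk - (S.g e x j k / 6) * hi
      - (S.g e x i k / 6) * hj
  · intro h
    -- The covector is forced by `3a = -δA`.
    refine ⟨fun i => -(1 / 3) * S.codiff e A x i, fun i => by ring, fun i j k => ?_⟩
    have := h i j k
    simp only [ckyArr] at this
    simp only [nablaTwo, codiff_eq]
    linear_combination this

lemma maxwell_iff (R : S.IsRotated U A e W α β) (hU : S.IsUnitary U) (he : e ∈ charts M)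
    (hW : IsOpen W) {x : R4} (hx : x ∈ coordSet e W) {p q : Fin 4 → ℝ}
    (hp : ∀ i, pd i α x = α x * p i - β x * q i)
    (hq : ∀ i, pd i β x = β x * p i + α x * q i) :
    (∀ i, S.codiff e A x i = 0 ∧ S.codiff e (S.star A) x i = 0) ↔
      (∀ i, p i = S.Phi e U x i) ∧ ∀ i, q i = S.Psi e U x i := by
  obtain ⟨-, h2, h3⟩ := R.eventually hU hW hx
  have ho := isOpen_coordSet e hW
  rw [Phi_eq hU, Psi_eq hU]
  exact (unitaryComponents hU he).maxwell_iff hx.1 (diffAt_of_contDiffOn ho R.smooth_cos hx)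
    (diffAt_of_contDiffOn ho R.smooth_sin hx) (R.ne_zero x hx) hp hq h2 h3

/-- `p + iq` is the quotient of `d(α + iβ)` by `α + iβ`, that is, the differentials of its
log-modulus and of its argument. -/
lemma exists_logarithmic_derivative (R : S.IsRotated U A e W α β) {x : R4}
    (hx : x ∈ coordSet e W) :
    ∃ p q : Fin 4 → ℝ, (∀ i, pd i α x = α x * p i - β x * q i) ∧
      ∀ i, pd i β x = β x * p i + α x * q i := by
  have h := R.ne_zero x hx
  refine ⟨fun i => (α x * pd i α x + β x * pd i β x) / (α x ^ 2 + β x ^ 2),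
    fun i => (α x * pd i β x - β x * pd i α x) / (α x ^ 2 + β x ^ 2), fun i => ?_, fun i => ?_⟩
  · field_simp; ring
  · field_simp; ring

/-- Common to both structures: the field equations identify the logarithmic derivative with a
constant multiple of `(Φ, Ψ)`, with `c = -1/2` for CKY and `c = 1` for Maxwell. -/
lemma closed (R : S.IsRotated U A e W α β) (hU : S.IsUnitary U) (he : e ∈ charts M)
    (hW : IsOpen W) {c : ℝ} (hc : c ≠ 0)
    (h : ∀ y ∈ coordSet e W, ∀ p q : Fin 4 → ℝ, (∀ i, pd i α y = α y * p i - β y * q i) →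
      (∀ i, pd i β y = β y * p i + α y * q i) →
      (∀ i, p i = c * S.Phi e U y i) ∧ ∀ i, q i = c * S.Psi e U y i)
    {x : R4} (hx : x ∈ coordSet e W) (i j : Fin 4) :
    dOne (S.Phi e U) x i j = 0 ∧ dOne (S.Psi e U) x i j = 0 := by
  have ho := isOpen_coordSet e hW
  have sP : ∀ i, ContDiffOn ℝ ∞ (fun y => S.Phi e U y i) (coordSet e W) := fun i =>
    (contDiffOn_Phi_Psi hU he i).1.mono Set.inter_subset_left
  have sQ : ∀ i, ContDiffOn ℝ ∞ (fun y => S.Psi e U y i) (coordSet e W) := fun i =>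
    (contDiffOn_Phi_Psi hU he i).2.mono Set.inter_subset_left
  have key : ∀ y ∈ coordSet e W, ∀ i, pd i α y
      = α y * (c * S.Phi e U y i) - β y * (c * S.Psi e U y i) ∧
      pd i β y = β y * (c * S.Phi e U y i) + α y * (c * S.Psi e U y i) := by
    intro y hy i
    obtain ⟨p, q, hp, hq⟩ := R.exists_logarithmic_derivative hy
    obtain ⟨h1, h2⟩ := h y hy p q hp hq
    rw [← h1, ← h2]
    exact ⟨hp i, hq i⟩
  have hd := dOne_eq_zero_of_rotation ho R.smooth_cos R.smooth_sin
    (p := fun y i => c * S.Phi e U y i) (q := fun y i => c * S.Psi e U y i)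
    (fun i => contDiffOn_const.mul (sP i)) (fun i => contDiffOn_const.mul (sQ i))
    (fun y hy i => (key y hy i).1) (fun y hy i => (key y hy i).2) hx (R.ne_zero x hx) i j
  have hm : ∀ w : R4 → Fin 4 → ℝ, (∀ i, ContDiffOn ℝ ∞ (fun y => w y i) (coordSet e W)) →
      dOne (fun y i => c * w y i) x i j = c * dOne w x i j := by
    intro w hw
    have hwd := fun i => diffAt_of_contDiffOn ho (hw i) hx
    simp only [dOne, pd_mul (differentiableAt_const c) (hwd _), pd_const]
    ring
  rw [hm _ sP, hm _ sQ] at hd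
  exact ⟨(mul_eq_zero.mp hd.1).resolve_left hc, (mul_eq_zero.mp hd.2).resolve_left hc⟩

end IsRotated

/-! ### Passage between the structures and the differential equations for `U`. -/

lemma vanishing_of_definesCKY (hU : S.IsUnitary U) (h : S.DefinesCKY U) :
    S.SigVanishes U ∧ S.PhiClosed U ∧ S.PsiClosed U := by
  have key : ∀ e ∈ charts M, ∀ x ∈ e.target, (∀ k i j, S.Sig e U x k i j = 0) ∧
      ∀ i j, dOne (S.Phi e U) x i j = 0 ∧ dOne (S.Psi e U) x i j = 0 := by
    intro e he x hx
    obtain ⟨W, hW, hxW, A, ⟨hA, hcky⟩, -, hc⟩ := h (e.symm x)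
    obtain ⟨α, β, R⟩ := exists_isRotated hU hA hc he
    refine ⟨?_, fun i j => ?_⟩
    · obtain ⟨p, q, hp, hq⟩ := R.exists_logarithmic_derivative ⟨hx, hxW⟩
      exact ((R.cky_iff hU he hW ⟨hx, hxW⟩ hp hq).mp (hcky e he x hx hxW)).1
    · refine R.closed hU he hW (c := -(1 / 2)) (by norm_num) (fun y hy p q hp hq => ?_)
        ⟨hx, hxW⟩ i j
      obtain ⟨-, h1, h2⟩ := (R.cky_iff hU he hW hy hp hq).mp (hcky e he y hy.1 hy.2)
      exact ⟨fun i => by rw [← h1]; ring, fun i => by rw [← h2]; ring⟩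
  exact ⟨fun e he x hx => (key e he x hx).1, fun e he x hx i j => ((key e he x hx).2 i j).1,
    fun e he x hx i j => ((key e he x hx).2 i j).2⟩

lemma closed_of_definesMaxwell (hU : S.IsUnitary U) (h : S.DefinesMaxwell U) :
    S.PhiClosed U ∧ S.PsiClosed U := by
  have key : ∀ e ∈ charts M, ∀ x ∈ e.target,
      ∀ i j, dOne (S.Phi e U) x i j = 0 ∧ dOne (S.Psi e U) x i j = 0 := by
    intro e he x hx i j
    obtain ⟨W, hW, hxW, A, ⟨hA, hm⟩, -, hc⟩ := h (e.symm x)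
    obtain ⟨α, β, R⟩ := exists_isRotated hU hA hc he
    refine R.closed hU he hW one_ne_zero (fun y hy p q hp hq => ?_) ⟨hx, hxW⟩ i j
    simpa only [one_mul] using (R.maxwell_iff hU he hW hy hp hq).mp (hm e he y hy.1 hy.2)
  exact ⟨fun e he x hx i j => (key e he x hx i j).1, fun e he x hx i j => (key e he x hx i j).2⟩

lemma exists_potentials (hU : S.IsUnitary U) (hP : S.PhiClosed U) (hQ : S.PsiClosed U) (p : M) :
    ∃ W : Set M, IsOpen W ∧ p ∈ W ∧ ∃ φ ψ : M → ℝ,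
      ContMDiffOn (𝓡 4) 𝓘(ℝ, ℝ) ∞ φ W ∧ ContMDiffOn (𝓡 4) 𝓘(ℝ, ℝ) ∞ ψ W ∧
      S.PhiPotential U W φ ∧ S.PsiPotential U W ψ := by
  obtain ⟨W, hW, hpW, φ, hφ, h1⟩ := exists_local_potential (w := fun e => S.Phi e U)
    (fun e he i => (contDiffOn_Phi_Psi hU he i).1)
    (fun e he e' he' y hy => (Phi_Psi_transition hU he he' hy).1) hP p
  obtain ⟨W', hW', hpW', ψ, hψ, h2⟩ := exists_local_potential (w := fun e => S.Psi e U)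
    (fun e he i => (contDiffOn_Phi_Psi hU he i).2)
    (fun e he e' he' y hy => (Phi_Psi_transition hU he he' hy).2) hQ p
  have hr : ∀ {φ : M → ℝ} {W : Set M}, ContMDiffOn (𝓡 4) 𝓘(ℝ, ℝ) ∞ φ W →
      IsOpen W → ∀ e ∈ charts M, ∀ x ∈ e.target, e.symm x ∈ W → ∀ i,
      pd i ((fun q => -(1 / 2) * φ q) ∘ e.symm) x = -(1 / 2) * pd i (φ ∘ e.symm) x := by
    intro φ W hφ hW e he x hx hxW i
    have := pd_mul (differentiableAt_const (-(1 / 2) : ℝ))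
      (diffAt_of_contDiffOn (isOpen_coordSet e hW) (contDiffOn_comp_symm hφ he) ⟨hx, hxW⟩) i
    rw [pd_const, zero_mul, zero_add] at this
    exact this
  -- Primitives of `Φ` and `Ψ` are rescaled by `-1/2` to satisfy `-2dφ = Φ` and `-2dψ = Ψ`.
  refine ⟨W ∩ W', hW.inter hW', ⟨hpW, hpW'⟩, fun q => -(1 / 2) * φ q, fun q => -(1 / 2) * ψ q,
    (contMDiffOn_const.mul hφ).mono Set.inter_subset_left,
    (contMDiffOn_const.mul hψ).mono Set.inter_subset_right,
    fun e he x hx hxW i => ?_, fun e he x hx hxW i => ?_⟩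
  · rw [hr hφ hW e he x hx hxW.1, h1 e he x hx hxW.1]; ring
  · rw [hr hψ hW' e he x hx hxW.2, h2 e he x hx hxW.2]; ring

lemma canonical_eq (φ ψ : M → ℝ) (p : M) : S.canonical U φ ψ p
    = (Real.exp (φ p) * Real.cos (ψ p)) • U p + (Real.exp (φ p) * Real.sin (ψ p)) • S.star U p := by
  rw [canonical, smul_add, smul_smul, smul_smul]

lemma regularAt_canonical (hU : S.IsUnitary U) (φ ψ : M → ℝ) (p : M) :
    S.RegularAt (S.canonical U φ ψ) p :=
  regularAt_of_rotated hU (canonical_eq φ ψ p) (exp_sq_ne_zero _ _)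

lemma isRotated_canonical {φ ψ : M → ℝ} {W : Set M} (hφ : ContMDiffOn (𝓡 4) 𝓘(ℝ, ℝ) ∞ φ W)
    (hψ : ContMDiffOn (𝓡 4) 𝓘(ℝ, ℝ) ∞ ψ W) {e : OpenPartialHomeomorph M R4}
    (he : e ∈ charts M) : S.IsRotated U (S.canonical U φ ψ) e W
      (fun y => Real.exp ((φ ∘ e.symm) y) * Real.cos ((ψ ∘ e.symm) y))
      (fun y => Real.exp ((φ ∘ e.symm) y) * Real.sin ((ψ ∘ e.symm) y)) where
  smooth_cos := (contDiffOn_comp_symm hφ he).exp.mul (contDiffOn_comp_symm hψ he).cos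
  smooth_sin := (contDiffOn_comp_symm hφ he).exp.mul (contDiffOn_comp_symm hψ he).sin
  ne_zero _ _ := exp_sq_ne_zero _ _
  eq _ _ := canonical_eq φ ψ _

lemma pd_rotation {f h : R4 → ℝ} {x : R4} (hf : DifferentiableAt ℝ f x)
    (hh : DifferentiableAt ℝ h x) (i : Fin 4) :
    pd i (fun y => Real.exp (f y) * Real.cos (h y)) x
        = Real.exp (f x) * Real.cos (h x) * pd i f x - Real.exp (f x) * Real.sin (h x) * pd i h x ∧
      pd i (fun y => Real.exp (f y) * Real.sin (h y)) x
        = Real.exp (f x) * Real.sin (h x) * pd i f x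
          + Real.exp (f x) * Real.cos (h x) * pd i h x := by
  have e1 : pd i (fun y => Real.exp (f y)) x = Real.exp (f x) * pd i f x := by
    simp [pd, fderiv_exp hf]
  have e2 : pd i (fun y => Real.cos (h y)) x = -Real.sin (h x) * pd i h x := by
    simp [pd, fderiv_cos hh]
  have e3 : pd i (fun y => Real.sin (h y)) x = Real.cos (h x) * pd i h x := by
    simp [pd, fderiv_sin hh]
  constructor
  · rw [pd_mul hf.exp hh.cos, e1, e2]; ring
  · rw [pd_mul hf.exp hh.sin, e1, e3]; ring

lemma isCKYOn_canonical (hU : S.IsUnitary U) (hS : S.SigVanishes U) {W : Set M} (hW : IsOpen W)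
    {φ ψ : M → ℝ} (hφ : ContMDiffOn (𝓡 4) 𝓘(ℝ, ℝ) ∞ φ W)
    (hψ : ContMDiffOn (𝓡 4) 𝓘(ℝ, ℝ) ∞ ψ W) (h1 : S.PhiPotential U W φ)
    (h2 : S.PsiPotential U W ψ) : S.IsCKYOn (S.canonical U φ ψ) W := by
  refine ⟨fun e he i j => (isRotated_canonical hφ hψ he).smooth hU he i j,
    fun e he x hx hxW => ?_⟩
  have ho := isOpen_coordSet e hW
  have hd := fun i => pd_rotation
    (diffAt_of_contDiffOn ho (contDiffOn_comp_symm hφ he) ⟨hx, hxW⟩)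
    (diffAt_of_contDiffOn ho (contDiffOn_comp_symm hψ he) ⟨hx, hxW⟩) i
  exact ((isRotated_canonical hφ hψ he).cky_iff hU he hW ⟨hx, hxW⟩ (fun i => (hd i).1)
    fun i => (hd i).2).mpr ⟨hS e he x hx, h1 e he x hx hxW, h2 e he x hx hxW⟩

/-- The Maxwell equations need `p = Φ` and `q = Ψ`, whereas the potentials satisfy `-2dφ = Φ` and
`-2dψ = Ψ`: hence the exponents `-2φ` and `-2ψ`. -/
lemma isMaxwellOn_canonical (hU : S.IsUnitary U) {W : Set M} (hW : IsOpen W)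
    {φ ψ : M → ℝ} (hφ : ContMDiffOn (𝓡 4) 𝓘(ℝ, ℝ) ∞ φ W)
    (hψ : ContMDiffOn (𝓡 4) 𝓘(ℝ, ℝ) ∞ ψ W)
    (h1 : S.PhiPotential U W φ) (h2 : S.PsiPotential U W ψ) :
    S.IsMaxwellOn (S.canonical U (fun p => -2 * φ p) fun p => -2 * ψ p) W := by
  have hφ' : ContMDiffOn (𝓡 4) 𝓘(ℝ, ℝ) ∞ (fun p => -2 * φ p) W := contMDiffOn_const.mul hφ
  have hψ' : ContMDiffOn (𝓡 4) 𝓘(ℝ, ℝ) ∞ (fun p => -2 * ψ p) W := contMDiffOn_const.mul hψ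
  refine ⟨fun e he i j => (isRotated_canonical hφ' hψ' he).smooth hU he i j,
    fun e he x hx hxW => ?_⟩
  have ho := isOpen_coordSet e hW
  have hd := fun i => pd_rotation
    (diffAt_of_contDiffOn ho (contDiffOn_comp_symm hφ' he) ⟨hx, hxW⟩)
    (diffAt_of_contDiffOn ho (contDiffOn_comp_symm hψ' he) ⟨hx, hxW⟩) i
  have hm : ∀ {φ : M → ℝ}, ContMDiffOn (𝓡 4) 𝓘(ℝ, ℝ) ∞ φ W → ∀ i,
      pd i ((fun p => -2 * φ p) ∘ e.symm) x = -2 * pd i (φ ∘ e.symm) x := by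
    intro φ hφ i
    have := pd_mul (differentiableAt_const (-2 : ℝ))
      (diffAt_of_contDiffOn ho (contDiffOn_comp_symm hφ he) ⟨hx, hxW⟩) i
    rw [pd_const, zero_mul, zero_add] at this
    exact this
  exact ((isRotated_canonical hφ' hψ' he).maxwell_iff hU he hW ⟨hx, hxW⟩ (fun i => (hd i).1)
    fun i => (hd i).2).mpr ⟨fun i => by rw [hm hφ, h1 e he x hx hxW],
      fun i => by rw [hm hψ, h2 e he x hx hxW]⟩

lemma definesCKY_iff (hU : S.IsUnitary U) :
    S.DefinesCKY U ↔ S.SigVanishes U ∧ S.PhiClosed U ∧ S.PsiClosed U := by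
  refine ⟨vanishing_of_definesCKY hU, fun ⟨hS, hP, hQ⟩ p => ?_⟩
  obtain ⟨W, hW, hp, φ, ψ, hφ, hψ, h1, h2⟩ := exists_potentials hU hP hQ p
  exact ⟨W, hW, hp, S.canonical U φ ψ, isCKYOn_canonical hU hS hW hφ hψ h1 h2,
    fun q _ => regularAt_canonical hU φ ψ q, fun q _ => ⟨φ q, ψ q, rfl⟩⟩

lemma definesMaxwell_iff (hU : S.IsUnitary U) :
    S.DefinesMaxwell U ↔ S.PhiClosed U ∧ S.PsiClosed U := by
  refine ⟨closed_of_definesMaxwell hU, fun ⟨hP, hQ⟩ p => ?_⟩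
  obtain ⟨W, hW, hp, φ, ψ, hφ, hψ, h1, h2⟩ := exists_potentials hU hP hQ p
  exact ⟨W, hW, hp, _, isMaxwellOn_canonical hU hW hφ hψ h1 h2,
    fun q _ => regularAt_canonical hU _ _ q, fun q _ => ⟨_, _, rfl⟩⟩

end OrientedSpacetime

end

end

end CKY

theorem mainTheorem4 {M : Type*} [TopologicalSpace M] [ChartedSpace CKY.R4 M]
    [IsManifold (𝓡 4) ∞ M] (S : CKY.OrientedSpacetime M) (U : CKY.TwoForm M)
    (hU : S.IsUnitary U) :
    (S.DefinesCKY U ↔ S.IsUmbilical U ∧ S.DefinesMaxwell U) ∧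
    (S.DefinesCKY U ↔ S.SigVanishes U ∧ S.PhiClosed U ∧ S.PsiClosed U) ∧
    (S.SigVanishes U → S.PhiClosed U → S.PsiClosed U →
      (∀ p : M, ∃ W : Set M, IsOpen W ∧ p ∈ W ∧ ∃ φ ψ : M → ℝ,
        ContMDiffOn (𝓡 4) 𝓘(ℝ, ℝ) ∞ φ W ∧ ContMDiffOn (𝓡 4) 𝓘(ℝ, ℝ) ∞ ψ W ∧
        S.PhiPotential U W φ ∧ S.PsiPotential U W ψ) ∧
      ∀ (W : Set M) (φ ψ : M → ℝ), IsOpen W →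
        ContMDiffOn (𝓡 4) 𝓘(ℝ, ℝ) ∞ φ W → ContMDiffOn (𝓡 4) 𝓘(ℝ, ℝ) ∞ ψ W →
        S.PhiPotential U W φ → S.PsiPotential U W ψ →
        (∀ q ∈ W, S.RegularAt (S.canonical U φ ψ) q) ∧
        S.IsCKYOn (S.canonical U φ ψ) W) := by
  have hc := CKY.OrientedSpacetime.definesCKY_iff hU
  refine ⟨?_, hc, fun hS hP hQ => ⟨CKY.OrientedSpacetime.exists_potentials hU hP hQ,
    fun W φ ψ hW hφ hψ h1 h2 => ⟨fun q _ => CKY.OrientedSpacetime.regularAt_canonical hU φ ψ q,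
      CKY.OrientedSpacetime.isCKYOn_canonical hU hS hW hφ hψ h1 h2⟩⟩⟩
  rw [hc, CKY.OrientedSpacetime.isUmbilical_iff_sigVanishes hU,
    CKY.OrientedSpacetime.definesMaxwell_iff hU]
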